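/- Let $\mathbb T=\mathbb R/\mathbb Z$ and write $x=(x_\perp,x_\parallel)\in\mathbb T^3$ with $x_\perp=(x_1,x_2)\in\mathbb T^2$, $x_\parallel\in\mathbb T$; all integrals are with respect to the normalized Haar measure, and $\int\cdot\,dx_\perp$ is the integral over $\mathbb T^2$. For $\delta>1$ let $B_\delta$ be the space of real continuous functions $\phi$ on $\mathbb T^3$ with $$|\phi|_\delta=\sum_{k\in\mathbb Z^3}|\mathcal F\phi(k)|\,\delta^{|k|}<\infty,\qquad \mathcal F\phi(k)=\int_{\mathbb T^3}\phi(x)e^{-2\pi i k\cdot x}\,dx,$$ where $|k|$ is the Euclidean norm. Consider, for $\rho(t,x)$, $v(t,x)=v_\parallel(t,x)$ and a pressure $p(t,x_\parallel)$ on $\mathbb T$, the system $$\begin{cases}\partial_t\rho+\nabla_\perp\cdot(E^\perp\rho)+\partial_\parallel(v\rho)=0,\\ \partial_t v+\nabla_\perp\cdot(E^\perp v)+v\,\partial_\parallel v=-\partial_\parallel p(t,x_\parallel),\\ E^\perp=\nabla^\perp\Delta_\perp^{-1}\left(\rho-\int\rho\,dx_\perp\right),\\ \int\rho\,dx_\perp=1,\end{cases}\tag{S}$$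 where $\nabla^\perp=(\partial_{x_2},-\partial_{x_1})$, and $\Delta_\perp^{-1}f$, for $f$ with $\int f\,dx_\perp=0$, is the solution $\psi$ of $\Delta_\perp\psi=f$ with $\int\psi\,dx_\perp=0$. Let $\delta_0>1$ and let $\rho_0,v_0\in B_{\delta_0}$ satisfy $\rho_0\ge0$, $\int\rho_0\,dx_\perp=1$ and $\partial_\parallel\int\rho_0v_0\,dx_\perp=0$ for every $x_\parallel$. Then there is $\eta>0$, depending only on $\delta_0$ and on $(\rho_0,v_0)$, such that for every $\delta_1\in(1,\delta_0)$, with $T=\eta(\delta_0-\delta_1)$, there is a unique strong solution $(\rho,v,p)$ of (S) on $[0,T)$ with $\rho(0)=\rho_0$, $v(0)=v_0$ and $\rho,v\in C([0,T),B_\delta)$ for all $1<\delta<\delta_1$. Here a strong solution satisfies (S) pointwise at every $t\in[0,T)$ and every $x$ (the time derivative being one-sided at $t=0$), with $p(t,\cdot)$ differentiable on $\mathbb T$; uniqueness means that $\rho$ and $v$ are unique and that $p(t,\cdot)$ is unique up to an additive constant for each $t$. Moreover, on $[0,T)$, $$-\partial_\parallel p=\partial_\parallel\int\rho v^2\,dx_\perp.$$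 -/

import Mathlib

noncomputable section

namespace DriftFluid

open Filter Topology Set MeasureTheory

/-- The torus `𝕋³ = (ℝ/ℤ)³`. The coordinates `0, 1` are the perpendicular ones, the coordinate `2`
is the parallel one. -/
abbrev T3 : Type := UnitAddTorus (Fin 3)

/-- The Fourier coefficient `∫_{𝕋³} φ(x) e^{-2πi k·x} dx` (normalized Haar measure). -/
def fourierC (φ : T3 → ℝ) (k : Fin 3 → ℤ) : ℂ :=
  UnitAddTorus.mFourierCoeff (fun x => (φ x : ℂ)) k

/-- The Euclidean length `|k|` of a frequency. -/
def freqNorm (k : Fin 3 → ℤ) : ℝ := Real.sqrt (∑ i, (k i : ℝ) ^ 2)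

/-- Membership in the analytic space `B_δ`. Continuity selects the continuous representative, and
makes the Fourier coefficients meaningful. -/
def MemB (δ : ℝ) (φ : T3 → ℝ) : Prop :=
  Continuous φ ∧ Summable fun k : Fin 3 → ℤ => ‖fourierC φ k‖ * δ ^ freqNorm k

/-- The norm `|φ|_δ = ∑ₖ |𝓕φ(k)| δ^{|k|}` of `B_δ`. -/
def normB (δ : ℝ) (φ : T3 → ℝ) : ℝ := ∑' k : Fin 3 → ℤ, ‖fourierC φ k‖ * δ ^ freqNorm k

/-- `u ∈ C([0,T), B_δ)`. -/
def ContinuousInB (T δ : ℝ) (u : ℝ → T3 → ℝ) : Prop :=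
  (∀ t ∈ Ico 0 T, MemB δ (u t)) ∧
    ∀ t ∈ Ico 0 T, Tendsto (fun s => normB δ (fun x => u s x - u t x)) (𝓝[Ico 0 T] t) (𝓝 0)

/-- The partial derivative `∂_i f (x)` on `𝕋³`. -/
def pd (i : Fin 3) (f : T3 → ℝ) (x : T3) : ℝ :=
  deriv (fun s : ℝ => f (x + Pi.single i (s : UnitAddCircle))) 0

/-- The derivative `∂_∥ g (z)` of a function of the parallel variable only. -/
def dPar (g : UnitAddCircle → ℝ) (z : UnitAddCircle) : ℝ :=
  deriv (fun s : ℝ => g (z + (s : UnitAddCircle))) 0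

/-- The perpendicular average `∫ φ dx_⊥`, a function of the parallel variable. -/
def perpMean (φ : T3 → ℝ) (z : UnitAddCircle) : ℝ :=
  ∫ a : UnitAddCircle, ∫ b : UnitAddCircle, φ ![a, b, z]
    ∂AddCircle.haarAddCircle ∂AddCircle.haarAddCircle

/-- `Δ_⊥⁻¹ f`, the solution `ψ` of `Δ_⊥ ψ = f` with `∫ ψ dx_⊥ = 0`, for `f` with `∫ f dx_⊥ = 0`:
the Fourier multiplier `-1 / (4π² |k_⊥|²)` on the frequencies with `k_⊥ ≠ 0`. (At `k_⊥ = 0` the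
quotient is `0`. The sum is real since `f` is.) -/
def invLaplacePerp (f : T3 → ℝ) (x : T3) : ℝ :=
  (∑' k : Fin 3 → ℤ,
    (-(fourierC f k) / ((4 * Real.pi ^ 2 * ((k 0 : ℝ) ^ 2 + (k 1 : ℝ) ^ 2) : ℝ) : ℂ)) *
      UnitAddTorus.mFourier k x).re

/-- The potential `Δ_⊥⁻¹ (ρ - ∫ ρ dx_⊥)`. -/
def potential (ρ : T3 → ℝ) : T3 → ℝ :=
  invLaplacePerp fun x => ρ x - perpMean ρ (x 2)

/-- First component of `E^⊥ = ∇^⊥ Δ_⊥⁻¹ (ρ - ∫ ρ dx_⊥)`, where `∇^⊥ = (∂₂, -∂₁)`. -/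
def drift₁ (ρ : T3 → ℝ) (x : T3) : ℝ := pd 1 (potential ρ) x

/-- Second component of `E^⊥`. -/
def drift₂ (ρ : T3 → ℝ) (x : T3) : ℝ := -pd 0 (potential ρ) x

/-- `∇_⊥ · (E^⊥ f)`, where `E^⊥` is the drift created by `ρ`. -/
def driftDiv (ρ f : T3 → ℝ) (x : T3) : ℝ :=
  pd 0 (fun y => drift₁ ρ y * f y) x + pd 1 (fun y => drift₂ ρ y * f y) x

/-- `(ρ, v, p)` is a strong solution on `[0,T)` of the drift-fluid system with initial data
`(ρ₀, v₀)`, with `ρ, v ∈ C([0,T), B_δ)` for all `1 < δ < δ₁`. The pressure `p(t, ·)` is a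
differentiable function on the circle. The time derivative is one-sided at `t = 0`. -/
structure IsStrongSolution (δ₁ T : ℝ) (ρ₀ v₀ : T3 → ℝ)
    (ρ v : ℝ → T3 → ℝ) (p : ℝ → UnitAddCircle → ℝ) : Prop where
  rho_mem : ∀ δ, 1 < δ → δ < δ₁ → ContinuousInB T δ ρ
  v_mem : ∀ δ, 1 < δ → δ < δ₁ → ContinuousInB T δ v
  p_diff : ∀ t ∈ Ico 0 T, Differentiable ℝ fun s : ℝ => p t (s : UnitAddCircle)
  init_rho : ρ 0 = ρ₀
  init_v : v 0 = v₀
  eq_rho : ∀ t ∈ Ico 0 T, ∀ x : T3,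
    HasDerivWithinAt (fun s => ρ s x)
      (-(driftDiv (ρ t) (ρ t) x + pd 2 (fun y => v t y * ρ t y) x)) (Ico 0 T) t
  eq_v : ∀ t ∈ Ico 0 T, ∀ x : T3,
    HasDerivWithinAt (fun s => v s x)
      (-(driftDiv (ρ t) (v t) x + v t x * pd 2 (v t) x) - dPar (p t) (x 2)) (Ico 0 T) t
  constraint : ∀ t ∈ Ico 0 T, ∀ z, perpMean (ρ t) z = 1

end DriftFluid

end

/-!
On the Fourier side every differential operator in the system is multiplication by a symbol of size
`O(|k|)`, so it costs at most a factor `O(1 / (δ' - δ))` from `B_δ'` to `B_δ`, while each `B_δ` is a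
Banach algebra and `E^⊥` is of order `-1` in `ρ`. Averaging the velocity equation against `ρ`, the
constraint `∫ ρ dx_⊥ = 1` gives the pressure law up to a function of time, which vanishes by
periodicity in `x_∥`. Conversely, under the pressure law the deviation of `∫ ρ dx_⊥` from `1` and
the derivative of the current solve a linear system with loss of one derivative and zero data.

Such a system, like the one for the difference of two solutions, has only the zero solution:
iterating the estimate `n` times over `n` nested radii loses a factor `(C n)ⁿ`, which on a short
time interval is beaten by the `tⁿ / n!` of the iterated time integrals. For existence, the
nonlinearity is polynomial, so the Taylor coefficients in time are given by a recursion. By the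
Cauchy–Kovalevskaya majorant `κⁿ / (n + 1)²` with `κ = c / (δ₀ - δ)` they decay geometrically in
each `B_δ`, whence a lifespan proportional to `δ₀ - δ`.
-/

noncomputable section

namespace DriftFluid

open Filter Topology Set MeasureTheory

open scoped ENNReal NNReal

section WeightedNorm

variable {G E : Type*} [NormedAddCommGroup E]

/-- The weighted `ℓ¹` norm `∑ₖ ‖a k‖ w k` of a family, with values in `[0, ∞]`. For `w k = δ^{|k|}`
and the Fourier coefficients of `φ` it is the norm `|φ|_δ`. -/
def wnorm (w : G → ℝ≥0) (a : G → E) : ℝ≥0∞ := ∑' k, ‖a k‖ₑ * w k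

/-- `a` has weighted `ℓ¹` norm at most the real number `β ≥ 0`. -/
def WNormLE (w : G → ℝ≥0) (a : G → E) (β : ℝ) : Prop := 0 ≤ β ∧ wnorm w a ≤ ENNReal.ofReal β

variable {w w' : G → ℝ≥0} {a b : G → E} {β γ C : ℝ}

lemma wnorm_mono (h : w ≤ w') (a : G → E) : wnorm w a ≤ wnorm w' a :=
  ENNReal.tsum_le_tsum fun k => by gcongr; exact h k

lemma wnorm_add_le (w : G → ℝ≥0) (a b : G → E) : wnorm w (a + b) ≤ wnorm w a + wnorm w b := by
  rw [wnorm, wnorm, wnorm, ← ENNReal.tsum_add]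
  refine ENNReal.tsum_le_tsum fun k => ?_
  rw [← add_mul]
  gcongr
  exact enorm_add_le _ _

lemma wnorm_tsum_le {ι : Type*} (w : G → ℝ≥0) (X : ι → G → E) :
    wnorm w (fun k => ∑' n, X n k) ≤ ∑' n, wnorm w (X n) := by
  simp only [wnorm]
  rw [ENNReal.tsum_comm]
  refine ENNReal.tsum_le_tsum fun k => ?_
  rw [ENNReal.tsum_mul_right]
  gcongr
  exact enorm_tsum_le_tsum_enorm

lemma enorm_le_wnorm (hw : 1 ≤ w) (a : G → E) (k : G) : ‖a k‖ₑ ≤ wnorm w a :=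
  calc ‖a k‖ₑ ≤ ‖a k‖ₑ * w k := le_mul_of_one_le_right' (by exact_mod_cast hw k)
    _ ≤ wnorm w a := ENNReal.le_tsum k

lemma tsum_enorm_le_wnorm (hw : 1 ≤ w) (a : G → E) : ∑' k, ‖a k‖ₑ ≤ wnorm w a :=
  ENNReal.tsum_le_tsum fun k => le_mul_of_one_le_right' (by exact_mod_cast hw k)

lemma summable_norm_of_wnorm_ne_top (hw : 1 ≤ w) (h : wnorm w a ≠ ⊤) :
    Summable fun k => ‖a k‖ := by
  simpa using ENNReal.summable_toReal (ne_top_of_le_ne_top h (tsum_enorm_le_wnorm hw a))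

lemma wNormLE_iff_forall_finset :
    WNormLE w a β ↔ ∀ s : Finset G, ∑ k ∈ s, ‖a k‖ * w k ≤ β := by
  have sum_eq (s : Finset G) :
      ∑ k ∈ s, ‖a k‖ₑ * (w k : ℝ≥0∞) = ENNReal.ofReal (∑ k ∈ s, ‖a k‖ * w k) := by
    rw [ENNReal.ofReal_sum_of_nonneg fun k _ => by positivity]
    exact Finset.sum_congr rfl fun k _ => by simp [ENNReal.ofReal_mul]
  rw [WNormLE, wnorm, ENNReal.tsum_eq_iSup_sum, iSup_le_iff]
  constructor
  · rintro ⟨hβ, h⟩ s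
    simpa only [sum_eq, ENNReal.ofReal_le_ofReal_iff hβ] using h s
  · intro h
    exact ⟨by simpa using h ∅, fun s => (sum_eq s).trans_le (ENNReal.ofReal_le_ofReal (h s))⟩

namespace WNormLE

lemma nonneg (h : WNormLE w a β) : 0 ≤ β := h.1

lemma wnorm_ne_top (h : WNormLE w a β) : wnorm w a ≠ ⊤ :=
  ne_top_of_le_ne_top ENNReal.ofReal_ne_top h.2

lemma of_wnorm_ne_top (h : wnorm w a ≠ ⊤) : WNormLE w a (wnorm w a).toReal :=
  ⟨ENNReal.toReal_nonneg, (ENNReal.ofReal_toReal h).ge⟩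

lemma summable_norm (h : WNormLE w a β) (hw : 1 ≤ w) : Summable fun k => ‖a k‖ :=
  summable_norm_of_wnorm_ne_top hw h.wnorm_ne_top

lemma mono (h : WNormLE w a β) (hβ : β ≤ γ) : WNormLE w a γ :=
  ⟨h.1.trans hβ, h.2.trans (ENNReal.ofReal_le_ofReal hβ)⟩

lemma mono_weight (h : WNormLE w' a β) (hw : w ≤ w') : WNormLE w a β :=
  ⟨h.1, (wnorm_mono hw a).trans h.2⟩

lemma zero (hβ : 0 ≤ β) : WNormLE w (0 : G → E) β := ⟨hβ, by simp [wnorm]⟩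

lemma add (ha : WNormLE w a β) (hb : WNormLE w b γ) : WNormLE w (a + b) (β + γ) :=
  ⟨add_nonneg ha.1 hb.1, (wnorm_add_le w a b).trans <| by
    rw [ENNReal.ofReal_add ha.1 hb.1]; exact add_le_add ha.2 hb.2⟩

lemma neg (ha : WNormLE w a β) : WNormLE w (-a) β := by simpa [WNormLE, wnorm] using ha

lemma sub (ha : WNormLE w a β) (hb : WNormLE w b γ) : WNormLE w (a - b) (β + γ) :=
  sub_eq_add_neg a b ▸ ha.add hb.neg

lemma sum {ι : Type*} {s : Finset ι} {X : ι → G → E} {B : ι → ℝ}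
    (h : ∀ i ∈ s, WNormLE w (X i) (B i)) : WNormLE w (∑ i ∈ s, X i) (∑ i ∈ s, B i) := by
  classical
  induction s using Finset.induction_on with
  | empty => exact zero le_rfl
  | insert i s hi ih =>
    rw [Finset.sum_insert hi, Finset.sum_insert hi]
    exact (h i (Finset.mem_insert_self i s)).add
      (ih fun j hj => h j (Finset.mem_insert_of_mem hj))

lemma tsum {ι : Type*} {X : ι → G → E} {B : ι → ℝ} (h : ∀ i, WNormLE w (X i) (B i))
    (hB : Summable B) : WNormLE w (fun k => ∑' i, X i k) (∑' i, B i) := by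
  refine ⟨tsum_nonneg fun i => (h i).1, (wnorm_tsum_le w X).trans ?_⟩
  rw [ENNReal.ofReal_tsum_of_nonneg (fun i => (h i).1) hB]
  exact ENNReal.tsum_le_tsum fun i => (h i).2

lemma of_norm_mul_weight_le {F : Type*} [NormedAddCommGroup F] {b : G → F}
    (ha : WNormLE w' a β) (hC : 0 ≤ C) (h : ∀ k, ‖b k‖ * w k ≤ C * (‖a k‖ * w' k)) :
    WNormLE w b (C * β) :=
  wNormLE_iff_forall_finset.2 fun s =>
    calc ∑ k ∈ s, ‖b k‖ * w k ≤ C * ∑ k ∈ s, ‖a k‖ * w' k := by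
          rw [Finset.mul_sum]; exact Finset.sum_le_sum fun k _ => h k
      _ ≤ C * β := by gcongr; exact wNormLE_iff_forall_finset.1 ha s

lemma of_norm_le_norm (ha : WNormLE w a β) (h : ∀ k, ‖b k‖ ≤ ‖a k‖) : WNormLE w b β := by
  simpa using ha.of_norm_mul_weight_le zero_le_one fun k => by
    simpa using mul_le_mul_of_nonneg_right (h k) (w k).coe_nonneg

lemma smul {𝕜 : Type*} [NormedField 𝕜] [NormedSpace 𝕜 E] (ha : WNormLE w a β) (c : 𝕜) :
    WNormLE w (c • a) (‖c‖ * β) :=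
  ha.of_norm_mul_weight_le (norm_nonneg c) fun k => by
    rw [Pi.smul_apply, norm_smul, mul_assoc]

lemma norm_apply_le (ha : WNormLE w a β) (hw : 1 ≤ w) (k : G) : ‖a k‖ ≤ β := by
  have h := (enorm_le_wnorm hw a k).trans ha.2
  rwa [← ofReal_norm, ENNReal.ofReal_le_ofReal_iff ha.1] at h

lemma tsum_norm_le (ha : WNormLE w a β) (hw : 1 ≤ w) : ∑' k, ‖a k‖ ≤ β := by
  have h := ENNReal.toReal_mono ENNReal.ofReal_ne_top ((tsum_enorm_le_wnorm hw a).trans ha.2)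
  rw [ENNReal.toReal_ofReal ha.1, ENNReal.tsum_toReal_eq fun _ => enorm_ne_top] at h
  simpa using h

end WNormLE

end WeightedNorm

section Convolution

variable {G R : Type*} [AddCommGroup G] [NormedRing R] {w : G → ℝ≥0} {a a' b b' : G → R}
  {A B β γ ε ε' : ℝ}

/-- The convolution of two families, the Fourier coefficients of a product. -/
def conv (a b : G → R) : G → R := fun n => ∑' l, a (n - l) * b l

lemma wnorm_conv_le (hw : ∀ k l, w (k + l) ≤ w k * w l) (a b : G → R) :
    wnorm w (conv a b) ≤ wnorm w a * wnorm w b := by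
  have term_le (n l : G) :
      ‖a (n - l) * b l‖ₑ * w n ≤ (‖a (n - l)‖ₑ * w (n - l)) * (‖b l‖ₑ * w l) := by
    have hwn : (w n : ℝ≥0∞) ≤ w (n - l) * w l := by
      exact_mod_cast sub_add_cancel n l ▸ hw (n - l) l
    calc ‖a (n - l) * b l‖ₑ * w n ≤ (‖a (n - l)‖ₑ * ‖b l‖ₑ) * (w (n - l) * w l) :=
          mul_le_mul' (ENNReal.coe_le_coe.2 (nnnorm_mul_le _ _)) hwn
      _ = _ := by ring
  calc wnorm w (conv a b)
      ≤ ∑' n, (∑' l, ‖a (n - l) * b l‖ₑ) * w n :=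
        ENNReal.tsum_le_tsum fun n => mul_le_mul_left enorm_tsum_le_tsum_enorm _
    _ ≤ ∑' n, ∑' l, (‖a (n - l)‖ₑ * w (n - l)) * (‖b l‖ₑ * w l) :=
        ENNReal.tsum_le_tsum fun n => by
          rw [← ENNReal.tsum_mul_right]
          exact ENNReal.tsum_le_tsum (term_le n)
    _ = ∑' l, ∑' n, (‖a (n - l)‖ₑ * w (n - l)) * (‖b l‖ₑ * w l) := ENNReal.tsum_comm
    _ = ∑' l, wnorm w a * (‖b l‖ₑ * w l) := tsum_congr fun l => by
        rw [ENNReal.tsum_mul_right]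
        exact congrArg (· * _) ((Equiv.subRight l).tsum_eq fun n => ‖a n‖ₑ * (w n : ℝ≥0∞))
    _ = wnorm w a * wnorm w b := ENNReal.tsum_mul_left

lemma WNormLE.convolve (ha : WNormLE w a β) (hb : WNormLE w b γ)
    (hw : ∀ k l, w (k + l) ≤ w k * w l) : WNormLE w (conv a b) (β * γ) :=
  ⟨mul_nonneg ha.1 hb.1, (wnorm_conv_le hw a b).trans <| by
    rw [ENNReal.ofReal_mul ha.1]; exact mul_le_mul' ha.2 hb.2⟩

lemma summable_norm_conv_term (ha : Summable fun k => ‖a k‖) (hb : Summable fun k => ‖b k‖)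
    (n : G) : Summable fun l => ‖a (n - l) * b l‖ := by
  refine Summable.of_nonneg_of_le (fun _ => norm_nonneg _) (fun l => ?_)
    (hb.mul_left (∑' k, ‖a k‖))
  refine (norm_mul_le _ _).trans ?_
  gcongr
  exact ha.le_tsum (n - l) fun _ _ => norm_nonneg _

variable [CompleteSpace R]

lemma conv_sub_left (ha : Summable fun k => ‖a k‖) (ha' : Summable fun k => ‖a' k‖)
    (hb : Summable fun k => ‖b k‖) : conv (a - a') b = conv a b - conv a' b := by
  ext n
  simp only [conv, Pi.sub_apply, sub_mul]
  exact (summable_norm_conv_term ha hb n).of_norm.tsum_sub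
    (summable_norm_conv_term ha' hb n).of_norm

lemma conv_sub_right (ha : Summable fun k => ‖a k‖) (hb : Summable fun k => ‖b k‖)
    (hb' : Summable fun k => ‖b' k‖) : conv a (b - b') = conv a b - conv a b' := by
  ext n
  simp only [conv, Pi.sub_apply, mul_sub]
  exact (summable_norm_conv_term ha hb n).of_norm.tsum_sub
    (summable_norm_conv_term ha hb' n).of_norm

lemma WNormLE.conv_sub_conv (hw₁ : 1 ≤ w) (hw : ∀ k l, w (k + l) ≤ w k * w l)
    (ha : WNormLE w a A) (ha' : WNormLE w a' A) (hb : WNormLE w b B) (hb' : WNormLE w b' B)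
    (hda : WNormLE w (a - a') ε) (hdb : WNormLE w (b - b') ε') :
    WNormLE w (conv a b - conv a' b') (ε * B + A * ε') := by
  have split : conv a b - conv a' b' = conv (a - a') b + conv a' (b - b') := by
    rw [conv_sub_left (ha.summable_norm hw₁) (ha'.summable_norm hw₁) (hb.summable_norm hw₁),
      conv_sub_right (ha'.summable_norm hw₁) (hb.summable_norm hw₁) (hb'.summable_norm hw₁)]
    abel
  rw [split]
  exact (hda.convolve hb hw).add (ha'.convolve hdb hw)

end Convolution

lemma WNormLE.mul_of_norm_le_one {G R : Type*} [NormedRing R] {w : G → ℝ≥0} {m a : G → R} {β : ℝ}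
    (ha : WNormLE w a β) (hm : ∀ k, ‖m k‖ ≤ 1) : WNormLE w (m * a) β :=
  ha.of_norm_le_norm fun k =>
    (norm_mul_le _ _).trans (mul_le_of_le_one_left (norm_nonneg _) (hm k))

section Hermitian

variable {G : Type*}

/-- The symmetry `a₋ₖ = conj aₖ` of the Fourier coefficients of a real function. -/
def Hermitian [Neg G] (a : G → ℂ) : Prop := ∀ k, a (-k) = (starRingEnd ℂ) (a k)

namespace Hermitian

section Neg

variable [Neg G] {a b : G → ℂ}

lemma add (ha : Hermitian a) (hb : Hermitian b) : Hermitian (a + b) :=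
  fun k => by simp [ha k, hb k]

lemma neg (ha : Hermitian a) : Hermitian (-a) := fun k => by simp [ha k]

lemma mul (ha : Hermitian a) (hb : Hermitian b) : Hermitian (a * b) :=
  fun k => by simp [ha k, hb k]

lemma real_smul (ha : Hermitian a) (c : ℝ) : Hermitian ((c : ℂ) • a) := fun k => by simp [ha k]

lemma sum {ι : Type*} {s : Finset ι} {X : ι → G → ℂ} (h : ∀ i ∈ s, Hermitian (X i)) :
    Hermitian (∑ i ∈ s, X i) := fun k => by
  simp only [Finset.sum_apply, map_sum]
  exact Finset.sum_congr rfl fun i hi => h i hi k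

end Neg

lemma convolve [AddCommGroup G] {a b : G → ℂ} (ha : Hermitian a) (hb : Hermitian b) :
    Hermitian (conv a b) := fun k => by
  simp only [conv, Complex.conj_tsum, map_mul]
  rw [← (Equiv.neg G).tsum_eq]
  refine tsum_congr fun l => ?_
  rw [Equiv.neg_apply, ← ha, ← hb, neg_sub_neg, neg_sub]

end Hermitian

end Hermitian

section Frequencies

lemma freqNorm_eq_norm (k : Fin 3 → ℤ) :
    freqNorm k = ‖(WithLp.toLp 2 fun i => (k i : ℝ) : EuclideanSpace ℝ (Fin 3))‖ := by
  simp [freqNorm, EuclideanSpace.norm_eq]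

lemma freqNorm_nonneg (k : Fin 3 → ℤ) : 0 ≤ freqNorm k := Real.sqrt_nonneg _

lemma freqNorm_add_le (k l : Fin 3 → ℤ) : freqNorm (k + l) ≤ freqNorm k + freqNorm l := by
  simp only [freqNorm_eq_norm]
  refine le_trans (le_of_eq ?_) (norm_add_le _ _)
  congr 1
  ext i
  simp

lemma freqNorm_zero : freqNorm 0 = 0 := by simp [freqNorm]

lemma abs_le_freqNorm (k : Fin 3 → ℤ) (i : Fin 3) : |(k i : ℝ)| ≤ freqNorm k := by
  rw [freqNorm, ← Real.sqrt_sq_eq_abs]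
  exact Real.sqrt_le_sqrt (Finset.single_le_sum (f := fun j => (k j : ℝ) ^ 2)
    (fun j _ => sq_nonneg _) (Finset.mem_univ i))

lemma one_le_freqNorm {k : Fin 3 → ℤ} (hk : k ≠ 0) : 1 ≤ freqNorm k := by
  obtain ⟨i, hi⟩ := Function.ne_iff.mp hk
  refine le_trans ?_ (abs_le_freqNorm k i)
  exact_mod_cast Int.one_le_abs hi

lemma mul_rpow_le_rpow_of_lt {δ δ' x : ℝ} (hδ : 0 < δ) (h : δ < δ') (hx : 1 ≤ x) :
    x * δ ^ x ≤ δ / (δ' - δ) * δ' ^ x := by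
  have hgap : 0 < δ' - δ := sub_pos.2 h
  have bernoulli : x * ((δ' - δ) / δ) ≤ (δ' / δ) ^ x := by
    have h := one_add_mul_self_le_rpow_one_add (s := (δ' - δ) / δ)
      (by linarith [div_pos hgap hδ]) hx
    rw [sub_div, div_self hδ.ne', add_sub_cancel] at h
    rw [sub_div, div_self hδ.ne']
    linarith
  calc x * δ ^ x = δ / (δ' - δ) * (x * ((δ' - δ) / δ)) * δ ^ x := by field_simp
    _ ≤ δ / (δ' - δ) * (δ' / δ) ^ x * δ ^ x := by gcongr
    _ = δ / (δ' - δ) * δ' ^ x := by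
      rw [Real.div_rpow (hδ.trans h).le hδ.le, mul_assoc,
        div_mul_cancel₀ _ (Real.rpow_pos_of_pos hδ x).ne']

lemma freqNorm_mul_rpow_le {δ δ' : ℝ} (hδ : 0 < δ) (h : δ < δ') (k : Fin 3 → ℤ) :
    freqNorm k * δ ^ freqNorm k ≤ δ / (δ' - δ) * δ' ^ freqNorm k := by
  rcases eq_or_ne k 0 with rfl | hk
  · have : 0 ≤ δ / (δ' - δ) := div_nonneg hδ.le (sub_nonneg.2 h.le)
    simpa [freqNorm_zero] using this
  · exact mul_rpow_le_rpow_of_lt hδ h (one_le_freqNorm hk)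

/-- The weight `δ^{|k|}` of the norm of `B_δ`. The truncation to nonnegative reals is harmless: only
radii `δ ≥ 0` occur. -/
def weight (δ : ℝ) (k : Fin 3 → ℤ) : ℝ≥0 := (δ ^ freqNorm k).toNNReal

variable {δ δ' : ℝ}

lemma coe_weight (hδ : 0 ≤ δ) (k : Fin 3 → ℤ) : (weight δ k : ℝ) = δ ^ freqNorm k :=
  Real.coe_toNNReal _ (Real.rpow_nonneg hδ _)

lemma weight_add_le (hδ : 1 ≤ δ) (k l : Fin 3 → ℤ) :
    weight δ (k + l) ≤ weight δ k * weight δ l := by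
  have hδ₀ : 0 < δ := by linarith
  rw [weight, weight, weight, ← Real.toNNReal_mul (Real.rpow_nonneg hδ₀.le _),
    ← Real.rpow_add hδ₀]
  exact Real.toNNReal_le_toNNReal (Real.rpow_le_rpow_of_exponent_le hδ (freqNorm_add_le k l))

lemma weight_mono (hδ : 0 ≤ δ) (h : δ ≤ δ') : weight δ ≤ weight δ' := fun k =>
  Real.toNNReal_le_toNNReal (Real.rpow_le_rpow hδ h (freqNorm_nonneg k))

lemma one_le_weight (hδ : 1 ≤ δ) : 1 ≤ weight δ := fun k =>
  Real.one_le_toNNReal.2 (Real.one_le_rpow hδ (freqNorm_nonneg k))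

lemma WNormLE.of_norm_le_freqNorm_mul {a b : (Fin 3 → ℤ) → ℂ} {C β : ℝ}
    (ha : WNormLE (weight δ') a β) (hδ : 0 < δ) (hlt : δ < δ') (hC : 0 ≤ C)
    (h : ∀ k, ‖b k‖ ≤ C * freqNorm k * ‖a k‖) :
    WNormLE (weight δ) b (C * δ / (δ' - δ) * β) := by
  have : 0 < δ' - δ := sub_pos.2 hlt
  refine ha.of_norm_mul_weight_le (by positivity) fun k => ?_
  rw [coe_weight hδ.le, coe_weight (hδ.trans hlt).le]
  calc ‖b k‖ * δ ^ freqNorm k ≤ C * freqNorm k * ‖a k‖ * δ ^ freqNorm k := by gcongr; exact h k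
    _ = C * ‖a k‖ * (freqNorm k * δ ^ freqNorm k) := by ring
    _ ≤ C * ‖a k‖ * (δ / (δ' - δ) * δ' ^ freqNorm k) :=
      mul_le_mul_of_nonneg_left (freqNorm_mul_rpow_le hδ hlt k) (by positivity)
    _ = _ := by ring

end Frequencies

section Symbols

/-- The symbol `2πi kᵢ` of `∂ᵢ`. -/
def dSym {d : Type*} (i : d) (k : d → ℤ) : ℂ := 2 * Real.pi * Complex.I * k i

/-- The symbol of `Δ_⊥⁻¹`; the quotient is `0` on the frequencies with `k_⊥ = 0`. -/
def lapSym (k : Fin 3 → ℤ) : ℂ :=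
  -1 / ((4 * Real.pi ^ 2 * ((k 0 : ℝ) ^ 2 + (k 1 : ℝ) ^ 2) : ℝ) : ℂ)

/-- The symbol of `∂₂ Δ_⊥⁻¹`, which maps `ρ` to the first component of the drift. -/
def driftSym₁ : (Fin 3 → ℤ) → ℂ := dSym 1 * lapSym

/-- The symbol of `-∂₁ Δ_⊥⁻¹`, which maps `ρ` to the second component of the drift. -/
def driftSym₂ : (Fin 3 → ℤ) → ℂ := -(dSym 0 * lapSym)

/-- The symbol of the perpendicular average, seen as a function on `𝕋³`. -/
def meanSym (k : Fin 3 → ℤ) : ℂ := if k 0 = 0 ∧ k 1 = 0 then 1 else 0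

lemma norm_dSym {d : Type*} (i : d) (k : d → ℤ) : ‖dSym i k‖ = 2 * Real.pi * |(k i : ℝ)| := by
  simp [dSym, abs_of_pos Real.pi_pos]

lemma norm_dSym_le (i : Fin 3) (k : Fin 3 → ℤ) : ‖dSym i k‖ ≤ 2 * Real.pi * freqNorm k := by
  rw [norm_dSym]
  gcongr
  exact abs_le_freqNorm k i

lemma norm_meanSym_le (k : Fin 3 → ℤ) : ‖meanSym k‖ ≤ 1 := by
  unfold meanSym
  split_ifs <;> simp

lemma norm_lapSym (k : Fin 3 → ℤ) :
    ‖lapSym k‖ = 1 / (4 * Real.pi ^ 2 * ((k 0 : ℝ) ^ 2 + (k 1 : ℝ) ^ 2)) := by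
  rw [lapSym, norm_div, Complex.norm_real, Real.norm_of_nonneg (by positivity)]
  simp

lemma two_pi_mul_le_four_pi_sq_mul {x q : ℝ} (hx : x ≤ q) (hq : 0 ≤ q) :
    2 * Real.pi * x ≤ 4 * Real.pi ^ 2 * q := by
  have hpi := Real.pi_gt_three
  calc 2 * Real.pi * x ≤ 2 * Real.pi * q := by gcongr
    _ ≤ 4 * Real.pi ^ 2 * q := mul_le_mul_of_nonneg_right (by nlinarith) hq

lemma norm_dSym_mul_norm_lapSym_le {i : Fin 3} (hi : i = 0 ∨ i = 1) (k : Fin 3 → ℤ) :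
    ‖dSym i k‖ * ‖lapSym k‖ ≤ 1 := by
  have abs_le_sq (m : ℤ) : |(m : ℝ)| ≤ (m : ℝ) ^ 2 := by
    exact_mod_cast Int.abs_eq_natAbs m ▸ Int.natAbs_le_self_sq m
  have hk : |(k i : ℝ)| ≤ (k 0 : ℝ) ^ 2 + (k 1 : ℝ) ^ 2 := by
    rcases hi with rfl | rfl
    · linarith [abs_le_sq (k 0), sq_nonneg (k 1 : ℝ)]
    · linarith [abs_le_sq (k 1), sq_nonneg (k 0 : ℝ)]
  rw [norm_dSym, norm_lapSym, mul_one_div]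
  exact div_le_one_of_le₀ (two_pi_mul_le_four_pi_sq_mul hk (by positivity)) (by positivity)

lemma norm_driftSym₁_le (k : Fin 3 → ℤ) : ‖driftSym₁ k‖ ≤ 1 := by
  simpa [driftSym₁] using norm_dSym_mul_norm_lapSym_le (.inr rfl) k

lemma norm_driftSym₂_le (k : Fin 3 → ℤ) : ‖driftSym₂ k‖ ≤ 1 := by
  simpa [driftSym₂] using norm_dSym_mul_norm_lapSym_le (.inl rfl) k

lemma norm_lapSym_le (k : Fin 3 → ℤ) : ‖lapSym k‖ ≤ 1 := by
  rw [norm_lapSym]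
  rcases eq_or_ne ((k 0 : ℝ) ^ 2 + (k 1 : ℝ) ^ 2) 0 with h | h
  · simp [h]
  have one_le : (1 : ℝ) ≤ (k 0 : ℝ) ^ 2 + (k 1 : ℝ) ^ 2 := by
    have : 0 < (k 0) ^ 2 + (k 1) ^ 2 := by exact_mod_cast h.symm.lt_of_le (by positivity)
    exact_mod_cast this
  refine div_le_one_of_le₀ ?_ (by positivity)
  have := two_pi_mul_le_four_pi_sq_mul one_le (by positivity)
  linarith [Real.pi_gt_three]

lemma WNormLE.dSym_mul {δ δ' β : ℝ} {a : (Fin 3 → ℤ) → ℂ} (ha : WNormLE (weight δ') a β)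
    (hδ : 0 < δ) (hlt : δ < δ') (i : Fin 3) :
    WNormLE (weight δ) (dSym i * a) (2 * Real.pi * δ / (δ' - δ) * β) :=
  ha.of_norm_le_freqNorm_mul hδ hlt (by positivity) fun k => by
    rw [Pi.mul_apply, norm_mul]
    gcongr
    exact norm_dSym_le i k

lemma meanSym_mul_dSym_eq_zero {i : Fin 3} (hi : i = 0 ∨ i = 1) : meanSym * dSym i = 0 := by
  ext k
  simp only [meanSym, dSym, Pi.mul_apply, Pi.zero_apply]
  rcases hi with rfl | rfl <;> split_ifs with h <;> simp [h]

lemma hermitian_dSym {d : Type*} (i : d) : Hermitian (dSym i) := fun k => by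
  simp [dSym, Complex.conj_ofNat]

lemma hermitian_lapSym : Hermitian lapSym := fun k => by
  simp only [lapSym, map_div₀, Complex.conj_ofReal, Pi.neg_apply]
  simp

lemma hermitian_meanSym : Hermitian meanSym := fun k => by
  simp only [meanSym, Pi.neg_apply, neg_eq_zero]
  split_ifs <;> simp

lemma hermitian_driftSym₁ : Hermitian driftSym₁ := (hermitian_dSym 1).mul hermitian_lapSym

lemma hermitian_driftSym₂ : Hermitian driftSym₂ := ((hermitian_dSym 0).mul hermitian_lapSym).neg

end Symbols

section FourierSeries

open UnitAddTorus

variable {d : Type*} [Fintype d]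

/-- The normalized Haar measure on the torus, in the product form used by `mFourierCoeff`. -/
def torusHaar (d : Type*) [Fintype d] : Measure (UnitAddTorus d) :=
  Measure.pi fun _ : d => (AddCircle.haarAddCircle : Measure UnitAddCircle)

instance : IsProbabilityMeasure (torusHaar d) := by unfold torusHaar; infer_instance

lemma mFourierCoeff_eq_integral_mul (f : UnitAddTorus d → ℂ) (k : d → ℤ) :
    mFourierCoeff f k = ∫ x, mFourier (-k) x * f x ∂torusHaar d := rfl

lemma norm_fourier_apply (n : ℤ) (x : UnitAddCircle) : ‖(fourier n x : ℂ)‖ = 1 := by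
  rw [fourier_apply, Circle.norm_coe]

lemma norm_mFourier_apply (k : d → ℤ) (x : UnitAddTorus d) : ‖mFourier k x‖ = 1 := by
  simp only [mFourier, ContinuousMap.coe_mk, norm_prod, norm_fourier_apply,
    Finset.prod_const_one]

lemma integral_fourier (n : ℤ) :
    ∫ x : UnitAddCircle, (fourier n x : ℂ) ∂AddCircle.haarAddCircle = if n = 0 then 1 else 0 := by
  have h := congrFun (fourierCoeff_fourier (T := (1 : ℝ)) n) 0
  simp only [fourierCoeff, neg_zero, fourier_zero, one_smul] at h
  rw [h, Pi.single_apply]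
  simp only [eq_comm]

lemma integral_mFourier (k : d → ℤ) :
    ∫ x, mFourier k x ∂torusHaar d = if k = 0 then 1 else 0 := by
  have h : ∫ x, mFourier k x ∂torusHaar d
      = ∏ i, ∫ x : UnitAddCircle, (fourier (k i) x : ℂ) ∂AddCircle.haarAddCircle := by
    rw [torusHaar, ← MeasureTheory.integral_fintype_prod_eq_prod]
    rfl
  rw [h]
  simp only [integral_fourier]
  split_ifs with hk
  · simp [hk]
  · obtain ⟨i, hi⟩ := Function.ne_iff.mp hk
    exact Finset.prod_eq_zero (Finset.mem_univ i) (by simpa using hi)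

lemma mFourier_apply_add (k : d → ℤ) (x y : UnitAddTorus d) :
    mFourier k (x + y) = mFourier k x * mFourier k y := by
  simp [mFourier, fourier_apply, smul_add, AddCircle.toCircle_add, Finset.prod_mul_distrib]

lemma mFourier_apply_single [DecidableEq d] (k : d → ℤ) (i : d) (z : UnitAddCircle) :
    mFourier k (Pi.single i z) = fourier (k i) z := by
  simp only [mFourier, ContinuousMap.coe_mk]
  rw [Finset.prod_eq_single i (fun j _ hj => by simp [Pi.single_eq_of_ne hj]) (by simp)]
  simp

/-- The sum of the Fourier series with coefficients `a`. -/
def synth (a : (d → ℤ) → ℂ) (x : UnitAddTorus d) : ℂ := ∑' k, a k * mFourier k x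

variable {a b : (d → ℤ) → ℂ}

lemma summable_norm_synth_term (ha : Summable fun k => ‖a k‖) (x : UnitAddTorus d) :
    Summable fun k => ‖a k * mFourier k x‖ := by
  simpa [norm_mul, norm_mFourier_apply] using ha

lemma continuous_synth (ha : Summable fun k => ‖a k‖) : Continuous (synth a) := by
  refine continuous_tsum (fun k => by fun_prop) ha fun k x => ?_
  simp [norm_mFourier_apply]

lemma norm_synth_le (ha : Summable fun k => ‖a k‖) (x : UnitAddTorus d) :
    ‖synth a x‖ ≤ ∑' k, ‖a k‖ := by
  refine (norm_tsum_le_tsum_norm (summable_norm_synth_term ha x)).trans (le_of_eq ?_)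
  simp [norm_mFourier_apply]

lemma synth_add (ha : Summable fun k => ‖a k‖) (hb : Summable fun k => ‖b k‖)
    (x : UnitAddTorus d) : synth (a + b) x = synth a x + synth b x := by
  simp only [synth, Pi.add_apply, add_mul]
  exact (summable_norm_synth_term ha x).of_norm.tsum_add (summable_norm_synth_term hb x).of_norm

lemma synth_smul (c : ℂ) (a : (d → ℤ) → ℂ) (x : UnitAddTorus d) :
    synth (c • a) x = c * synth a x := by
  simp only [synth, Pi.smul_apply, smul_eq_mul, mul_assoc]
  exact tsum_mul_left

lemma synth_neg (a : (d → ℤ) → ℂ) (x : UnitAddTorus d) : synth (-a) x = -synth a x := by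
  simpa using synth_smul (-1) a x

/-- The shear `(n, l) ↦ (n - l, l)`, which turns a sum over pairs of frequencies into a
convolution. -/
def subShear (G : Type*) [AddGroup G] : G × G ≃ G × G where
  toFun p := (p.1 - p.2, p.2)
  invFun p := (p.1 + p.2, p.2)
  left_inv p := by simp
  right_inv p := by simp

lemma synth_conv (ha : Summable fun k => ‖a k‖) (hb : Summable fun k => ‖b k‖)
    (x : UnitAddTorus d) : synth (conv a b) x = synth a x * synth b x := by
  have ha' := summable_norm_synth_term ha x
  have hb' := summable_norm_synth_term hb x
  let term (p : (d → ℤ) × (d → ℤ)) : ℂ := (a p.1 * mFourier p.1 x) * (b p.2 * mFourier p.2 x)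
  have hterm : Summable (term ∘ subShear (d → ℤ)) :=
    (subShear _).summable_iff.mpr (ha'.mul_norm hb').of_norm
  calc synth (conv a b) x = ∑' n, ∑' l, term (subShear _ (n, l)) := by
        refine tsum_congr fun n => ?_
        rw [conv, ← tsum_mul_right]
        refine tsum_congr fun l => ?_
        rw [← sub_add_cancel n l, mFourier_add, sub_add_cancel]
        simp only [term, subShear, Equiv.coe_fn_mk]
        ring
    _ = ∑' p, term (subShear _ p) := hterm.tsum_prod.symm
    _ = ∑' p, term p := (subShear _).tsum_eq term
    _ = synth a x * synth b x := (tsum_mul_tsum_of_summable_norm ha' hb').symm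

lemma mFourierCoeff_synth (ha : Summable fun k => ‖a k‖) : mFourierCoeff (synth a) = a := by
  ext n
  have hsum := hasSum_integral_of_summable_integral_norm (μ := torusHaar d)
    (F := fun k x => mFourier (-n) x * (a k * mFourier k x))
    (fun k => Continuous.integrable_of_hasCompactSupport (by fun_prop)
      (HasCompactSupport.of_compactSpace _))
    (by simpa [norm_mFourier_apply] using ha)
  have hint (k : d → ℤ) : ∫ x, mFourier (-n) x * (a k * mFourier k x) ∂torusHaar d
      = if k = n then a n else 0 := by
    have (x : UnitAddTorus d) :
        mFourier (-n) x * (a k * mFourier k x) = a k * mFourier (k - n) x := by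
      rw [sub_eq_add_neg, mFourier_add]; ring
    simp only [this]
    rw [integral_const_mul, integral_mFourier]
    by_cases hk : k = n <;> simp [hk, sub_eq_zero]
  simp only [hint] at hsum
  rw [mFourierCoeff_eq_integral_mul, ← hsum.unique (hasSum_ite_eq n (a n))]
  exact integral_congr_ae (ae_of_all _ fun x => tsum_mul_left.symm)

lemma conj_synth (ha : Hermitian a) (x : UnitAddTorus d) :
    (starRingEnd ℂ) (synth a x) = synth a x := by
  rw [synth, Complex.conj_tsum, ← (Equiv.neg (d → ℤ)).tsum_eq]
  refine tsum_congr fun k => ?_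
  rw [Equiv.neg_apply, map_mul, ← ha, neg_neg, mFourier_neg, Complex.conj_conj]

lemma ofReal_re_synth (ha : Hermitian a) (x : UnitAddTorus d) :
    ((synth a x).re : ℂ) = synth a x :=
  Complex.conj_eq_iff_re.mp (conj_synth ha x)

lemma hasDerivAt_synth [DecidableEq d] {i : d} (ha : Summable fun k => ‖a k‖)
    (hd : Summable fun k => ‖(dSym i * a) k‖) (x : UnitAddTorus d) :
    HasDerivAt (fun s : ℝ => synth a (x + Pi.single i (s : UnitAddCircle)))
      (synth (dSym i * a) x) 0 := by
  have hterm (k : d → ℤ) (s : ℝ) :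
      HasDerivAt (fun s : ℝ => a k * mFourier k x * fourier (k i) (s : UnitAddCircle))
        ((dSym i * a) k * mFourier k x * fourier (k i) (s : UnitAddCircle)) s := by
    have h := (hasDerivAt_fourier 1 (k i) s).const_mul (a k * mFourier k x)
    rw [Complex.ofReal_one, div_one] at h
    exact h.congr_deriv (by rw [Pi.mul_apply, dSym]; ring)
  have h := hasDerivAt_tsum (𝕜 := ℝ) (y₀ := (0 : ℝ)) hd hterm
    (fun k s => by simp only [norm_mul, norm_mFourier_apply, norm_fourier_apply, mul_one, le_rfl])
    (by simpa using (summable_norm_synth_term ha x).of_norm) 0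
  simpa [synth, mFourier_apply_add, mFourier_apply_single, mul_assoc] using h

end FourierSeries

section HasFourierSeries

open UnitAddTorus

/-- `φ` is the sum of the Fourier series with coefficients `a`, and `|φ|_δ < ∞`. The relation lets
identities between functions of `B_δ` be proved on the coefficients. -/
structure HasFourierSeries (δ : ℝ) (φ : T3 → ℝ) (a : (Fin 3 → ℤ) → ℂ) : Prop where
  one_le : 1 ≤ δ
  wnorm_ne_top : wnorm (weight δ) a ≠ ⊤
  eq_synth : ∀ x, (φ x : ℂ) = synth a x

variable {δ δ' β : ℝ} {φ ψ : T3 → ℝ} {a b : (Fin 3 → ℤ) → ℂ}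

lemma wnorm_weight_eq_tsum_ofReal (hδ : 0 ≤ δ) (a : (Fin 3 → ℤ) → ℂ) :
    wnorm (weight δ) a = ∑' k, ENNReal.ofReal (‖a k‖ * δ ^ freqNorm k) :=
  tsum_congr fun k => by
    rw [← coe_weight hδ, ENNReal.ofReal_mul (norm_nonneg _), ofReal_norm, ENNReal.ofReal_coe_nnreal]

lemma summable_iff_wnorm_ne_top (hδ : 0 ≤ δ) (a : (Fin 3 → ℤ) → ℂ) :
    (Summable fun k => ‖a k‖ * δ ^ freqNorm k) ↔ wnorm (weight δ) a ≠ ⊤ := by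
  have term_nonneg (k) : 0 ≤ ‖a k‖ * δ ^ freqNorm k := by positivity
  rw [wnorm_weight_eq_tsum_ofReal hδ]
  constructor
  · intro h
    rw [← ENNReal.ofReal_tsum_of_nonneg term_nonneg h]
    exact ENNReal.ofReal_ne_top
  · intro h
    exact (ENNReal.summable_toReal h).congr fun k => ENNReal.toReal_ofReal (term_nonneg k)

lemma normB_eq_toReal_wnorm (hδ : 0 ≤ δ) (φ : T3 → ℝ) :
    normB δ φ = (wnorm (weight δ) (fourierC φ)).toReal := by
  rw [wnorm_weight_eq_tsum_ofReal hδ, ENNReal.tsum_toReal_eq (fun _ => ENNReal.ofReal_ne_top),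
    normB]
  exact tsum_congr fun k => (ENNReal.toReal_ofReal (by positivity)).symm

lemma MemB.hasFourierSeries (hδ : 1 ≤ δ) (h : MemB δ φ) :
    HasFourierSeries δ φ (fourierC φ) := by
  have hw := (summable_iff_wnorm_ne_top (by linarith) _).mp h.2
  let f : C(T3, ℂ) := ⟨fun x => (φ x : ℂ), Complex.continuous_ofReal.comp h.1⟩
  have hs : Summable (mFourierCoeff f) :=
    (summable_norm_of_wnorm_ne_top (one_le_weight hδ) hw).of_norm
  exact ⟨hδ, hw, fun x => (hasSum_mFourier_series_apply_of_summable hs x).tsum_eq.symm⟩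

namespace HasFourierSeries

protected lemma summable (h : HasFourierSeries δ φ a) : Summable fun k => ‖a k‖ :=
  summable_norm_of_wnorm_ne_top (one_le_weight h.one_le) h.wnorm_ne_top

protected lemma continuous (h : HasFourierSeries δ φ a) : Continuous φ := by
  have : Continuous fun x => (φ x : ℂ).re := by
    simp only [h.eq_synth]
    exact Complex.continuous_re.comp (continuous_synth h.summable)
  simpa using this

lemma fourierC_eq (h : HasFourierSeries δ φ a) : fourierC φ = a := by
  rw [← mFourierCoeff_synth h.summable]
  ext k
  simp only [fourierC, h.eq_synth]

lemma memB (h : HasFourierSeries δ φ a) : MemB δ φ := by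
  refine ⟨h.continuous, (summable_iff_wnorm_ne_top (zero_le_one.trans h.one_le) _).mpr ?_⟩
  exact h.fourierC_eq ▸ h.wnorm_ne_top

lemma unique (h : HasFourierSeries δ φ a) (h' : HasFourierSeries δ' φ b) : a = b := by
  rw [← h.fourierC_eq, h'.fourierC_eq]

lemma congr (h : HasFourierSeries δ φ a) (hφ : ∀ x, ψ x = φ x) (hb : b = a) :
    HasFourierSeries δ ψ b := by
  rwa [funext hφ, hb]

lemma ext (h : HasFourierSeries δ φ a) (h' : HasFourierSeries δ' ψ a) : φ = ψ :=
  funext fun x => Complex.ofReal_injective ((h.eq_synth x).trans (h'.eq_synth x).symm)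

lemma mono (h : HasFourierSeries δ' φ a) (hδ : 1 ≤ δ) (hle : δ ≤ δ') : HasFourierSeries δ φ a :=
  ⟨hδ, ne_top_of_le_ne_top h.wnorm_ne_top (wnorm_mono (weight_mono (by linarith) hle) a),
    h.eq_synth⟩

lemma hermitian (h : HasFourierSeries δ φ a) : Hermitian a := fun k => by
  simp only [← h.fourierC_eq, fourierC, mFourierCoeff_eq_integral_mul]
  rw [← integral_conj]
  exact integral_congr_ae (ae_of_all _ fun x => by simp [mFourier_neg])

lemma wNormLE (h : HasFourierSeries δ φ a) : WNormLE (weight δ) a (wnorm (weight δ) a).toReal :=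
  .of_wnorm_ne_top h.wnorm_ne_top

lemma add (h : HasFourierSeries δ φ a) (h' : HasFourierSeries δ ψ b) :
    HasFourierSeries δ (fun x => φ x + ψ x) (a + b) :=
  ⟨h.one_le, (h.wNormLE.add h'.wNormLE).wnorm_ne_top, fun x => by
    rw [synth_add h.summable h'.summable, ← h.eq_synth, ← h'.eq_synth, Complex.ofReal_add]⟩

lemma neg (h : HasFourierSeries δ φ a) : HasFourierSeries δ (fun x => -φ x) (-a) :=
  ⟨h.one_le, h.wNormLE.neg.wnorm_ne_top, fun x => by
    rw [synth_neg, ← h.eq_synth, Complex.ofReal_neg]⟩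

lemma sub (h : HasFourierSeries δ φ a) (h' : HasFourierSeries δ ψ b) :
    HasFourierSeries δ (fun x => φ x - ψ x) (a - b) :=
  (h.add h'.neg).congr (fun _ => sub_eq_add_neg _ _) (sub_eq_add_neg _ _)

lemma const_mul (h : HasFourierSeries δ φ a) (c : ℝ) :
    HasFourierSeries δ (fun x => c * φ x) ((c : ℂ) • a) :=
  ⟨h.one_le, (h.wNormLE.smul (c : ℂ)).wnorm_ne_top, fun x => by
    rw [synth_smul, ← h.eq_synth, Complex.ofReal_mul]⟩

lemma mul (h : HasFourierSeries δ φ a) (h' : HasFourierSeries δ ψ b) :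
    HasFourierSeries δ (fun x => φ x * ψ x) (conv a b) :=
  ⟨h.one_le, (h.wNormLE.convolve h'.wNormLE (weight_add_le h.one_le)).wnorm_ne_top, fun x => by
    rw [synth_conv h.summable h'.summable, ← h.eq_synth, ← h'.eq_synth, Complex.ofReal_mul]⟩

lemma of_hermitian (hδ : 1 ≤ δ) (ha : wnorm (weight δ) a ≠ ⊤) (hh : Hermitian a) :
    HasFourierSeries δ (fun x => (synth a x).re) a :=
  ⟨hδ, ha, fun x => ofReal_re_synth hh x⟩

lemma of_norm_symbol_le_one {m : (Fin 3 → ℤ) → ℂ} (h : HasFourierSeries δ φ a)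
    (hm : ∀ k, ‖m k‖ ≤ 1) (hψ : ∀ x, (ψ x : ℂ) = synth (m * a) x) :
    HasFourierSeries δ ψ (m * a) :=
  ⟨h.one_le, (h.wNormLE.mul_of_norm_le_one hm).wnorm_ne_top, hψ⟩

lemma abs_le (h : HasFourierSeries δ φ a) (hb : WNormLE (weight δ) a β) (x : T3) :
    |φ x| ≤ β := by
  rw [← Real.norm_eq_abs, ← Complex.norm_real, h.eq_synth]
  exact (norm_synth_le h.summable x).trans (hb.tsum_norm_le (one_le_weight h.one_le))

lemma wnorm_dSym_mul_ne_top (h : HasFourierSeries δ φ a) (hδ : 1 ≤ δ') (hlt : δ' < δ)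
    (i : Fin 3) : wnorm (weight δ') (dSym i * a) ≠ ⊤ :=
  (h.wNormLE.dSym_mul (zero_lt_one.trans_le hδ) hlt i).wnorm_ne_top

lemma hasDerivAt_re_synth (h : HasFourierSeries δ φ a) (hδ : 1 < δ) (i : Fin 3) (x : T3) :
    HasDerivAt (fun s : ℝ => φ (x + Pi.single i (s : UnitAddCircle)))
      (synth (dSym i * a) x).re 0 := by
  have hsum := summable_norm_of_wnorm_ne_top (one_le_weight le_rfl)
    (h.wnorm_dSym_mul_ne_top le_rfl hδ i)
  have hderiv := hasDerivAt_synth h.summable hsum x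
  simp only [← h.eq_synth] at hderiv
  simpa [Function.comp_def] using Complex.reCLM.hasFDerivAt.comp_hasDerivAt (0 : ℝ) hderiv

protected lemma hasDerivAt (h : HasFourierSeries δ φ a) (hδ : 1 < δ) (i : Fin 3) (x : T3) :
    HasDerivAt (fun s : ℝ => φ (x + Pi.single i (s : UnitAddCircle))) (pd i φ x) 0 := by
  have hderiv := h.hasDerivAt_re_synth hδ i x
  rwa [pd, hderiv.deriv]

lemma ofReal_pd (h : HasFourierSeries δ φ a) (hδ : 1 < δ) (i : Fin 3) (x : T3) :
    (pd i φ x : ℂ) = synth (dSym i * a) x := by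
  rw [pd, (h.hasDerivAt_re_synth hδ i x).deriv,
    ofReal_re_synth ((hermitian_dSym i).mul h.hermitian)]

protected lemma pd (h : HasFourierSeries δ φ a) (hδ : 1 ≤ δ') (hlt : δ' < δ) (i : Fin 3) :
    HasFourierSeries δ' (pd i φ) (dSym i * a) :=
  ⟨hδ, h.wnorm_dSym_mul_ne_top hδ hlt i, fun x => h.ofReal_pd (hδ.trans_lt hlt) i x⟩

lemma pd_mul (h : HasFourierSeries δ φ a) (h' : HasFourierSeries δ ψ b) (hδ : 1 < δ)
    (i : Fin 3) (x : T3) :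
    pd i (fun y => φ y * ψ y) x
      = pd i φ x * ψ x + φ x * pd i ψ x := by
  have hprod := ((h.hasDerivAt hδ i x).fun_mul (h'.hasDerivAt hδ i x)).deriv
  simp only [AddCircle.coe_zero, Pi.single_zero, add_zero] at hprod
  exact hprod

end HasFourierSeries

end HasFourierSeries

section PerpMean

open UnitAddTorus

/-- The normalized Haar measure in the two perpendicular variables. -/
def perpHaar : Measure (UnitAddCircle × UnitAddCircle) :=
  (AddCircle.haarAddCircle : Measure UnitAddCircle).prod AddCircle.haarAddCircle

instance : IsProbabilityMeasure perpHaar := by unfold perpHaar; infer_instance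

variable {δ δ' : ℝ} {φ f g : T3 → ℝ} {a : (Fin 3 → ℤ) → ℂ}

lemma continuous_slice (z : UnitAddCircle) :
    Continuous fun q : UnitAddCircle × UnitAddCircle => (![q.1, q.2, z] : T3) := by
  refine continuous_pi fun i => ?_
  fin_cases i
  · exact continuous_fst
  · exact continuous_snd
  · exact continuous_const

lemma integrable_perpHaar {E : Type*} [NormedAddCommGroup E]
    {f : UnitAddCircle × UnitAddCircle → E} (hf : Continuous f) : Integrable f perpHaar :=
  hf.integrable_of_hasCompactSupport (HasCompactSupport.of_compactSpace _)

lemma perpMean_eq_integral (hφ : Continuous φ) (z : UnitAddCircle) :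
    perpMean φ z = ∫ q, φ ![q.1, q.2, z] ∂perpHaar :=
  (integral_prod _ (integrable_perpHaar (hφ.comp (continuous_slice z)))).symm

lemma perpMean_add (hf : Continuous f) (hg : Continuous g) (z : UnitAddCircle) :
    perpMean (fun x => f x + g x) z = perpMean f z + perpMean g z := by
  rw [perpMean_eq_integral hf, perpMean_eq_integral hg,
    perpMean_eq_integral (φ := fun x => f x + g x) (by fun_prop)]
  exact integral_add (integrable_perpHaar (hf.comp (continuous_slice z)))
    (integrable_perpHaar (hg.comp (continuous_slice z)))

lemma perpMean_mul_const (f : T3 → ℝ) (c : ℝ) (z : UnitAddCircle) :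
    perpMean (fun x => f x * c) z = perpMean f z * c := by
  simp only [perpMean, integral_mul_const]

lemma integral_mFourier_slice (k : Fin 3 → ℤ) (z : UnitAddCircle) :
    ∫ q, mFourier k (![q.1, q.2, z] : T3) ∂perpHaar = meanSym k * fourier (k 2) z := by
  have factor (q : UnitAddCircle × UnitAddCircle) : mFourier k (![q.1, q.2, z] : T3)
      = (fourier (k 0) q.1 : ℂ) * (fourier (k 1) q.2 * fourier (k 2) z : ℂ) := by
    simp [mFourier, Fin.prod_univ_three, mul_assoc]
  simp only [factor]
  rw [perpHaar, integral_prod_mul (fun x : UnitAddCircle => (fourier (k 0) x : ℂ))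
    (fun y : UnitAddCircle => (fourier (k 1) y * fourier (k 2) z : ℂ)),
    integral_mul_const, integral_fourier, integral_fourier, meanSym]
  by_cases h0 : k 0 = 0 <;> by_cases h1 : k 1 = 0 <;> simp [h0, h1]

lemma meanSym_mul_mFourier (k : Fin 3 → ℤ) (x : T3) :
    meanSym k * mFourier k x = meanSym k * fourier (k 2) (x 2) := by
  by_cases h : k 0 = 0 ∧ k 1 = 0
  · simp [mFourier, Fin.prod_univ_three, h.1, h.2]
  · simp [meanSym, h]

protected lemma HasFourierSeries.perpMean (h : HasFourierSeries δ φ a) :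
    HasFourierSeries δ (fun x => perpMean φ (x 2)) (meanSym * a) := by
  refine h.of_norm_symbol_le_one norm_meanSym_le fun x => ?_
  rw [perpMean_eq_integral h.continuous, ← integral_complex_ofReal]
  have hsum := hasSum_integral_of_summable_integral_norm (μ := perpHaar)
    (F := fun k q => a k * mFourier k (![q.1, q.2, x 2] : T3))
    (fun k => integrable_perpHaar
      (continuous_const.mul ((mFourier k).continuous.comp (continuous_slice (x 2)))))
    (by simpa [norm_mFourier_apply] using h.summable)
  simp only [h.eq_synth, synth]
  refine hsum.tsum_eq.symm.trans (tsum_congr fun k => ?_)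
  rw [integral_const_mul, integral_mFourier_slice, ← meanSym_mul_mFourier, Pi.mul_apply]
  ring

lemma pd_two_comp (g : UnitAddCircle → ℝ) (x : T3) :
    pd 2 (fun y => g (y 2)) x = dPar g (x 2) := by
  simp [pd, dPar]

protected lemma HasFourierSeries.dPar_perpMean (hδ : 1 ≤ δ') (hlt : δ' < δ)
    (h : HasFourierSeries δ φ a) :
    HasFourierSeries δ' (fun x => dPar (DriftFluid.perpMean φ) (x 2)) (dSym 2 * (meanSym * a)) :=
  (h.perpMean.pd hδ hlt 2).congr (fun x => (pd_two_comp _ x).symm) rfl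

lemma hasDerivAt_dPar {g : UnitAddCircle → ℝ}
    (hg : Differentiable ℝ fun s : ℝ => g (s : UnitAddCircle)) (y : ℝ) :
    HasDerivAt (fun s : ℝ => g (s : UnitAddCircle)) (dPar g (y : UnitAddCircle)) y := by
  have translate := deriv_comp_const_add (fun s : ℝ => g (s : UnitAddCircle)) y 0
  simp only [add_zero, AddCircle.coe_add] at translate
  rw [dPar, translate]
  exact (hg y).hasDerivAt

lemma eq_of_dPar_eq_zero {g : UnitAddCircle → ℝ}
    (hg : Differentiable ℝ fun s : ℝ => g (s : UnitAddCircle)) (hzero : ∀ z, dPar g z = 0)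
    (z z' : UnitAddCircle) : g z = g z' := by
  obtain ⟨y, rfl⟩ := QuotientAddGroup.mk_surjective z
  obtain ⟨y', rfl⟩ := QuotientAddGroup.mk_surjective z'
  exact is_const_of_deriv_eq_zero hg (fun y => (hasDerivAt_dPar hg y).deriv.trans (hzero _)) y y'

lemma HasFourierSeries.differentiable_perpMean (hδ : 1 < δ) (h : HasFourierSeries δ φ a) :
    Differentiable ℝ fun s : ℝ => DriftFluid.perpMean φ (s : UnitAddCircle) := fun y => by
  have hderiv := (h.perpMean.hasDerivAt hδ 2 ![0, 0, (y : UnitAddCircle)]).differentiableAt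
  have hy : DifferentiableAt ℝ
      (fun s : ℝ => DriftFluid.perpMean φ ((y + s : ℝ) : UnitAddCircle)) (y - y) := by
    simpa using hderiv
  simpa using (hy.hasDerivAt.comp_sub_const y y).differentiableAt

end PerpMean

section Drift

variable {δ δ' : ℝ} {ρ v f g : T3 → ℝ} {r w a b : (Fin 3 → ℤ) → ℂ}

protected lemma HasFourierSeries.potential (h : HasFourierSeries δ ρ r) :
    HasFourierSeries δ (potential ρ) (lapSym * r) := by
  refine h.of_norm_symbol_le_one norm_lapSym_le fun x => ?_
  rw [DriftFluid.potential, invLaplacePerp, (h.sub h.perpMean).fourierC_eq,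
    ← ofReal_re_synth (hermitian_lapSym.mul h.hermitian)]
  congr 2
  refine tsum_congr fun k => ?_
  simp only [Pi.sub_apply, Pi.mul_apply, lapSym, meanSym]
  by_cases hk : k 0 = 0 ∧ k 1 = 0
  · simp [hk.1, hk.2]
  · simp only [hk, if_false]
    ring

protected lemma HasFourierSeries.drift₁ (hδ : 1 < δ) (h : HasFourierSeries δ ρ r) :
    HasFourierSeries δ (drift₁ ρ) (driftSym₁ * r) :=
  h.of_norm_symbol_le_one norm_driftSym₁_le fun x => by
    rw [DriftFluid.drift₁, h.potential.ofReal_pd hδ, driftSym₁, mul_assoc]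

protected lemma HasFourierSeries.drift₂ (hδ : 1 < δ) (h : HasFourierSeries δ ρ r) :
    HasFourierSeries δ (drift₂ ρ) (driftSym₂ * r) :=
  h.of_norm_symbol_le_one norm_driftSym₂_le fun x => by
    rw [DriftFluid.drift₂, Complex.ofReal_neg, h.potential.ofReal_pd hδ, driftSym₂, neg_mul,
      mul_assoc, synth_neg]

lemma pd_drift_add_pd_drift (hδ : 1 < δ) (h : HasFourierSeries δ ρ r) (x : T3) :
    pd 0 (drift₁ ρ) x + pd 1 (drift₂ ρ) x = 0 := by
  have hpd₁ := (h.drift₁ hδ).ofReal_pd hδ 0 x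
  have hpd₂ := (h.drift₂ hδ).ofReal_pd hδ 1 x
  have symbols_cancel : dSym 1 * (driftSym₂ * r) = -(dSym 0 * (driftSym₁ * r)) := by
    rw [driftSym₁, driftSym₂]; ring
  rw [symbols_cancel, synth_neg, ← hpd₁, ← Complex.ofReal_neg, Complex.ofReal_inj] at hpd₂
  rw [hpd₂, add_neg_cancel]

lemma driftDiv_eq (hδ : 1 < δ) (hρ : HasFourierSeries δ ρ r) (hf : HasFourierSeries δ f a)
    (x : T3) : driftDiv ρ f x = drift₁ ρ x * pd 0 f x + drift₂ ρ x * pd 1 f x := by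
  rw [driftDiv, (hρ.drift₁ hδ).pd_mul hf hδ, (hρ.drift₂ hδ).pd_mul hf hδ]
  linear_combination f x * pd_drift_add_pd_drift hδ hρ x

/-- The Fourier coefficients of `∇_⊥ · (E^⊥ f)`, from those of `ρ` and `f`. -/
def driftDivCoeff (r a : (Fin 3 → ℤ) → ℂ) : (Fin 3 → ℤ) → ℂ :=
  dSym 0 * conv (driftSym₁ * r) a + dSym 1 * conv (driftSym₂ * r) a

protected lemma HasFourierSeries.driftDiv (hδ : 1 ≤ δ') (hlt : δ' < δ) (hρ : HasFourierSeries δ ρ r)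
    (hf : HasFourierSeries δ f a) :
    HasFourierSeries δ' (driftDiv ρ f) (driftDivCoeff r a) :=
  (((hρ.drift₁ (hδ.trans_lt hlt)).mul hf).pd hδ hlt 0).add
    (((hρ.drift₂ (hδ.trans_lt hlt)).mul hf).pd hδ hlt 1)

lemma meanSym_mul_driftDivCoeff (r a : (Fin 3 → ℤ) → ℂ) : meanSym * driftDivCoeff r a = 0 := by
  rw [driftDivCoeff, mul_add, ← mul_assoc, ← mul_assoc, meanSym_mul_dSym_eq_zero (.inl rfl),
    meanSym_mul_dSym_eq_zero (.inr rfl), zero_mul, zero_mul, add_zero]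

lemma perpMean_neg_driftDiv_add_pd (hδ : 1 < δ) (hρ : HasFourierSeries δ ρ r)
    (hf : HasFourierSeries δ f a) (hg : HasFourierSeries δ g b) (z : UnitAddCircle) :
    perpMean (fun x => -(driftDiv ρ f x + pd 2 g x)) z = -dPar (perpMean g) z := by
  have hmean := (((hρ.driftDiv le_rfl hδ hf).add (hg.pd le_rfl hδ 2)).neg).perpMean
  have hcoeff : meanSym * -(driftDivCoeff r a + dSym 2 * b) = -(dSym 2 * (meanSym * b)) := by
    linear_combination -meanSym_mul_driftDivCoeff r a
  rw [hcoeff] at hmean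
  simpa using congrFun (hmean.ext (hg.dPar_perpMean le_rfl hδ).neg) ![0, 0, z]

end Drift

section RightHandSides

variable {δ δ' : ℝ} {ρ v : T3 → ℝ} {r w : (Fin 3 → ℤ) → ℂ}

/-- The right hand side `-(∇_⊥ · (E^⊥ ρ) + ∂_∥ (v ρ))` of the continuity equation. -/
def continuityRhs (ρ v : T3 → ℝ) (x : T3) : ℝ :=
  -(driftDiv ρ ρ x + pd 2 (fun y => v y * ρ y) x)

/-- The advection term `-(∇_⊥ · (E^⊥ v) + v ∂_∥ v)`, that is, the right hand side of the velocity
equation without the pressure. -/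
def advection (ρ v : T3 → ℝ) (x : T3) : ℝ := -(driftDiv ρ v x + v x * pd 2 v x)

/-- The force `∂_∥ ∫ ρ v² dx_⊥` prescribed by the pressure law, on the parallel circle. -/
def pressureForce (ρ v : T3 → ℝ) : UnitAddCircle → ℝ := dPar (perpMean fun x => ρ x * v x ^ 2)

/-- The Fourier coefficients of `continuityRhs`. -/
def continuityCoeff (r w : (Fin 3 → ℤ) → ℂ) : (Fin 3 → ℤ) → ℂ :=
  -(driftDivCoeff r r + dSym 2 * conv w r)

/-- The Fourier coefficients of `advection`, where `v ∂_∥ v` is written as `∂_∥ (v² / 2)`. -/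
def advectionCoeff (r w : (Fin 3 → ℤ) → ℂ) : (Fin 3 → ℤ) → ℂ :=
  -(driftDivCoeff r w + dSym 2 * ((1 / 2 : ℝ) : ℂ) • conv w w)

/-- The Fourier coefficients of `pressureForce`, seen as a function on `𝕋³`. -/
def pressureCoeff (r w : (Fin 3 → ℤ) → ℂ) : (Fin 3 → ℤ) → ℂ :=
  dSym 2 * (meanSym * conv r (conv w w))

/-- The Fourier coefficients of the right hand side of the velocity equation in which the pressure
is eliminated by the pressure law. -/
def velocityCoeff (r w : (Fin 3 → ℤ) → ℂ) : (Fin 3 → ℤ) → ℂ :=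
  advectionCoeff r w + pressureCoeff r w

namespace HasFourierSeries

lemma mul_sq (hρ : HasFourierSeries δ ρ r) (hv : HasFourierSeries δ v w) :
    HasFourierSeries δ (fun x => ρ x * v x ^ 2) (conv r (conv w w)) :=
  (hρ.mul (hv.mul hv)).congr (fun x => by rw [sq]) rfl

protected lemma continuityRhs (hδ : 1 ≤ δ') (hlt : δ' < δ) (hρ : HasFourierSeries δ ρ r)
    (hv : HasFourierSeries δ v w) :
    HasFourierSeries δ' (continuityRhs ρ v) (continuityCoeff r w) :=
  ((hρ.driftDiv hδ hlt hρ).add ((hv.mul hρ).pd hδ hlt 2)).neg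

protected lemma advection (hδ : 1 ≤ δ') (hlt : δ' < δ) (hρ : HasFourierSeries δ ρ r)
    (hv : HasFourierSeries δ v w) :
    HasFourierSeries δ' (advection ρ v) (advectionCoeff r w) := by
  refine ((hρ.driftDiv hδ hlt hv).add (((hv.mul hv).const_mul (1 / 2)).pd hδ hlt 2)).neg.congr
    (fun x => ?_) rfl
  have h := ((hv.mul hv).hasDerivAt (hδ.trans_lt hlt) 2 x).const_mul (1 / 2 : ℝ)
  have pd_half_sq : DriftFluid.pd 2 (fun y => 1 / 2 * (v y * v y)) x
      = v x * DriftFluid.pd 2 v x := by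
    rw [hv.pd_mul hv (hδ.trans_lt hlt)] at h
    rw [DriftFluid.pd, h.deriv]
    ring
  rw [DriftFluid.advection, pd_half_sq]

protected lemma pressureForce (hδ : 1 ≤ δ') (hlt : δ' < δ) (hρ : HasFourierSeries δ ρ r)
    (hv : HasFourierSeries δ v w) :
    HasFourierSeries δ' (fun x => pressureForce ρ v (x 2)) (pressureCoeff r w) :=
  (hρ.mul_sq hv).dPar_perpMean hδ hlt

end HasFourierSeries

lemma continuityRhs_mul_add_mul_advection (hδ : 1 < δ) (hρ : HasFourierSeries δ ρ r)
    (hv : HasFourierSeries δ v w) (x : T3) :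
    continuityRhs ρ v x * v x + ρ x * advection ρ v x
      = -(driftDiv ρ (fun y => ρ y * v y) x + pd 2 (fun y => ρ y * v y ^ 2) x) := by
  simp only [continuityRhs, advection, sq]
  rw [driftDiv_eq hδ hρ hρ, driftDiv_eq hδ hρ hv, driftDiv_eq hδ hρ (hρ.mul hv),
    hv.pd_mul hρ hδ, hρ.pd_mul hv hδ, hρ.pd_mul hv hδ, hρ.pd_mul (hv.mul hv) hδ, hv.pd_mul hv hδ]
  ring

lemma perpMean_momentum_balance (hδ : 1 < δ) (hρ : HasFourierSeries δ ρ r)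
    (hv : HasFourierSeries δ v w) (z : UnitAddCircle) :
    perpMean (fun x => continuityRhs ρ v x * v x + ρ x * advection ρ v x) z
      = -pressureForce ρ v z := by
  simp only [continuityRhs_mul_add_mul_advection hδ hρ hv]
  exact perpMean_neg_driftDiv_add_pd hδ hρ (hρ.mul hv) (hρ.mul_sq hv) z

end RightHandSides

namespace WNormLE

variable {δ δ' R β : ℝ} {r w r' w' a a' : (Fin 3 → ℤ) → ℂ}

lemma conv_sub_conv_weight (hδ : 1 ≤ δ) (ha : WNormLE (weight δ) a R)
    (ha' : WNormLE (weight δ) a' R) (hr : WNormLE (weight δ) r R) (hr' : WNormLE (weight δ) r' R)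
    (hda : WNormLE (weight δ) (a - a') β) (hdr : WNormLE (weight δ) (r - r') β) :
    WNormLE (weight δ) (conv a r - conv a' r') (2 * R * β) :=
  (conv_sub_conv (one_le_weight hδ) (weight_add_le hδ) ha ha' hr hr' hda hdr).mono
    (le_of_eq (by ring))

lemma driftDivCoeff_sub (hδ : 1 ≤ δ) (hlt : δ < δ')
    (hr : WNormLE (weight δ') r R) (ha : WNormLE (weight δ') a R)
    (hr' : WNormLE (weight δ') r' R) (ha' : WNormLE (weight δ') a' R)
    (hdr : WNormLE (weight δ') (r - r') β) (hda : WNormLE (weight δ') (a - a') β) :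
    WNormLE (weight δ) (driftDivCoeff r a - driftDivCoeff r' a')
      (2 * Real.pi * δ / (δ' - δ) * (4 * R * β)) := by
  have product_sub {m : (Fin 3 → ℤ) → ℂ} (hm : ∀ k, ‖m k‖ ≤ 1) :
      WNormLE (weight δ') (conv (m * r) a - conv (m * r') a') (2 * R * β) :=
    conv_sub_conv_weight (hδ.trans hlt.le) (hr.mul_of_norm_le_one hm) (hr'.mul_of_norm_le_one hm)
      ha ha' (by rw [← mul_sub]; exact hdr.mul_of_norm_le_one hm) hda
  have split : driftDivCoeff r a - driftDivCoeff r' a'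
      = dSym 0 * (conv (driftSym₁ * r) a - conv (driftSym₁ * r') a')
        + dSym 1 * (conv (driftSym₂ * r) a - conv (driftSym₂ * r') a') := by
    rw [driftDivCoeff, driftDivCoeff]; ring
  have hδ₀ : 0 < δ := by linarith
  rw [split]
  exact (((product_sub norm_driftSym₁_le).dSym_mul hδ₀ hlt 0).add
    ((product_sub norm_driftSym₂_le).dSym_mul hδ₀ hlt 1)).mono (le_of_eq (by ring))

lemma continuityCoeff_sub (hδ : 1 ≤ δ) (hlt : δ < δ')
    (hr : WNormLE (weight δ') r R) (hw : WNormLE (weight δ') w R)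
    (hr' : WNormLE (weight δ') r' R) (hw' : WNormLE (weight δ') w' R)
    (hdr : WNormLE (weight δ') (r - r') β) (hdw : WNormLE (weight δ') (w - w') β) :
    WNormLE (weight δ) (continuityCoeff r w - continuityCoeff r' w')
      (2 * Real.pi * δ / (δ' - δ) * (6 * R * β)) := by
  have split : continuityCoeff r w - continuityCoeff r' w'
      = -((driftDivCoeff r r - driftDivCoeff r' r') + dSym 2 * (conv w r - conv w' r')) := by
    rw [continuityCoeff, continuityCoeff]; ring
  have hproduct := conv_sub_conv_weight (hδ.trans hlt.le) hw hw' hr hr' hdw hdr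
  rw [split]
  exact ((driftDivCoeff_sub hδ hlt hr hr hr' hr' hdr hdr).add
    (hproduct.dSym_mul (by linarith) hlt 2)).neg.mono (le_of_eq (by ring))

lemma advectionCoeff_sub (hδ : 1 ≤ δ) (hlt : δ < δ')
    (hr : WNormLE (weight δ') r R) (hw : WNormLE (weight δ') w R)
    (hr' : WNormLE (weight δ') r' R) (hw' : WNormLE (weight δ') w' R)
    (hdr : WNormLE (weight δ') (r - r') β) (hdw : WNormLE (weight δ') (w - w') β) :
    WNormLE (weight δ) (advectionCoeff r w - advectionCoeff r' w')
      (2 * Real.pi * δ / (δ' - δ) * (5 * R * β)) := by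
  have split : advectionCoeff r w - advectionCoeff r' w'
      = -((driftDivCoeff r w - driftDivCoeff r' w')
        + dSym 2 * ((1 / 2 : ℝ) : ℂ) • (conv w w - conv w' w')) := by
    rw [advectionCoeff, advectionCoeff, smul_sub]; ring
  have hsquare := (conv_sub_conv_weight (hδ.trans hlt.le) hw hw' hw hw' hdw hdw).smul
    ((1 / 2 : ℝ) : ℂ)
  rw [split]
  refine ((driftDivCoeff_sub hδ hlt hr hw hr' hw' hdr hdw).add
    (hsquare.dSym_mul (by linarith) hlt 2)).neg.mono (le_of_eq ?_)
  rw [Complex.norm_real, Real.norm_of_nonneg (by norm_num)]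
  ring

lemma pressureCoeff_sub (hδ : 1 ≤ δ) (hlt : δ < δ')
    (hr : WNormLE (weight δ') r R) (hw : WNormLE (weight δ') w R)
    (hr' : WNormLE (weight δ') r' R) (hw' : WNormLE (weight δ') w' R)
    (hdr : WNormLE (weight δ') (r - r') β) (hdw : WNormLE (weight δ') (w - w') β) :
    WNormLE (weight δ) (pressureCoeff r w - pressureCoeff r' w')
      (2 * Real.pi * δ / (δ' - δ) * (3 * R ^ 2 * β)) := by
  have hδ' : 1 ≤ δ' := hδ.trans hlt.le
  have split : pressureCoeff r w - pressureCoeff r' w'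
      = dSym 2 * (meanSym * (conv r (conv w w) - conv r' (conv w' w'))) := by
    rw [pressureCoeff, pressureCoeff]; ring
  have hsquare := conv_sub_conv_weight hδ' hw hw' hw hw' hdw hdw
  have hcubic := conv_sub_conv (one_le_weight hδ') (weight_add_le hδ') hr hr'
    (hw.convolve hw (weight_add_le hδ')) (hw'.convolve hw' (weight_add_le hδ')) hdr hsquare
  rw [split]
  exact ((hcubic.mul_of_norm_le_one norm_meanSym_le).dSym_mul (by linarith) hlt 2).mono
    (le_of_eq (by ring))

lemma velocityCoeff_sub (hδ : 1 ≤ δ) (hlt : δ < δ')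
    (hr : WNormLE (weight δ') r R) (hw : WNormLE (weight δ') w R)
    (hr' : WNormLE (weight δ') r' R) (hw' : WNormLE (weight δ') w' R)
    (hdr : WNormLE (weight δ') (r - r') β) (hdw : WNormLE (weight δ') (w - w') β) :
    WNormLE (weight δ) (velocityCoeff r w - velocityCoeff r' w')
      (2 * Real.pi * δ / (δ' - δ) * ((5 * R + 3 * R ^ 2) * β)) := by
  rw [velocityCoeff, velocityCoeff, add_sub_add_comm]
  exact ((advectionCoeff_sub hδ hlt hr hw hr' hw' hdr hdw).add
    (pressureCoeff_sub hδ hlt hr hw hr' hw' hdr hdw)).mono (le_of_eq (by ring))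

end WNormLE

lemma conv_zero_right {G R : Type*} [AddCommGroup G] [NormedRing R] (a : G → R) :
    conv a 0 = 0 := by
  ext n; simp [conv]

namespace WNormLE

variable {δ δ' R : ℝ} {r w : (Fin 3 → ℤ) → ℂ}

protected lemma continuityCoeff (hδ : 1 ≤ δ) (hlt : δ < δ') (hr : WNormLE (weight δ') r R)
    (hw : WNormLE (weight δ') w R) :
    WNormLE (weight δ) (continuityCoeff r w) (2 * Real.pi * δ / (δ' - δ) * (6 * R * R)) := by
  simpa [DriftFluid.continuityCoeff, driftDivCoeff, conv_zero_right] using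
    continuityCoeff_sub hδ hlt hr hw (zero hr.nonneg) (zero hr.nonneg)
      (by rwa [sub_zero]) (by rwa [sub_zero])

protected lemma advectionCoeff (hδ : 1 ≤ δ) (hlt : δ < δ') (hr : WNormLE (weight δ') r R)
    (hw : WNormLE (weight δ') w R) :
    WNormLE (weight δ) (advectionCoeff r w) (2 * Real.pi * δ / (δ' - δ) * (5 * R * R)) := by
  simpa [DriftFluid.advectionCoeff, driftDivCoeff, conv_zero_right] using
    advectionCoeff_sub hδ hlt hr hw (zero hr.nonneg) (zero hr.nonneg)
      (by rwa [sub_zero]) (by rwa [sub_zero])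

protected lemma pressureCoeff (hδ : 1 ≤ δ) (hlt : δ < δ') (hr : WNormLE (weight δ') r R)
    (hw : WNormLE (weight δ') w R) :
    WNormLE (weight δ) (pressureCoeff r w)
      (2 * Real.pi * δ / (δ' - δ) * (3 * R ^ 2 * R)) := by
  simpa [DriftFluid.pressureCoeff, conv_zero_right] using
    pressureCoeff_sub hδ hlt hr hw (zero hr.nonneg) (zero hr.nonneg)
      (by rwa [sub_zero]) (by rwa [sub_zero])

end WNormLE

section LossOfRadius

lemma ratio_pow_le_three (n : ℕ) : (((n : ℝ) + 2) / (n + 1)) ^ n ≤ 3 :=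
  calc (((n : ℝ) + 2) / (n + 1)) ^ n = (1 / (n + 1) + 1 : ℝ) ^ n := by
        congr 1; field_simp; ring
    _ ≤ Real.exp (1 / (n + 1)) ^ n := by gcongr; exact Real.add_one_le_exp _
    _ = Real.exp (n * (1 / (n + 1))) := (Real.exp_nat_mul _ n).symm
    _ ≤ Real.exp 1 := by
        refine Real.exp_le_exp.mpr ?_
        rw [mul_one_div, div_le_one (by positivity)]
        linarith
    _ ≤ 3 := by linarith [Real.exp_one_lt_d9]

lemma exists_intermediate_radius {r r₁ : ℝ} (n : ℕ) (h : r < r₁) :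
    ∃ r' ∈ Ioo r r₁, (r' - r)⁻¹ = (n + 2) / (r₁ - r) ∧
      (r₁ - r')⁻¹ ^ n ≤ 3 * (r₁ - r)⁻¹ ^ n := by
  have : 0 < r₁ - r := sub_pos.2 h
  have gap_left : r + (r₁ - r) / (n + 2) - r = (r₁ - r) / (n + 2) := by ring
  have gap_right : r₁ - (r + (r₁ - r) / (n + 2)) = (r₁ - r) * ((n + 1) / (n + 2)) := by
    field_simp; ring
  refine ⟨r + (r₁ - r) / (n + 2), ⟨sub_pos.1 ?_, sub_pos.1 ?_⟩, ?_, ?_⟩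
  · rw [gap_left]; positivity
  · rw [gap_right]; positivity
  · rw [gap_left, inv_div]
  · rw [gap_right, mul_inv, inv_div, mul_pow, mul_comm]
    gcongr
    exact ratio_pow_le_three n

variable {G ι E : Type*} [NormedAddCommGroup E] [NormedSpace ℝ E]

lemma WNormLE.of_deriv {w : G → ℝ≥0} {t₀ t₁ β : ℝ} {n : ℕ} {d d' : ℝ → G → E}
    (hd : ∀ t ∈ Icc t₀ t₁, ∀ k, HasDerivWithinAt (fun s => d s k) (d' t k) (Icc t₀ t₁) t)
    (h₀ : d t₀ = 0) (hd' : ∀ t ∈ Icc t₀ t₁, WNormLE w (d' t) (β * (t - t₀) ^ n)) {t : ℝ}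
    (ht : t ∈ Icc t₀ t₁) : WNormLE w (d t) (β * (t - t₀) ^ (n + 1) / (n + 1)) := by
  refine wNormLE_iff_forall_finset.2 fun s => ?_
  let weighted (a : G → E) : PiLp 1 fun _ : s => E := WithLp.toLp 1 fun k => (w k : ℝ) • a k
  have norm_weighted (a : G → E) : ‖weighted a‖ = ∑ k ∈ s, ‖a k‖ * w k := by
    rw [PiLp.norm_eq_of_L1, ← Finset.sum_coe_sort s fun k => ‖a k‖ * w k]
    exact Finset.sum_congr rfl fun k _ => by simp [weighted, norm_smul, mul_comm]
  have hderiv : ∀ τ ∈ Icc t₀ t₁,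
      HasDerivWithinAt (fun τ => weighted (d τ)) (weighted (d' τ)) (Icc t₀ t₁) τ := fun τ hτ =>
    HasFDerivAt.comp_hasDerivWithinAt (f := fun τ (k : s) => (w k : ℝ) • d τ k) τ
      (PiLp.hasFDerivAt_toLp 1 _)
      (hasDerivWithinAt_pi.2 fun k => (hd τ hτ k).const_smul (w k : ℝ))
  have hprimitive (τ : ℝ) : HasDerivAt (fun τ : ℝ => β * (τ - t₀) ^ (n + 1) / (n + 1))
      (β * (τ - t₀) ^ n) τ := by
    refine (((((hasDerivAt_id τ).sub_const t₀).pow (n + 1)).const_mul β).div_const _).congr_deriv ?_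
    push_cast [id]
    field_simp
  rw [← norm_weighted]
  exact image_norm_le_of_norm_deriv_right_le_deriv_boundary'
    (fun τ hτ => (hderiv τ hτ).continuousWithinAt)
    (fun τ hτ => (hderiv τ (Ico_subset_Icc_self hτ)).mono_of_mem_nhdsWithin
      (Icc_mem_nhdsGE_of_mem hτ))
    (by simp [norm_weighted, h₀]) (by fun_prop) (fun τ _ => (hprimitive τ).hasDerivWithinAt)
    (fun τ hτ => (norm_weighted _).trans_le
      (wNormLE_iff_forall_finset.1 (hd' τ (Ico_subset_Icc_self hτ)) s)) ht

/-- A bounded solution `d` of a linear evolution problem `∂ₜ d = d'` on `[t₀, t₁]` in the scale of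
spaces with weights `W δ`, `r₀ ≤ δ < r₁`, where `d'` is controlled by `d` at the price
`L / (δ' - δ)` of a smaller radius. The index `ι` numbers the unknowns of the system. -/
structure LossSystem (W : ℝ → G → ℝ≥0) (r₀ r₁ L B t₀ t₁ : ℝ) (d d' : ℝ → ι → G → E) : Prop where
  lt : r₀ < r₁
  L_nonneg : 0 ≤ L
  deriv : ∀ t ∈ Icc t₀ t₁, ∀ i k, HasDerivWithinAt (fun s => d s i k) (d' t i k) (Icc t₀ t₁) t
  bound : ∀ t ∈ Icc t₀ t₁, ∀ δ ∈ Ico r₀ r₁, ∀ i, WNormLE (W δ) (d t i) B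
  loss : ∀ t ∈ Icc t₀ t₁, ∀ δ δ' β, r₀ ≤ δ → δ < δ' → δ' < r₁ →
    (∀ i, WNormLE (W δ') (d t i) β) → ∀ i, WNormLE (W δ) (d' t i) (L / (δ' - δ) * β)

namespace LossSystem

variable {W : ℝ → G → ℝ≥0} {r₀ r₁ L B t₀ t₁ : ℝ} {d d' : ℝ → ι → G → E}

lemma mono (h : LossSystem W r₀ r₁ L B t₀ t₁ d d') {s₀ s₁ : ℝ} (hs : Icc s₀ s₁ ⊆ Icc t₀ t₁) :
    LossSystem W r₀ r₁ L B s₀ s₁ d d' where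
  lt := h.lt
  L_nonneg := h.L_nonneg
  deriv t ht i k := (h.deriv t (hs ht) i k).mono hs
  bound t ht := h.bound t (hs ht)
  loss t ht := h.loss t (hs ht)

lemma deriv_bound (h : LossSystem W r₀ r₁ L B t₀ t₁ d d') {n : ℕ} {t δ : ℝ} (ht : t ∈ Icc t₀ t₁)
    (hδ : δ ∈ Ico r₀ r₁)
    (hd : ∀ δ ∈ Ico r₀ r₁, ∀ i, WNormLE (W δ) (d t i) (B * (6 * L * (t - t₀) / (r₁ - δ)) ^ n))
    (i : ι) :
    WNormLE (W δ) (d' t i)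
      ((n + 2) / 2 * (B * (6 * L / (r₁ - δ)) ^ (n + 1)) * (t - t₀) ^ n) := by
  obtain ⟨δ', hδ', inv_left, inv_right_pow⟩ := exists_intermediate_radius n hδ.2
  have hmem : δ' ∈ Ico r₀ r₁ := ⟨hδ.1.trans hδ'.1.le, hδ'.2⟩
  have hL := h.L_nonneg
  have hB : 0 ≤ B := (h.bound t ht δ hδ i).nonneg
  have ht₀ : 0 ≤ t - t₀ := sub_nonneg.2 ht.1
  have hgap : 0 < r₁ - δ := sub_pos.2 hδ.2
  refine (h.loss t ht δ δ' _ hδ.1 hδ'.1 hδ'.2 (hd δ' hmem) i).mono ?_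
  calc L / (δ' - δ) * (B * (6 * L * (t - t₀) / (r₁ - δ')) ^ n)
      = L * ((n + 2) / (r₁ - δ)) * (B * (6 * L * (t - t₀)) ^ n * (r₁ - δ')⁻¹ ^ n) := by
        rw [div_eq_mul_inv L, inv_left, div_eq_mul_inv _ (r₁ - δ'), mul_pow]; ring
    _ ≤ L * ((n + 2) / (r₁ - δ)) * (B * (6 * L * (t - t₀)) ^ n * (3 * (r₁ - δ)⁻¹ ^ n)) := by
        gcongr
    _ = (n + 2) / 2 * (B * (6 * L / (r₁ - δ)) ^ (n + 1)) * (t - t₀) ^ n := by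
        simp only [div_eq_mul_inv, mul_pow, pow_succ]; ring

/-- Integration in time divides by `n + 1`, which compensates the factor `n + 2` lost in splitting
the radius at the `n`-th step. -/
lemma iterate (h : LossSystem W r₀ r₁ L B t₀ t₁ d d') (h₀ : ∀ i, d t₀ i = 0) (n : ℕ) :
    ∀ t ∈ Icc t₀ t₁, ∀ δ ∈ Ico r₀ r₁, ∀ i,
      WNormLE (W δ) (d t i) (B * (6 * L * (t - t₀) / (r₁ - δ)) ^ n) := by
  induction n with
  | zero => simpa using h.bound
  | succ n ih =>
    intro t ht δ hδ i
    have hL := h.L_nonneg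
    have hB : 0 ≤ B := (h.bound t ht δ hδ i).nonneg
    have ht₀ : 0 ≤ t - t₀ := sub_nonneg.2 ht.1
    have hgap : 0 < r₁ - δ := sub_pos.2 hδ.2
    have ratio_le : ((n : ℝ) + 2) / (2 * (n + 1)) ≤ 1 := by
      rw [div_le_one (by positivity)]; linarith
    refine (WNormLE.of_deriv (fun τ hτ => h.deriv τ hτ i) (h₀ i)
      (fun τ hτ => h.deriv_bound hτ hδ (ih τ hτ) i) ht).mono ?_
    calc (n + 2) / 2 * (B * (6 * L / (r₁ - δ)) ^ (n + 1)) * (t - t₀) ^ (n + 1) / (n + 1)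
        = (n + 2) / (2 * (n + 1)) * (B * (6 * L * (t - t₀) / (r₁ - δ)) ^ (n + 1)) := by
          rw [mul_div_right_comm (6 * L), mul_pow]; field_simp
      _ ≤ B * (6 * L * (t - t₀) / (r₁ - δ)) ^ (n + 1) :=
          mul_le_of_le_one_left (by positivity) ratio_le

lemma eq_zero_of_short (h : LossSystem W r₀ r₁ L B t₀ t₁ d d') (hW : 1 ≤ W r₀)
    (h₀ : ∀ i, d t₀ i = 0) (hshort : 12 * L * (t₁ - t₀) ≤ r₁ - r₀) {t : ℝ} (ht : t ∈ Icc t₀ t₁)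
    (i : ι) : d t i = 0 := by
  have hmem : r₀ ∈ Ico r₀ r₁ := ⟨le_rfl, h.lt⟩
  have hgap : 0 < r₁ - r₀ := sub_pos.2 h.lt
  have hL := h.L_nonneg
  have ht₀ : 0 ≤ t - t₀ := sub_nonneg.2 ht.1
  have hB : 0 ≤ B := (h.bound t ht r₀ hmem i).nonneg
  have ratio_le : 6 * L * (t - t₀) / (r₁ - r₀) ≤ 1 / 2 := by
    rw [div_le_iff₀ hgap]
    have : 12 * L * (t - t₀) ≤ 12 * L * (t₁ - t₀) := by gcongr; exact ht.2
    linarith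
  have tendsto_zero : Tendsto (fun n : ℕ => B * (1 / 2 : ℝ) ^ n) atTop (𝓝 0) := by
    simpa using (tendsto_pow_atTop_nhds_zero_of_lt_one (by norm_num : (0 : ℝ) ≤ 1 / 2)
      (by norm_num)).const_mul B
  ext k
  refine norm_le_zero_iff.1 (ge_of_tendsto' tendsto_zero fun n => ?_)
  exact (((h.iterate h₀ n t ht r₀ hmem i).norm_apply_le hW k)).trans (by gcongr)

theorem eq_zero (h : LossSystem W r₀ r₁ L B t₀ t₁ d d') (hW : 1 ≤ W r₀) (h₀ : ∀ i, d t₀ i = 0)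
    {t : ℝ} (ht : t ∈ Icc t₀ t₁) (i : ι) : d t i = 0 := by
  have hgap : 0 < r₁ - r₀ := sub_pos.2 h.lt
  have hL := h.L_nonneg
  obtain ⟨τ, hτ, hLτ⟩ : ∃ τ > 0, 12 * L * τ ≤ r₁ - r₀ := by
    refine ⟨(r₁ - r₀) / (12 * (L + 1)), by positivity, ?_⟩
    rw [mul_div_assoc', div_le_iff₀ (by positivity)]
    nlinarith
  have eq_zero_on_steps (m : ℕ) : ∀ t ∈ Icc t₀ t₁, t ≤ t₀ + m * τ → ∀ i, d t i = 0 := by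
    induction m with
    | zero =>
      intro t ht htm
      rwa [le_antisymm (by simpa using htm) ht.1]
    | succ m ih =>
      intro t ht htm i
      rcases le_or_gt t (t₀ + m * τ) with hle | hgt
      · exact ih t ht hle i
      have hmem : t₀ + m * τ ∈ Icc t₀ t₁ := ⟨le_add_of_nonneg_right (by positivity),
        hgt.le.trans ht.2⟩
      refine (h.mono (Icc_subset_Icc hmem.1 ht.2)).eq_zero_of_short hW (ih _ hmem le_rfl)
        (le_trans ?_ hLτ) ⟨hgt.le, le_rfl⟩ i
      gcongr
      push_cast at htm
      linarith
  obtain ⟨m, hm⟩ := exists_nat_ge ((t - t₀) / τ)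
  rw [div_le_iff₀ hτ] at hm
  exact eq_zero_on_steps m t ht (by linarith) i

end LossSystem

end LossOfRadius

section TimeDerivatives

variable {S : Set ℝ} {C t : ℝ}

lemma hasDerivWithinAt_integral_of_bounded {X E : Type*} [MeasurableSpace X]
    [NormedAddCommGroup E] [NormedSpace ℝ E] {μ : Measure X} [IsFiniteMeasure μ]
    (hS : Convex ℝ S) {f f' : ℝ → X → E} (hf : ∀ s ∈ S, Integrable (f s) μ)
    (hd : ∀ s ∈ S, ∀ x, HasDerivWithinAt (fun s => f s x) (f' s x) S s)
    (hb : ∀ s ∈ S, ∀ x, ‖f' s x‖ ≤ C) (ht : t ∈ S) :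
    HasDerivWithinAt (fun s => ∫ x, f s x ∂μ) (∫ x, f' t x ∂μ) S t := by
  rw [hasDerivWithinAt_iff_tendsto_slope]
  have hmem : ∀ᶠ s in 𝓝[S \ {t}] t, s ∈ S \ {t} := self_mem_nhdsWithin
  have tendsto_integral_slope : Tendsto (fun s => ∫ x, slope (fun s => f s x) t s ∂μ)
      (𝓝[S \ {t}] t) (𝓝 (∫ x, f' t x ∂μ)) := by
    refine tendsto_integral_filter_of_dominated_convergence (fun _ => C) ?_ ?_
      (integrable_const C) (ae_of_all _ fun x => hasDerivWithinAt_iff_tendsto_slope.mp (hd t ht x))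
    · filter_upwards [hmem] with s hs
      simp only [slope, vsub_eq_sub]
      exact (((hf s hs.1).sub (hf t ht)).smul ((s - t)⁻¹)).aestronglyMeasurable
    · filter_upwards [hmem] with s hs
      refine ae_of_all _ fun x => ?_
      have hst : 0 < ‖s - t‖ := norm_pos_iff.mpr (sub_ne_zero.mpr hs.2)
      rw [slope, vsub_eq_sub, norm_smul, norm_inv, inv_mul_le_iff₀ hst, mul_comm]
      exact hS.norm_image_sub_le_of_norm_hasDerivWithin_le (fun s hs => hd s hs x)
        (fun s hs => hb s hs x) ht hs.1
  refine tendsto_integral_slope.congr' ?_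
  filter_upwards [hmem] with s hs
  simp only [slope, vsub_eq_sub]
  rw [integral_smul, integral_sub (hf s hs.1) (hf t ht)]

lemma hasDerivWithinAt_fourierC (hS : Convex ℝ S) {φ φ' : ℝ → T3 → ℝ}
    (hφ : ∀ s ∈ S, Continuous (φ s))
    (hd : ∀ s ∈ S, ∀ x, HasDerivWithinAt (fun s => φ s x) (φ' s x) S s)
    (hb : ∀ s ∈ S, ∀ x, |φ' s x| ≤ C) (ht : t ∈ S) (k : Fin 3 → ℤ) :
    HasDerivWithinAt (fun s => fourierC (φ s) k) (fourierC (φ' t) k) S t := by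
  simp only [fourierC, mFourierCoeff_eq_integral_mul]
  refine hasDerivWithinAt_integral_of_bounded (C := C)
    (f := fun s x => UnitAddTorus.mFourier (-k) x * (φ s x : ℂ))
    (f' := fun s x => UnitAddTorus.mFourier (-k) x * (φ' s x : ℂ)) hS (fun s hs => ?_)
    (fun s hs x => (hd s hs x).ofReal_comp.const_mul _) (fun s hs x => ?_) ht
  · have := hφ s hs
    exact Continuous.integrable_of_hasCompactSupport (by fun_prop) (.of_compactSpace _)
  · rw [norm_mul, norm_mFourier_apply, one_mul, Complex.norm_real]
    exact hb s hs x

lemma hasDerivWithinAt_perpMean (hS : Convex ℝ S) {f f' : ℝ → T3 → ℝ} {z : UnitAddCircle}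
    (hf : ∀ s ∈ S, Continuous (f s))
    (hd : ∀ s ∈ S, ∀ x : T3, x 2 = z → HasDerivWithinAt (fun s => f s x) (f' s x) S s)
    (hb : ∀ s ∈ S, ∀ x : T3, x 2 = z → |f' s x| ≤ C) (ht : t ∈ S) (hf' : Continuous (f' t)) :
    HasDerivWithinAt (fun s => perpMean (f s) z) (perpMean (f' t) z) S t := by
  rw [perpMean_eq_integral hf' z]
  exact (hasDerivWithinAt_integral_of_bounded (μ := perpHaar)
    (f := fun s q => f s ![q.1, q.2, z]) (f' := fun s q => f' s ![q.1, q.2, z]) hS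
    (fun s hs => integrable_perpHaar ((hf s hs).comp (continuous_slice z)))
    (fun s hs q => hd s hs _ rfl) (fun s hs q => hb s hs _ rfl) ht).congr_of_mem
      (fun s hs => perpMean_eq_integral (hf s hs) z) ht

end TimeDerivatives

/-- A solution on `[0, T]` of the equations for `ρ` and `v` with pressure gradient `q(t, x_∥)`,
bounded by `R` in `B_δ`. No regularity of `q` in time is required. -/
structure IsBoundedSolution (δ R T : ℝ) (ρ v : ℝ → T3 → ℝ) (q : ℝ → UnitAddCircle → ℝ) :
    Prop where
  one_lt : 1 < δ
  rho : ∀ t ∈ Icc 0 T, HasFourierSeries δ (ρ t) (fourierC (ρ t))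
  vel : ∀ t ∈ Icc 0 T, HasFourierSeries δ (v t) (fourierC (v t))
  rho_bound : ∀ t ∈ Icc 0 T, WNormLE (weight δ) (fourierC (ρ t)) R
  vel_bound : ∀ t ∈ Icc 0 T, WNormLE (weight δ) (fourierC (v t)) R
  rho_deriv : ∀ t ∈ Icc 0 T, ∀ x,
    HasDerivWithinAt (fun s => ρ s x) (continuityRhs (ρ t) (v t) x) (Icc 0 T) t
  vel_deriv : ∀ t ∈ Icc 0 T, ∀ x,
    HasDerivWithinAt (fun s => v s x) (advection (ρ t) (v t) x - q t (x 2)) (Icc 0 T) t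

/-- The pressure law `-∂_∥ p = ∂_∥ ∫ ρ v² dx_⊥` on `[0, T]`, with `q = ∂_∥ p`. -/
def PressureLaw (T : ℝ) (ρ v : ℝ → T3 → ℝ) (q : ℝ → UnitAddCircle → ℝ) : Prop :=
  ∀ t ∈ Icc 0 T, ∀ z, -q t z = pressureForce (ρ t) (v t) z

lemma abs_mul_add_mul_le {a b c d A B C D : ℝ} (ha : |a| ≤ A) (hb : |b| ≤ B) (hc : |c| ≤ C)
    (hd : |d| ≤ D) : |a * b + c * d| ≤ A * B + C * D := by
  refine (abs_add_le _ _).trans ?_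
  rw [abs_mul, abs_mul]
  have := (abs_nonneg a).trans ha
  have := (abs_nonneg c).trans hc
  gcongr

lemma WNormLE.mono_loss {G E : Type*} [NormedAddCommGroup E] {w : G → ℝ≥0} {a : G → E}
    {δ δ' δ₁ c C β : ℝ} (h : WNormLE w a (2 * Real.pi * δ / (δ' - δ) * (c * β))) (hδ : 0 ≤ δ)
    (hδ₁ : δ ≤ δ₁) (hlt : δ < δ') (hβ : 0 ≤ β) (hC : 0 ≤ C) (hc : c ≤ C) :
    WNormLE w a (2 * Real.pi * δ₁ * C / (δ' - δ) * β) := by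
  have : 0 < δ' - δ := sub_pos.2 hlt
  refine h.mono ?_
  calc 2 * Real.pi * δ / (δ' - δ) * (c * β) ≤ 2 * Real.pi * δ / (δ' - δ) * (C * β) := by gcongr
    _ ≤ 2 * Real.pi * δ₁ / (δ' - δ) * (C * β) := by gcongr
    _ = 2 * Real.pi * δ₁ * C / (δ' - δ) * β := by ring

namespace IsBoundedSolution

variable {δ R T : ℝ} {ρ v ρ' v' : ℝ → T3 → ℝ} {q q' : ℝ → UnitAddCircle → ℝ} {t : ℝ}

lemma abs_rho_le (h : IsBoundedSolution δ R T ρ v q) (ht : t ∈ Icc 0 T) (x : T3) : |ρ t x| ≤ R :=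
  (h.rho t ht).abs_le (h.rho_bound t ht) x

lemma abs_vel_le (h : IsBoundedSolution δ R T ρ v q) (ht : t ∈ Icc 0 T) (x : T3) : |v t x| ≤ R :=
  (h.vel t ht).abs_le (h.vel_bound t ht) x

lemma exists_bound_continuityRhs (h : IsBoundedSolution δ R T ρ v q) :
    ∃ C, ∀ t ∈ Icc 0 T, ∀ x, |continuityRhs (ρ t) (v t) x| ≤ C :=
  ⟨_, fun t ht => ((h.rho t ht).continuityRhs le_rfl h.one_lt (h.vel t ht)).abs_le
    (.continuityCoeff le_rfl h.one_lt (h.rho_bound t ht) (h.vel_bound t ht))⟩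

lemma exists_bound_advection (h : IsBoundedSolution δ R T ρ v q) :
    ∃ C, ∀ t ∈ Icc 0 T, ∀ x, |advection (ρ t) (v t) x| ≤ C :=
  ⟨_, fun t ht => ((h.rho t ht).advection le_rfl h.one_lt (h.vel t ht)).abs_le
    (.advectionCoeff le_rfl h.one_lt (h.rho_bound t ht) (h.vel_bound t ht))⟩

lemma exists_bound_pressureForce (h : IsBoundedSolution δ R T ρ v q) :
    ∃ C, ∀ t ∈ Icc 0 T, ∀ z, |pressureForce (ρ t) (v t) z| ≤ C :=
  ⟨_, fun t ht z => ((h.rho t ht).pressureForce le_rfl h.one_lt (h.vel t ht)).abs_le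
    (.pressureCoeff le_rfl h.one_lt (h.rho_bound t ht) (h.vel_bound t ht)) ![0, 0, z]⟩

lemma hasDerivWithinAt_fourierC_rho (h : IsBoundedSolution δ R T ρ v q) (ht : t ∈ Icc 0 T)
    (k : Fin 3 → ℤ) :
    HasDerivWithinAt (fun s => fourierC (ρ s) k)
      (continuityCoeff (fourierC (ρ t)) (fourierC (v t)) k) (Icc 0 T) t := by
  obtain ⟨C, hC⟩ := h.exists_bound_continuityRhs
  rw [← ((h.rho t ht).continuityRhs le_rfl h.one_lt (h.vel t ht)).fourierC_eq]
  exact hasDerivWithinAt_fourierC (convex_Icc 0 T) (fun s hs => (h.rho s hs).continuous)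
    h.rho_deriv hC ht k

lemma hasDerivWithinAt_fourierC_vel (h : IsBoundedSolution δ R T ρ v q)
    (hq : PressureLaw T ρ v q) (ht : t ∈ Icc 0 T) (k : Fin 3 → ℤ) :
    HasDerivWithinAt (fun s => fourierC (v s) k)
      (velocityCoeff (fourierC (ρ t)) (fourierC (v t)) k) (Icc 0 T) t := by
  obtain ⟨C, hC⟩ := h.exists_bound_advection
  obtain ⟨C', hC'⟩ := h.exists_bound_pressureForce
  rw [velocityCoeff, ← (((h.rho t ht).advection le_rfl h.one_lt (h.vel t ht)).add
    ((h.rho t ht).pressureForce le_rfl h.one_lt (h.vel t ht))).fourierC_eq]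
  exact hasDerivWithinAt_fourierC (convex_Icc 0 T) (fun s hs => (h.vel s hs).continuous)
    (φ' := fun s x => advection (ρ s) (v s) x + pressureForce (ρ s) (v s) (x 2))
    (fun s hs x => by simpa only [← hq s hs, ← sub_eq_add_neg] using h.vel_deriv s hs x)
    (fun s hs x => (abs_add_le _ _).trans (add_le_add (hC s hs x) (hC' s hs (x 2)))) ht k

lemma lossSystem_sub (h : IsBoundedSolution δ R T ρ v q) (hq : PressureLaw T ρ v q)
    (h' : IsBoundedSolution δ R T ρ' v' q') (hq' : PressureLaw T ρ' v' q') (hR : 0 ≤ R) :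
    LossSystem weight 1 δ (2 * Real.pi * δ * (6 * R + 3 * R ^ 2)) (R + R) 0 T
      (fun t => ![fourierC (ρ t) - fourierC (ρ' t), fourierC (v t) - fourierC (v' t)])
      (fun t => ![continuityCoeff (fourierC (ρ t)) (fourierC (v t))
          - continuityCoeff (fourierC (ρ' t)) (fourierC (v' t)),
        velocityCoeff (fourierC (ρ t)) (fourierC (v t))
          - velocityCoeff (fourierC (ρ' t)) (fourierC (v' t))]) where
  lt := h.one_lt
  L_nonneg := by have := h.one_lt; positivity
  deriv t ht := Fin.forall_fin_two.2
    ⟨fun k => (h.hasDerivWithinAt_fourierC_rho ht k).sub (h'.hasDerivWithinAt_fourierC_rho ht k),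
      fun k => (h.hasDerivWithinAt_fourierC_vel hq ht k).sub
        (h'.hasDerivWithinAt_fourierC_vel hq' ht k)⟩
  bound t ht δ₁ hδ₁ := by
    have hw : weight δ₁ ≤ weight δ := weight_mono (by linarith [hδ₁.1]) hδ₁.2.le
    exact Fin.forall_fin_two.2 ⟨((h.rho_bound t ht).sub (h'.rho_bound t ht)).mono_weight hw,
      ((h.vel_bound t ht).sub (h'.vel_bound t ht)).mono_weight hw⟩
  loss t ht δ₁ δ₂ β hδ₁ hlt hδ₂ hβ := by
    have hw : weight δ₂ ≤ weight δ := weight_mono (by linarith) hδ₂.le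
    have hρ := (h.rho_bound t ht).mono_weight hw
    have hv := (h.vel_bound t ht).mono_weight hw
    have hρ' := (h'.rho_bound t ht).mono_weight hw
    have hv' := (h'.vel_bound t ht).mono_weight hw
    have hle : δ₁ ≤ δ := by linarith
    exact Fin.forall_fin_two.2
      ⟨(WNormLE.continuityCoeff_sub hδ₁ hlt hρ hv hρ' hv' (hβ 0) (hβ 1)).mono_loss (by linarith)
        hle hlt (hβ 0).nonneg (by positivity) (by nlinarith),
      (WNormLE.velocityCoeff_sub hδ₁ hlt hρ hv hρ' hv' (hβ 0) (hβ 1)).mono_loss (by linarith)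
        hle hlt (hβ 0).nonneg (by positivity) (by linarith)⟩

theorem unique (h : IsBoundedSolution δ R T ρ v q) (hq : PressureLaw T ρ v q)
    (h' : IsBoundedSolution δ R T ρ' v' q') (hq' : PressureLaw T ρ' v' q')
    (hρ : ρ 0 = ρ' 0) (hv : v 0 = v' 0) (ht : t ∈ Icc 0 T) : ρ t = ρ' t ∧ v t = v' t := by
  have difference_eq_zero := (h.lossSystem_sub hq h' hq' (h.rho_bound t ht).nonneg).eq_zero
    (one_le_weight le_rfl)
    (Fin.forall_fin_two.2 ⟨sub_eq_zero.2 (by rw [hρ]), sub_eq_zero.2 (by rw [hv])⟩) ht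
  exact ⟨(h.rho t ht).ext (sub_eq_zero.1 (difference_eq_zero 0) ▸ h'.rho t ht),
    (h.vel t ht).ext (sub_eq_zero.1 (difference_eq_zero 1) ▸ h'.vel t ht)⟩

lemma hasDerivWithinAt_perpMean_rho (h : IsBoundedSolution δ R T ρ v q) (ht : t ∈ Icc 0 T)
    (z : UnitAddCircle) :
    HasDerivWithinAt (fun s => perpMean (ρ s) z)
      (-dPar (perpMean fun x => v t x * ρ t x) z) (Icc 0 T) t := by
  obtain ⟨C, hC⟩ := h.exists_bound_continuityRhs
  have hρ := h.rho t ht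
  have hv := h.vel t ht
  rw [← perpMean_neg_driftDiv_add_pd h.one_lt hρ hρ (hv.mul hρ)]
  exact hasDerivWithinAt_perpMean (convex_Icc 0 T) (fun s hs => (h.rho s hs).continuous)
    (fun s hs x _ => h.rho_deriv s hs x) (fun s hs x _ => hC s hs x) ht
    (hρ.continuityRhs le_rfl h.one_lt hv).continuous

lemma hasDerivWithinAt_perpMean_relative_current (h : IsBoundedSolution δ R T ρ v q)
    (ht : t ∈ Icc 0 T) (e : T3) :
    HasDerivWithinAt (fun s => perpMean (fun x => ρ s x * (v s x - v s e)) (e 2))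
      (perpMean (fun x => continuityRhs (ρ t) (v t) x * (v t x - v t e)
        + ρ t x * (advection (ρ t) (v t) x - advection (ρ t) (v t) e)) (e 2)) (Icc 0 T) t := by
  obtain ⟨C₁, hC₁⟩ := h.exists_bound_continuityRhs
  obtain ⟨C₂, hC₂⟩ := h.exists_bound_advection
  have := ((h.rho t ht).continuityRhs le_rfl h.one_lt (h.vel t ht)).continuous
  have := ((h.rho t ht).advection le_rfl h.one_lt (h.vel t ht)).continuous
  have := (h.rho t ht).continuous
  have := (h.vel t ht).continuous
  refine hasDerivWithinAt_perpMean (convex_Icc 0 T) (C := C₁ * (R + R) + R * (C₂ + C₂))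
    (fun s hs => (h.rho s hs).continuous.mul ((h.vel s hs).continuous.sub continuous_const))
    (f' := fun s x => continuityRhs (ρ s) (v s) x * (v s x - v s e)
      + ρ s x * (advection (ρ s) (v s) x - advection (ρ s) (v s) e))
    (fun s hs x hx => ?_) (fun s hs x _ => ?_) ht (by fun_prop)
  · have relative_deriv := (h.vel_deriv s hs x).sub (h.vel_deriv s hs e)
    rw [hx, sub_sub_sub_cancel_right] at relative_deriv
    exact (h.rho_deriv s hs x).fun_mul relative_deriv
  · exact abs_mul_add_mul_le (hC₁ s hs x)
      ((abs_sub _ _).trans (add_le_add (h.abs_vel_le hs x) (h.abs_vel_le hs e)))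
      (h.abs_rho_le hs x) ((abs_sub _ _).trans (add_le_add (hC₂ s hs x) (hC₂ s hs e)))

/-- Differentiating `∫ ρ v dx_⊥` under the integral would require a bound on `q`. The velocity
relative to a point `e` of the same slice does not feel the pressure. -/
lemma hasDerivWithinAt_perpMean_current (h : IsBoundedSolution δ R T ρ v q) (ht : t ∈ Icc 0 T)
    (z : UnitAddCircle) :
    HasDerivWithinAt (fun s => perpMean (fun x => v s x * ρ s x) z)
      (-pressureForce (ρ t) (v t) z - q t z * perpMean (ρ t) z) (Icc 0 T) t := by
  let e : T3 := ![0, 0, z]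
  have hρ := h.rho t ht
  have hv := h.vel t ht
  have split : ∀ s ∈ Icc 0 T, perpMean (fun x => v s x * ρ s x) z
      = perpMean (fun x => ρ s x * (v s x - v s e)) z + perpMean (ρ s) z * v s e := fun s hs => by
    have := (h.rho s hs).continuous
    have := (h.vel s hs).continuous
    rw [← perpMean_mul_const, ← perpMean_add (by fun_prop) (by fun_prop)]
    exact congrArg (perpMean · z) (funext fun x => by ring)
  have deriv_split := ((h.hasDerivWithinAt_perpMean_relative_current ht e).fun_add
    ((h.hasDerivWithinAt_perpMean_rho ht z).fun_mul (h.vel_deriv t ht e))).congr_of_mem split ht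
  refine deriv_split.congr_deriv ?_
  have cF := (hρ.continuityRhs le_rfl h.one_lt hv).continuous
  have cA := (hρ.advection le_rfl h.one_lt hv).continuous
  have := hρ.continuous
  have := hv.continuous
  have integrand_split : (fun x => continuityRhs (ρ t) (v t) x * (v t x - v t e)
        + ρ t x * (advection (ρ t) (v t) x - advection (ρ t) (v t) e))
      = fun x => (continuityRhs (ρ t) (v t) x * v t x + ρ t x * advection (ρ t) (v t) x)
        + (continuityRhs (ρ t) (v t) x * -v t e + ρ t x * -advection (ρ t) (v t) e) :=
    funext fun x => by ring
  have mean_continuityRhs : perpMean (continuityRhs (ρ t) (v t)) z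
      = -dPar (perpMean fun x => v t x * ρ t x) z :=
    perpMean_neg_driftDiv_add_pd h.one_lt hρ hρ (hv.mul hρ) z
  change perpMean _ z + _ = _
  rw [integrand_split, perpMean_add (by fun_prop) (by fun_prop),
    perpMean_add (f := fun x => continuityRhs (ρ t) (v t) x * -v t e) (by fun_prop) (by fun_prop),
    perpMean_mul_const, perpMean_mul_const, perpMean_momentum_balance h.one_lt hρ hv,
    mean_continuityRhs]
  change _ + (_ + perpMean (ρ t) z * (_ - q t z)) = _
  ring

end IsBoundedSolution

lemma hasFourierSeries_one {δ : ℝ} (hδ : 1 ≤ δ) :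
    HasFourierSeries δ (fun _ => 1) (Pi.single 0 1) := by
  refine ⟨hδ, ?_, fun x => ?_⟩
  · rw [wnorm, tsum_eq_single 0 fun k hk => by simp [hk]]
    simp [weight]
  · rw [synth, tsum_eq_single 0 fun k hk => by simp [hk]]
    simp [UnitAddTorus.mFourier_zero]

namespace IsBoundedSolution

variable {δ R T : ℝ} {ρ v : ℝ → T3 → ℝ} {q : ℝ → UnitAddCircle → ℝ} {t : ℝ}

lemma hasDerivWithinAt_meanSym_mul_fourierC_rho (h : IsBoundedSolution δ R T ρ v q)
    (ht : t ∈ Icc 0 T) (k : Fin 3 → ℤ) :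
    HasDerivWithinAt (fun s => (meanSym * fourierC (ρ s)) k)
      ((-(dSym 2 * (meanSym * conv (fourierC (v t)) (fourierC (ρ t)))) : (Fin 3 → ℤ) → ℂ) k)
      (Icc 0 T) t := by
  have mean_continuityCoeff :
      meanSym * continuityCoeff (fourierC (ρ t)) (fourierC (v t))
        = -(dSym 2 * (meanSym * conv (fourierC (v t)) (fourierC (ρ t)))) := by
    rw [continuityCoeff]
    linear_combination -meanSym_mul_driftDivCoeff (fourierC (ρ t)) (fourierC (ρ t))
  rw [← mean_continuityCoeff]
  exact (h.hasDerivWithinAt_fourierC_rho ht k).const_mul (meanSym k)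

lemma hasDerivWithinAt_meanSym_mul_conv (h : IsBoundedSolution δ R T ρ v q)
    (hq : PressureLaw T ρ v q) (ht : t ∈ Icc 0 T) (k : Fin 3 → ℤ) :
    HasDerivWithinAt (fun s => (meanSym * conv (fourierC (v s)) (fourierC (ρ s))) k)
      (conv (meanSym * fourierC (ρ t) - Pi.single 0 1)
        (pressureCoeff (fourierC (ρ t)) (fourierC (v t))) k) (Icc 0 T) t := by
  have hcurrent {s : ℝ} (hs : s ∈ Icc 0 T) := ((h.vel s hs).mul (h.rho s hs)).perpMean
  have hmean {s : ℝ} (hs : s ∈ Icc 0 T) :=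
    (h.rho s hs).perpMean.sub (hasFourierSeries_one h.one_lt.le)
  have hforce {s : ℝ} (hs : s ∈ Icc 0 T) :=
    (h.rho s hs).pressureForce le_rfl h.one_lt (h.vel s hs)
  obtain ⟨C, hC⟩ := h.exists_bound_pressureForce
  rw [← (((hmean ht).mono le_rfl h.one_lt.le).mul (hforce ht)).fourierC_eq]
  refine (hasDerivWithinAt_fourierC (convex_Icc 0 T) (fun s hs => (hcurrent hs).continuous)
    (φ' := fun s x => (perpMean (ρ s) (x 2) - 1) * pressureForce (ρ s) (v s) (x 2))
    (C := (R + (wnorm (weight δ) (Pi.single 0 (1 : ℂ))).toReal) * C)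
    (fun s hs x => ?_) (fun s hs x => ?_) ht k).congr_of_mem
      (fun s hs => by rw [(hcurrent hs).fourierC_eq]) ht
  · refine (h.hasDerivWithinAt_perpMean_current hs (x 2)).congr_deriv ?_
    linear_combination perpMean (ρ s) (x 2) * hq s hs (x 2)
  · rw [abs_mul]
    have mean_bound := (hmean hs).abs_le (((h.rho_bound s hs).mul_of_norm_le_one
      norm_meanSym_le).sub (hasFourierSeries_one h.one_lt.le).wNormLE) x
    exact mul_le_mul mean_bound (hC s hs (x 2)) (abs_nonneg _) ((abs_nonneg _).trans mean_bound)

lemma wNormLE_meanSym_mul_conv (h : IsBoundedSolution δ R T ρ v q) (ht : t ∈ Icc 0 T) :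
    WNormLE (weight δ) (meanSym * conv (fourierC (v t)) (fourierC (ρ t))) (R * R) :=
  ((h.vel_bound t ht).convolve (h.rho_bound t ht)
    (weight_add_le h.one_lt.le)).mul_of_norm_le_one norm_meanSym_le

lemma wNormLE_conv_pressureCoeff (h : IsBoundedSolution δ R T ρ v q) (ht : t ∈ Icc 0 T)
    {δ₁ δ₂ β : ℝ} {a : (Fin 3 → ℤ) → ℂ} (hδ₁ : 1 ≤ δ₁) (hlt : δ₁ < δ₂) (hδ₂ : δ₂ < δ)
    (ha : WNormLE (weight δ₂) a β) :
    WNormLE (weight δ₁) (conv a (pressureCoeff (fourierC (ρ t)) (fourierC (v t))))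
      (2 * Real.pi * δ₁ / (δ₂ - δ₁) * (3 * R ^ 3 * β)) := by
  have hw : weight δ₂ ≤ weight δ := weight_mono (by linarith) hδ₂.le
  exact ((ha.mono_weight (weight_mono (by linarith) hlt.le)).convolve
    (.pressureCoeff hδ₁ hlt ((h.rho_bound t ht).mono_weight hw)
      ((h.vel_bound t ht).mono_weight hw)) (weight_add_le hδ₁)).mono (le_of_eq (by ring))

lemma lossSystem_constraint (h : IsBoundedSolution δ R T ρ v q) (hq : PressureLaw T ρ v q)
    (hR : 0 ≤ R) (hT : 0 ≤ T)
    (hcurrent : dSym 2 * (meanSym * conv (fourierC (v 0)) (fourierC (ρ 0))) = 0) :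
    LossSystem weight 1 δ (2 * Real.pi * δ * (1 + 3 * R ^ 3))
      (R + (wnorm (weight δ) (Pi.single 0 (1 : ℂ))).toReal + (R * R + R * R)) 0 T
      (fun t => ![meanSym * fourierC (ρ t) - Pi.single 0 1,
        meanSym * conv (fourierC (v t)) (fourierC (ρ t))
          - meanSym * conv (fourierC (v 0)) (fourierC (ρ 0))])
      (fun t => ![-(dSym 2 * (meanSym * conv (fourierC (v t)) (fourierC (ρ t))
          - meanSym * conv (fourierC (v 0)) (fourierC (ρ 0)))),
        conv (meanSym * fourierC (ρ t) - Pi.single 0 1)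
          (pressureCoeff (fourierC (ρ t)) (fourierC (v t)))]) where
  lt := h.one_lt
  L_nonneg := by have := h.one_lt; positivity
  deriv t ht := by
    refine Fin.forall_fin_two.2 ⟨fun k => ?_, fun k => ?_⟩
    · have drop_initial : ∀ u, -(dSym 2 * u)
          = -(dSym 2 * (u - meanSym * conv (fourierC (v 0)) (fourierC (ρ 0)))) := fun u => by
        rw [mul_sub, hcurrent, sub_zero]
      exact ((h.hasDerivWithinAt_meanSym_mul_fourierC_rho ht k).sub_const
        ((Pi.single 0 1 : (Fin 3 → ℤ) → ℂ) k)).congr_deriv (congrFun (drop_initial _) k)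
    · exact (h.hasDerivWithinAt_meanSym_mul_conv hq ht k).sub_const
        ((meanSym * conv (fourierC (v 0)) (fourierC (ρ 0))) k)
  bound t ht δ₁ hδ₁ := by
    have hw : weight δ₁ ≤ weight δ := weight_mono (by linarith [hδ₁.1]) hδ₁.2.le
    refine Fin.forall_fin_two.2 ⟨((((h.rho_bound t ht).mul_of_norm_le_one norm_meanSym_le).sub
      (hasFourierSeries_one h.one_lt.le).wNormLE).mono_weight hw).mono ?_,
      (((h.wNormLE_meanSym_mul_conv ht).sub
        (h.wNormLE_meanSym_mul_conv ⟨le_rfl, hT⟩)).mono_weight hw).mono ?_⟩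
    · exact le_add_of_nonneg_right (by positivity)
    · exact le_add_of_nonneg_left (by positivity)
  loss t ht δ₁ δ₂ β hδ₁ hlt hδ₂ hβ := by
    have hβ₀ := (hβ 0).nonneg
    have hle : δ₁ ≤ δ := by linarith
    have : 0 < δ₂ - δ₁ := sub_pos.2 hlt
    refine Fin.forall_fin_two.2 ⟨?_, ?_⟩
    · have current_loss := ((hβ 1).dSym_mul (by linarith) hlt 2).neg
      rw [← one_mul β] at current_loss
      exact current_loss.mono_loss (by linarith) hle hlt hβ₀ (by positivity)
        (le_add_of_nonneg_right (by positivity))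
    · have pressure_loss := h.wNormLE_conv_pressureCoeff ht hδ₁ hlt hδ₂ (hβ 0)
      exact pressure_loss.mono_loss (by linarith) hle hlt hβ₀ (by positivity)
        (le_add_of_nonneg_left zero_le_one)

theorem perpMean_rho_eq_one (h : IsBoundedSolution δ R T ρ v q) (hq : PressureLaw T ρ v q)
    (hmean : ∀ z, perpMean (ρ 0) z = 1)
    (hcurrent : ∀ z, dPar (perpMean fun x => ρ 0 x * v 0 x) z = 0) (ht : t ∈ Icc 0 T)
    (z : UnitAddCircle) : perpMean (ρ t) z = 1 := by
  have hT : 0 ≤ T := ht.1.trans ht.2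
  have h₀ : (0 : ℝ) ∈ Icc 0 T := ⟨le_rfl, hT⟩
  have hone := hasFourierSeries_one h.one_lt.le
  have current_coeff : dSym 2 * (meanSym * conv (fourierC (v 0)) (fourierC (ρ 0))) = 0 := by
    have initial_current := ((h.vel 0 h₀).mul (h.rho 0 h₀)).dPar_perpMean le_rfl h.one_lt
    simp only [mul_comm (v 0 _), hcurrent] at initial_current
    simpa using initial_current.unique (initial_current.sub initial_current |>.congr (by simp) rfl)
  have mean_coeff : meanSym * fourierC (ρ 0) = Pi.single 0 1 :=
    ((h.rho 0 h₀).perpMean.congr (fun x => (hmean (x 2)).symm) rfl).unique hone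
  have mean_sub_one_eq_zero :=
    (h.lossSystem_constraint hq (h.rho_bound t ht).nonneg hT current_coeff).eq_zero
      (one_le_weight le_rfl)
      (Fin.forall_fin_two.2 ⟨sub_eq_zero.2 mean_coeff, sub_self _⟩) ht 0
  exact congrFun ((h.rho t ht).perpMean.ext (sub_eq_zero.1 mean_sub_one_eq_zero ▸ hone)) ![0, 0, z]

lemma dPar_current (h : IsBoundedSolution δ R T ρ v q) (hT : 0 < T)
    (hmean : ∀ t ∈ Icc 0 T, ∀ z, perpMean (ρ t) z = 1) (ht : t ∈ Icc 0 T) (z : UnitAddCircle) :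
    dPar (perpMean fun x => v t x * ρ t x) z = 0 :=
  neg_eq_zero.1 <| (uniqueDiffOn_Icc hT t ht).eq_deriv _ (h.hasDerivWithinAt_perpMean_rho ht z)
    ((hasDerivWithinAt_const t (Icc 0 T) (1 : ℝ)).congr_of_mem (fun s hs => hmean s hs z) ht)

lemma perpMean_current_eq (h : IsBoundedSolution δ R T ρ v q) (hT : 0 < T)
    (hmean : ∀ t ∈ Icc 0 T, ∀ z, perpMean (ρ t) z = 1) (ht : t ∈ Icc 0 T) (z : UnitAddCircle) :
    perpMean (fun x => v t x * ρ t x) z = perpMean (fun x => v t x * ρ t x) 0 :=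
  eq_of_dPar_eq_zero (((h.vel t ht).mul (h.rho t ht)).differentiable_perpMean h.one_lt)
    (h.dPar_current hT hmean ht) z 0

/-- Both sides of the pressure law differ by a constant, since the current is constant in `x_∥`;
the constant vanishes by periodicity. -/
theorem pressureLaw (h : IsBoundedSolution δ R T ρ v q) (hT : 0 < T)
    (hmean : ∀ t ∈ Icc 0 T, ∀ z, perpMean (ρ t) z = 1) {p : ℝ → UnitAddCircle → ℝ}
    (hp : ∀ t ∈ Icc 0 T, Differentiable ℝ fun s : ℝ => p t (s : UnitAddCircle))
    (hq : ∀ t ∈ Icc 0 T, ∀ z, q t z = dPar (p t) z) : PressureLaw T ρ v q := by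
  intro t ht z
  set j := -pressureForce (ρ t) (v t) 0 - q t 0
  have current_rate (z : UnitAddCircle) : -pressureForce (ρ t) (v t) z - q t z = j := by
    have rate_eq := (uniqueDiffOn_Icc hT t ht).eq_deriv _
      (h.hasDerivWithinAt_perpMean_current ht z)
      ((h.hasDerivWithinAt_perpMean_current ht 0).congr_of_mem
        (fun s hs => h.perpMean_current_eq hT hmean hs z) ht)
    simpa only [hmean t ht, mul_one] using rate_eq
  have hflux := hasDerivAt_dPar
    (((h.rho t ht).mul_sq (h.vel t ht)).differentiable_perpMean h.one_lt)
  have total_deriv (y : ℝ) : HasDerivAt (fun s : ℝ => p t (s : UnitAddCircle)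
      + perpMean (fun x => ρ t x * v t x ^ 2) (s : UnitAddCircle) + j * s) 0 y := by
    refine (((hasDerivAt_dPar (hp t ht) y).fun_add (hflux y)).fun_add
      ((hasDerivAt_id y).const_mul j)).congr_deriv ?_
    rw [← current_rate (y : UnitAddCircle), hq t ht, pressureForce]
    ring
  have total_periodic := is_const_of_deriv_eq_zero (fun y => (total_deriv y).differentiableAt)
    (fun y => (total_deriv y).deriv) 1 0
  have one_eq_zero : ((1 : ℝ) : UnitAddCircle) = ((0 : ℝ) : UnitAddCircle) := by simp
  rw [one_eq_zero] at total_periodic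
  linarith [current_rate z]

end IsBoundedSolution

section PowerSeries

variable {G : Type*}

/-- The sum at time `t` of the power series with coefficients `X`, where each `X n` is itself a
family of Fourier coefficients. -/
def series (t : ℝ) (X : ℕ → G → ℂ) : G → ℂ := fun k => ∑' n, (t : ℂ) ^ n * X n k

/-- The power series with coefficients `X` sums to `a` at time `t`, one Fourier coefficient at a
time. -/
def HasSeries (t : ℝ) (X : ℕ → G → ℂ) (a : G → ℂ) : Prop :=
  ∀ k, HasSum (fun n => (t : ℂ) ^ n * X n k) (a k)

/-- Absolute convergence of the power series at time `t` in the space of weight `w`. -/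
def SummableSeries (w : G → ℝ≥0) (t : ℝ) (X : ℕ → G → ℂ) : Prop :=
  ∃ B : ℕ → ℝ, (∀ n, WNormLE w (X n) (B n)) ∧ Summable fun n => |t| ^ n * B n

/-- The coefficients of the product of two power series with respect to convolution. -/
def cauchyProduct [AddCommGroup G] (X Y : ℕ → G → ℂ) (n : ℕ) : G → ℂ :=
  ∑ p ∈ Finset.HasAntidiagonal.antidiagonal n, conv (X p.1) (Y p.2)

lemma norm_ofReal_pow_mul (t : ℝ) (n : ℕ) (z : ℂ) : ‖(t : ℂ) ^ n * z‖ = |t| ^ n * ‖z‖ := by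
  rw [norm_mul, norm_pow, Complex.norm_real, Real.norm_eq_abs]

variable {w : G → ℝ≥0} {t : ℝ} {X Y : ℕ → G → ℂ} {a b : G → ℂ}

namespace HasSeries

lemma series_eq (h : HasSeries t X a) : series t X = a := funext fun k => (h k).tsum_eq

lemma add (hX : HasSeries t X a) (hY : HasSeries t Y b) :
    HasSeries t (fun n => X n + Y n) (a + b) := fun k => by
  simpa [mul_add] using (hX k).add (hY k)

lemma neg (hX : HasSeries t X a) : HasSeries t (fun n => -X n) (-a) := fun k => by
  simpa using (hX k).neg

lemma symbol_mul (hX : HasSeries t X a) (m : G → ℂ) :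
    HasSeries t (fun n => m * X n) (m * a) := fun k => by
  simpa [mul_left_comm] using (hX k).mul_left (m k)

lemma smul (hX : HasSeries t X a) (c : ℂ) : HasSeries t (fun n => c • X n) (c • a) := fun k => by
  simpa [mul_left_comm] using (hX k).mul_left c

end HasSeries

namespace SummableSeries

lemma summable_prod (hX : SummableSeries w t X) (hw : 1 ≤ w) :
    Summable fun p : ℕ × G => ‖(t : ℂ) ^ p.1 * X p.1 p.2‖ := by
  obtain ⟨B, hB, hsum⟩ := hX
  simp only [norm_ofReal_pow_mul]
  refine (summable_prod_of_nonneg fun p => by positivity).mpr ⟨fun n => ?_, ?_⟩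
  · exact ((hB n).summable_norm hw).mul_left (|t| ^ n)
  · refine hsum.of_nonneg_of_le (fun n => tsum_nonneg fun k => by positivity) fun n => ?_
    simp only [tsum_mul_left]
    gcongr
    exact (hB n).tsum_norm_le hw

lemma summable_apply (hX : SummableSeries w t X) (hw : 1 ≤ w) (k : G) :
    Summable fun n => ‖(t : ℂ) ^ n * X n k‖ :=
  (hX.summable_prod hw).prod_symm.prod_factor k

lemma hasSeries (hX : SummableSeries w t X) (hw : 1 ≤ w) : HasSeries t X (series t X) :=
  fun k => (hX.summable_apply hw k).of_norm.hasSum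

lemma wnorm_series_ne_top (hX : SummableSeries w t X) : wnorm w (series t X) ≠ ⊤ := by
  obtain ⟨B, hB, hsum⟩ := hX
  refine (WNormLE.tsum (X := fun n => (t : ℂ) ^ n • X n) (B := fun n => |t| ^ n * B n)
    (fun n => ?_) hsum).wnorm_ne_top
  simpa using (hB n).smul ((t : ℂ) ^ n)

lemma symbol_mul (hX : SummableSeries w t X) {m : G → ℂ} (hm : ∀ k, ‖m k‖ ≤ 1) :
    SummableSeries w t fun n => m * X n :=
  let ⟨B, hB, hsum⟩ := hX
  ⟨B, fun n => (hB n).mul_of_norm_le_one hm, hsum⟩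

lemma synth_series {d : Type*} [Fintype d] {w : (d → ℤ) → ℝ≥0} {X : ℕ → (d → ℤ) → ℂ}
    (hX : SummableSeries w t X) (hw : 1 ≤ w) (x : UnitAddTorus d) :
    synth (series t X) x = ∑' n, (t : ℂ) ^ n * synth (X n) x := by
  have hsum : Summable (Function.uncurry fun (n : ℕ) (k : d → ℤ) =>
      (t : ℂ) ^ n * X n k * UnitAddTorus.mFourier k x) :=
    .of_norm ((hX.summable_prod hw).congr fun p => by
      simp [Function.uncurry, norm_mFourier_apply])
  simp only [synth, series, ← tsum_mul_right, ← tsum_mul_left]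
  rw [hsum.tsum_comm]
  exact tsum_congr fun n => tsum_congr fun k => by ring

variable [AddCommGroup G]

protected lemma cauchyProduct (hX : SummableSeries w t X) (hY : SummableSeries w t Y)
    (hadd : ∀ k l, w (k + l) ≤ w k * w l) : SummableSeries w t (cauchyProduct X Y) := by
  obtain ⟨A, hA, sumA⟩ := hX
  obtain ⟨B, hB, sumB⟩ := hY
  have hsum := summable_sum_mul_antidiagonal_of_summable_mul (f := fun n => |t| ^ n * A n)
    (g := fun n => |t| ^ n * B n) (sumA.mul_of_nonneg sumB
      (fun n => mul_nonneg (pow_nonneg (abs_nonneg t) n) (hA n).nonneg)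
      fun n => mul_nonneg (pow_nonneg (abs_nonneg t) n) (hB n).nonneg)
  refine ⟨fun n => ∑ p ∈ Finset.HasAntidiagonal.antidiagonal n, A p.1 * B p.2,
    fun n => WNormLE.sum fun p _ => (hA p.1).convolve (hB p.2) hadd, hsum.congr fun n => ?_⟩
  rw [Finset.mul_sum]
  refine Finset.sum_congr rfl fun p hp => ?_
  rw [← Finset.HasAntidiagonal.mem_antidiagonal.mp hp, pow_add]
  ring

lemma summable_conv_term (hX : SummableSeries w t X) (hY : SummableSeries w t Y) (hw : 1 ≤ w)
    (k : G) : Summable (Function.uncurry fun (l : G) (p : ℕ × ℕ) =>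
      ((t : ℂ) ^ p.1 * X p.1 (k - l)) * ((t : ℂ) ^ p.2 * Y p.2 l)) := by
  obtain ⟨B, hB, hsum⟩ := hX
  have majorant : Summable fun p : ℕ × (ℕ × G) =>
      |t| ^ p.1 * B p.1 * ‖(t : ℂ) ^ p.2.1 * Y p.2.1 p.2.2‖ :=
    hsum.mul_of_nonneg (hY.summable_prod hw)
      (fun n => mul_nonneg (by positivity) (hB n).nonneg) fun _ => norm_nonneg _
  let e : G × (ℕ × ℕ) ≃ ℕ × (ℕ × G) :=
    { toFun := fun p => (p.2.1, (p.2.2, p.1))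
      invFun := fun p => (p.2.2, (p.1, p.2.1))
      left_inv := fun _ => rfl
      right_inv := fun _ => rfl }
  refine .of_norm_bounded (e.summable_iff.mpr majorant) fun p => ?_
  simp only [Function.uncurry, Function.comp_apply, e, Equiv.coe_fn_mk]
  rw [norm_mul, norm_ofReal_pow_mul t p.2.1]
  gcongr
  exact (hB _).norm_apply_le hw _

lemma hasSum_conv_series (hX : SummableSeries w t X) (hY : SummableSeries w t Y) (hw : 1 ≤ w)
    (k : G) : HasSum (fun p : ℕ × ℕ => (t : ℂ) ^ (p.1 + p.2) * conv (X p.1) (Y p.2) k)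
      (conv (series t X) (series t Y) k) := by
  have hsum := hX.summable_conv_term hY hw k
  have term_eq (p : ℕ × ℕ) : (t : ℂ) ^ (p.1 + p.2) * conv (X p.1) (Y p.2) k
      = ∑' l, ((t : ℂ) ^ p.1 * X p.1 (k - l)) * ((t : ℂ) ^ p.2 * Y p.2 l) := by
    rw [conv, ← tsum_mul_left]
    exact tsum_congr fun l => by rw [pow_add]; ring
  have conv_eq : conv (series t X) (series t Y) k
      = ∑' (p : ℕ × ℕ) (l : G), ((t : ℂ) ^ p.1 * X p.1 (k - l)) * ((t : ℂ) ^ p.2 * Y p.2 l) := by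
    rw [hsum.tsum_comm, conv]
    exact tsum_congr fun l => tsum_mul_tsum_of_summable_norm (hX.summable_apply hw (k - l))
      (hY.summable_apply hw l)
  rw [conv_eq]
  simp only [term_eq]
  exact hsum.prod_symm.prod.hasSum

lemma hasSeries_cauchyProduct (hX : SummableSeries w t X) (hY : SummableSeries w t Y)
    (hw : 1 ≤ w) : HasSeries t (cauchyProduct X Y) (conv (series t X) (series t Y)) := fun k => by
  have hsum := (Finset.HasAntidiagonal.sigmaAntidiagonalEquivProd (A := ℕ)).hasSum_iff.mpr
    (hX.hasSum_conv_series hY hw k)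
  refine (hsum.sigma fun n => hasSum_fintype _).congr_fun fun n => ?_
  rw [cauchyProduct, Finset.sum_apply, Finset.mul_sum, ← Finset.sum_coe_sort]
  refine Finset.sum_congr rfl fun p _ => ?_
  simp only [Function.comp, Finset.HasAntidiagonal.sigmaAntidiagonalEquivProd_apply]
  rw [Finset.HasAntidiagonal.mem_antidiagonal.mp p.2]

end SummableSeries

section CauchyProduct

variable [AddCommGroup G] {X' Y' : ℕ → G → ℂ} {n : ℕ}

lemma cauchyProduct_congr (hX : ∀ m ≤ n, X m = X' m) (hY : ∀ m ≤ n, Y m = Y' m) :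
    cauchyProduct X Y n = cauchyProduct X' Y' n :=
  Finset.sum_congr rfl fun p hp => by
    rw [hX p.1 (Finset.HasAntidiagonal.antidiagonal.fst_le hp),
      hY p.2 (Finset.HasAntidiagonal.antidiagonal.snd_le hp)]

lemma Hermitian.cauchyProduct (hX : ∀ m ≤ n, Hermitian (X m)) (hY : ∀ m ≤ n, Hermitian (Y m)) :
    Hermitian (cauchyProduct X Y n) :=
  .sum fun p hp =>
    (hX p.1 (Finset.HasAntidiagonal.antidiagonal.fst_le hp)).convolve
      (hY p.2 (Finset.HasAntidiagonal.antidiagonal.snd_le hp))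

end CauchyProduct

end PowerSeries

section TaylorCoefficients

/-- The Taylor coefficients of `∇_⊥ · (E^⊥ f)`. -/
def driftDivStep (X Y : ℕ → (Fin 3 → ℤ) → ℂ) (n : ℕ) : (Fin 3 → ℤ) → ℂ :=
  dSym 0 * cauchyProduct (fun m => driftSym₁ * X m) Y n
    + dSym 1 * cauchyProduct (fun m => driftSym₂ * X m) Y n

/-- The Taylor coefficients of `continuityRhs`. -/
def continuityStep (X W : ℕ → (Fin 3 → ℤ) → ℂ) (n : ℕ) : (Fin 3 → ℤ) → ℂ :=
  -(driftDivStep X X n + dSym 2 * cauchyProduct W X n)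

/-- The Taylor coefficients of the right hand side of the velocity equation in which the pressure
is eliminated by the pressure law. -/
def velocityStep (X W : ℕ → (Fin 3 → ℤ) → ℂ) (n : ℕ) : (Fin 3 → ℤ) → ℂ :=
  -(driftDivStep X W n + dSym 2 * ((1 / 2 : ℝ) : ℂ) • cauchyProduct W W n)
    + dSym 2 * (meanSym * cauchyProduct X (cauchyProduct W W) n)

/-- The Taylor coefficients in time of the solution `(ρ, v)` whose initial values have Fourier
coefficients `a` and `b`. -/
def taylor (a b : (Fin 3 → ℤ) → ℂ) : ℕ → ((Fin 3 → ℤ) → ℂ) × ((Fin 3 → ℤ) → ℂ)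
  | 0 => (a, b)
  | n + 1 =>
    let X m := if _ : m ≤ n then (taylor a b m).1 else 0
    let W m := if _ : m ≤ n then (taylor a b m).2 else 0
    (((1 / (n + 1) : ℝ) : ℂ) • continuityStep X W n, ((1 / (n + 1) : ℝ) : ℂ) • velocityStep X W n)

/-- The Taylor coefficients of the density. -/
def taylorRho (a b : (Fin 3 → ℤ) → ℂ) (n : ℕ) : (Fin 3 → ℤ) → ℂ := (taylor a b n).1

/-- The Taylor coefficients of the velocity. -/
def taylorVel (a b : (Fin 3 → ℤ) → ℂ) (n : ℕ) : (Fin 3 → ℤ) → ℂ := (taylor a b n).2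

section Step

variable {w : (Fin 3 → ℤ) → ℝ≥0} {t : ℝ} {X W X' W' : ℕ → (Fin 3 → ℤ) → ℂ} {n : ℕ}

lemma hasSeries_driftDivStep (hX : SummableSeries w t X) (hW : SummableSeries w t W)
    (hw : 1 ≤ w) :
    HasSeries t (driftDivStep X W) (driftDivCoeff (series t X) (series t W)) := by
  have h₁ := ((hX.symbol_mul norm_driftSym₁_le).hasSeries_cauchyProduct hW hw).symbol_mul (dSym 0)
  have h₂ := ((hX.symbol_mul norm_driftSym₂_le).hasSeries_cauchyProduct hW hw).symbol_mul (dSym 1)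
  rw [((hX.hasSeries hw).symbol_mul driftSym₁).series_eq] at h₁
  rw [((hX.hasSeries hw).symbol_mul driftSym₂).series_eq] at h₂
  exact h₁.add h₂

lemma hasSeries_continuityStep (hX : SummableSeries w t X) (hW : SummableSeries w t W)
    (hw : 1 ≤ w) :
    HasSeries t (continuityStep X W) (continuityCoeff (series t X) (series t W)) :=
  ((hasSeries_driftDivStep hX hX hw).add
    ((hW.hasSeries_cauchyProduct hX hw).symbol_mul (dSym 2))).neg

lemma hasSeries_velocityStep (hX : SummableSeries w t X) (hW : SummableSeries w t W)
    (hw : 1 ≤ w) (hadd : ∀ k l, w (k + l) ≤ w k * w l) :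
    HasSeries t (velocityStep X W) (velocityCoeff (series t X) (series t W)) := by
  have cubic := hX.hasSeries_cauchyProduct (hW.cauchyProduct hW hadd) hw
  rw [(hW.hasSeries_cauchyProduct hW hw).series_eq] at cubic
  exact ((hasSeries_driftDivStep hX hW hw).add
    (((hW.hasSeries_cauchyProduct hW hw).smul ((1 / 2 : ℝ) : ℂ)).symbol_mul (dSym 2))).neg.add
      ((cubic.symbol_mul meanSym).symbol_mul (dSym 2))

lemma driftDivStep_congr (hX : ∀ m ≤ n, X m = X' m) (hW : ∀ m ≤ n, W m = W' m) :
    driftDivStep X W n = driftDivStep X' W' n := by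
  rw [driftDivStep, driftDivStep, cauchyProduct_congr (fun m hm => by rw [hX m hm]) hW,
    cauchyProduct_congr (X := fun m => driftSym₂ * X m) (fun m hm => by rw [hX m hm]) hW]

lemma continuityStep_congr (hX : ∀ m ≤ n, X m = X' m) (hW : ∀ m ≤ n, W m = W' m) :
    continuityStep X W n = continuityStep X' W' n := by
  rw [continuityStep, continuityStep, driftDivStep_congr hX hX, cauchyProduct_congr hW hX]

lemma velocityStep_congr (hX : ∀ m ≤ n, X m = X' m) (hW : ∀ m ≤ n, W m = W' m) :
    velocityStep X W n = velocityStep X' W' n := by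
  rw [velocityStep, velocityStep, driftDivStep_congr hX hW, cauchyProduct_congr hW hW,
    cauchyProduct_congr hX fun m hm => cauchyProduct_congr (fun l hl => hW l (hl.trans hm))
      fun l hl => hW l (hl.trans hm)]

namespace Hermitian

protected lemma driftDivStep (hX : ∀ m ≤ n, Hermitian (X m)) (hW : ∀ m ≤ n, Hermitian (W m)) :
    Hermitian (driftDivStep X W n) :=
  ((hermitian_dSym 0).mul (.cauchyProduct (fun m hm => hermitian_driftSym₁.mul (hX m hm)) hW)).add
    ((hermitian_dSym 1).mul (.cauchyProduct (fun m hm => hermitian_driftSym₂.mul (hX m hm)) hW))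

protected lemma continuityStep (hX : ∀ m ≤ n, Hermitian (X m)) (hW : ∀ m ≤ n, Hermitian (W m)) :
    Hermitian (continuityStep X W n) :=
  ((Hermitian.driftDivStep hX hX).add ((hermitian_dSym 2).mul (.cauchyProduct hW hX))).neg

protected lemma velocityStep (hX : ∀ m ≤ n, Hermitian (X m)) (hW : ∀ m ≤ n, Hermitian (W m)) :
    Hermitian (velocityStep X W n) :=
  ((Hermitian.driftDivStep hX hW).add
    ((hermitian_dSym 2).mul ((Hermitian.cauchyProduct hW hW).real_smul _))).neg.add
    ((hermitian_dSym 2).mul (hermitian_meanSym.mul (.cauchyProduct hX fun _ hm =>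
      .cauchyProduct (fun l hl => hW l (hl.trans hm)) fun l hl => hW l (hl.trans hm))))

end Hermitian

end Step

variable (a b : (Fin 3 → ℤ) → ℂ)

lemma taylorRho_zero : taylorRho a b 0 = a := by rw [taylorRho, taylor]

lemma taylorVel_zero : taylorVel a b 0 = b := by rw [taylorVel, taylor]

lemma taylorRho_succ (n : ℕ) : taylorRho a b (n + 1)
    = ((1 / (n + 1) : ℝ) : ℂ) • continuityStep (taylorRho a b) (taylorVel a b) n := by
  rw [taylorRho, taylor]
  exact congrArg (((1 / (n + 1) : ℝ) : ℂ) • ·)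
    (continuityStep_congr (fun m hm => dif_pos hm) fun m hm => dif_pos hm)

lemma taylorVel_succ (n : ℕ) : taylorVel a b (n + 1)
    = ((1 / (n + 1) : ℝ) : ℂ) • velocityStep (taylorRho a b) (taylorVel a b) n := by
  rw [taylorVel, taylor]
  exact congrArg (((1 / (n + 1) : ℝ) : ℂ) • ·)
    (velocityStep_congr (fun m hm => dif_pos hm) fun m hm => dif_pos hm)

variable {a b}

lemma hermitian_taylor (ha : Hermitian a) (hb : Hermitian b) (n : ℕ) :
    Hermitian (taylorRho a b n) ∧ Hermitian (taylorVel a b n) := by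
  induction n using Nat.strong_induction_on with
  | _ n ih =>
    cases n with
    | zero => exact ⟨(taylorRho_zero a b).symm ▸ ha, (taylorVel_zero a b).symm ▸ hb⟩
    | succ n =>
      rw [taylorRho_succ, taylorVel_succ]
      have hX : ∀ m ≤ n, Hermitian (taylorRho a b m) := fun m hm => (ih m (by omega)).1
      have hW : ∀ m ≤ n, Hermitian (taylorVel a b m) := fun m hm => (ih m (by omega)).2
      exact ⟨(Hermitian.continuityStep hX hW).real_smul _,
        (Hermitian.velocityStep hX hW).real_smul _⟩

end TaylorCoefficients

section Majorant

/-- The Cauchy–Kovalevskaya majorant of the Taylor coefficients. The factor `1 / (n + 1) ^ 2`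
makes it stable under Cauchy products, up to a constant. -/
def majorant (κ : ℝ) (n : ℕ) : ℝ := κ ^ n / ((n : ℝ) + 1) ^ 2

variable {κ : ℝ}

lemma majorant_zero : majorant κ 0 = 1 := by simp [majorant]

lemma majorant_nonneg (hκ : 0 ≤ κ) (n : ℕ) : 0 ≤ majorant κ n := by
  unfold majorant
  positivity

lemma majorant_le_pow (hκ : 0 ≤ κ) (n : ℕ) : majorant κ n ≤ κ ^ n :=
  div_le_self (pow_nonneg hκ n) (one_le_pow₀ (by linarith [n.cast_nonneg (α := ℝ)]))

lemma sum_range_one_div_sq_le (n : ℕ) :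
    ∑ i ∈ Finset.range (n + 1), 1 / ((i : ℝ) + 1) ^ 2 ≤ 2 - 1 / ((n : ℝ) + 1) := by
  induction n with
  | zero => norm_num
  | succ n ih =>
    rw [Finset.sum_range_succ]
    push_cast
    have telescope : 1 / ((n : ℝ) + 1 + 1) ^ 2 ≤ 1 / (n + 1) - 1 / (n + 1 + 1) := by
      rw [div_sub_div _ _ (by positivity) (by positivity),
        div_le_div_iff₀ (by positivity) (by positivity)]
      nlinarith
    linarith

lemma one_div_sq_mul_one_div_sq_le {x y : ℝ} (hx : 0 ≤ x) (hy : 0 ≤ y) :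
    1 / (x + 1) ^ 2 * (1 / (y + 1) ^ 2)
      ≤ 2 / (x + y + 1) ^ 2 * (1 / (x + 1) ^ 2 + 1 / (y + 1) ^ 2) := by
  have sq_le : (x + y + 1) ^ 2 ≤ 2 * ((x + 1) ^ 2 + (y + 1) ^ 2) := by
    nlinarith [sq_nonneg (x - y)]
  rw [← sub_nonneg]
  have : 2 / (x + y + 1) ^ 2 * (1 / (x + 1) ^ 2 + 1 / (y + 1) ^ 2)
      - 1 / (x + 1) ^ 2 * (1 / (y + 1) ^ 2)
      = (2 * ((x + 1) ^ 2 + (y + 1) ^ 2) - (x + y + 1) ^ 2)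
        / ((x + y + 1) ^ 2 * (x + 1) ^ 2 * (y + 1) ^ 2) := by
    field_simp
    ring
  rw [this]
  exact div_nonneg (sub_nonneg.2 sq_le) (by positivity)

lemma sum_antidiagonal_one_div_sq_le (n : ℕ) :
    ∑ p ∈ Finset.HasAntidiagonal.antidiagonal n,
      1 / ((p.1 : ℝ) + 1) ^ 2 * (1 / ((p.2 : ℝ) + 1) ^ 2) ≤ 8 / ((n : ℝ) + 1) ^ 2 := by
  have sum_fst : ∑ p ∈ Finset.HasAntidiagonal.antidiagonal n, 1 / ((p.1 : ℝ) + 1) ^ 2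
      = ∑ i ∈ Finset.range (n + 1), 1 / ((i : ℝ) + 1) ^ 2 :=
    Finset.Nat.sum_antidiagonal_eq_sum_range_succ_mk (fun p : ℕ × ℕ => 1 / ((p.1 : ℝ) + 1) ^ 2) n
  have sum_snd : ∑ p ∈ Finset.HasAntidiagonal.antidiagonal n, 1 / ((p.2 : ℝ) + 1) ^ 2
      = ∑ i ∈ Finset.range (n + 1), 1 / ((i : ℝ) + 1) ^ 2 := by
    rw [← sum_fst, ← Finset.Nat.sum_antidiagonal_swap]
    rfl
  calc ∑ p ∈ Finset.HasAntidiagonal.antidiagonal n,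
        1 / ((p.1 : ℝ) + 1) ^ 2 * (1 / ((p.2 : ℝ) + 1) ^ 2)
      ≤ ∑ p ∈ Finset.HasAntidiagonal.antidiagonal n,
          2 / ((n : ℝ) + 1) ^ 2 * (1 / ((p.1 : ℝ) + 1) ^ 2 + 1 / ((p.2 : ℝ) + 1) ^ 2) := by
        refine Finset.sum_le_sum fun p hp => ?_
        rw [← Finset.HasAntidiagonal.mem_antidiagonal.mp hp, Nat.cast_add]
        exact one_div_sq_mul_one_div_sq_le p.1.cast_nonneg p.2.cast_nonneg
    _ = 2 / ((n : ℝ) + 1) ^ 2 * (2 * ∑ i ∈ Finset.range (n + 1), 1 / ((i : ℝ) + 1) ^ 2) := by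
        rw [← Finset.mul_sum, Finset.sum_add_distrib, sum_fst, sum_snd, two_mul]
    _ ≤ 2 / ((n : ℝ) + 1) ^ 2 * (2 * 2) := by
        gcongr
        exact (sum_range_one_div_sq_le n).trans (sub_le_self _ (by positivity))
    _ = 8 / ((n : ℝ) + 1) ^ 2 := by ring

lemma sum_antidiagonal_majorant_le (hκ : 0 ≤ κ) (n : ℕ) :
    ∑ p ∈ Finset.HasAntidiagonal.antidiagonal n, majorant κ p.1 * majorant κ p.2
      ≤ 8 * majorant κ n :=
  calc ∑ p ∈ Finset.HasAntidiagonal.antidiagonal n, majorant κ p.1 * majorant κ p.2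
      = κ ^ n * ∑ p ∈ Finset.HasAntidiagonal.antidiagonal n,
          1 / ((p.1 : ℝ) + 1) ^ 2 * (1 / ((p.2 : ℝ) + 1) ^ 2) := by
        rw [Finset.mul_sum]
        refine Finset.sum_congr rfl fun p hp => ?_
        rw [← Finset.HasAntidiagonal.mem_antidiagonal.mp hp, pow_add, majorant, majorant]
        ring
    _ ≤ κ ^ n * (8 / ((n : ℝ) + 1) ^ 2) := by
        gcongr
        exact sum_antidiagonal_one_div_sq_le n
    _ = 8 * majorant κ n := by rw [majorant]; ring

lemma add_two_div_cube_le (n : ℕ) :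
    ((n : ℝ) + 2) / ((n : ℝ) + 1) ^ 3 ≤ 8 / ((n : ℝ) + 2) ^ 2 := by
  rw [div_le_div_iff₀ (by positivity) (by positivity)]
  calc ((n : ℝ) + 2) * ((n : ℝ) + 2) ^ 2 = ((n : ℝ) + 2) ^ 3 := by ring
    _ ≤ (2 * ((n : ℝ) + 1)) ^ 3 := by gcongr; linarith [n.cast_nonneg (α := ℝ)]
    _ = 8 * ((n : ℝ) + 1) ^ 3 := by ring

end Majorant

section Growth

/-- The growth condition on the first `N` Taylor coefficients: in the norm of any radius `δ < δ₀`
they are bounded by `A` times the majorant whose rate is inverse to the distance to `δ₀`. -/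
def GrowthLE (δ₀ c : ℝ) (N : ℕ) (X : ℕ → (Fin 3 → ℤ) → ℂ) (A : ℝ) : Prop :=
  ∀ n ≤ N, ∀ δ, 1 ≤ δ → δ < δ₀ → WNormLE (weight δ) (X n) (A * majorant (c / (δ₀ - δ)) n)

namespace GrowthLE

variable {δ₀ c A B : ℝ} {N : ℕ} {X Y : ℕ → (Fin 3 → ℤ) → ℂ}

lemma nonneg (h : GrowthLE δ₀ c N X A) (hδ₀ : 1 < δ₀) : 0 ≤ A := by
  simpa [majorant_zero] using (h 0 N.zero_le 1 le_rfl hδ₀).nonneg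

lemma zero (h : WNormLE (weight δ₀) (X 0) A) : GrowthLE δ₀ c 0 X A := fun n hn δ hδ hlt => by
  rw [Nat.le_zero.1 hn, majorant_zero, mul_one]
  exact h.mono_weight (weight_mono (zero_le_one.trans hδ) hlt.le)

lemma succ (h : GrowthLE δ₀ c N X A) (hN : ∀ δ, 1 ≤ δ → δ < δ₀ →
    WNormLE (weight δ) (X (N + 1)) (A * majorant (c / (δ₀ - δ)) (N + 1))) :
    GrowthLE δ₀ c (N + 1) X A := fun n hn => by
  rcases Nat.le_succ_iff.1 hn with hn | rfl
  exacts [h n hn, hN]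

lemma symbol_mul (h : GrowthLE δ₀ c N X A) {m : (Fin 3 → ℤ) → ℂ} (hm : ∀ k, ‖m k‖ ≤ 1) :
    GrowthLE δ₀ c N (fun n => m * X n) A :=
  fun n hn δ hδ hlt => (h n hn δ hδ hlt).mul_of_norm_le_one hm

lemma smul (h : GrowthLE δ₀ c N X A) (z : ℂ) : GrowthLE δ₀ c N (fun n => z • X n) (‖z‖ * A) :=
  fun n hn δ hδ hlt => by
    rw [mul_assoc]
    exact (h n hn δ hδ hlt).smul z

protected lemma cauchyProduct (hX : GrowthLE δ₀ c N X A) (hY : GrowthLE δ₀ c N Y B) (hc : 0 ≤ c) :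
    GrowthLE δ₀ c N (cauchyProduct X Y) (8 * A * B) := fun n hn δ hδ hlt => by
  have hδ₀ : 1 < δ₀ := hδ.trans_lt hlt
  have hAB : 0 ≤ A * B := mul_nonneg (hX.nonneg hδ₀) (hY.nonneg hδ₀)
  have hκ : 0 ≤ c / (δ₀ - δ) := div_nonneg hc (sub_nonneg.2 hlt.le)
  have hsum := WNormLE.sum (s := Finset.HasAntidiagonal.antidiagonal n) fun p hp =>
    (hX p.1 ((Finset.HasAntidiagonal.antidiagonal.fst_le hp).trans hn) δ hδ hlt).convolve
      (hY p.2 ((Finset.HasAntidiagonal.antidiagonal.snd_le hp).trans hn) δ hδ hlt)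
      (weight_add_le hδ)
  refine hsum.mono ?_
  calc ∑ p ∈ Finset.HasAntidiagonal.antidiagonal n,
        A * majorant (c / (δ₀ - δ)) p.1 * (B * majorant (c / (δ₀ - δ)) p.2)
      = A * B * ∑ p ∈ Finset.HasAntidiagonal.antidiagonal n,
          majorant (c / (δ₀ - δ)) p.1 * majorant (c / (δ₀ - δ)) p.2 := by
        rw [Finset.mul_sum]
        exact Finset.sum_congr rfl fun p _ => by ring
    _ ≤ A * B * (8 * majorant (c / (δ₀ - δ)) n) :=
        mul_le_mul_of_nonneg_left (sum_antidiagonal_majorant_le hκ n) hAB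
    _ = 8 * A * B * majorant (c / (δ₀ - δ)) n := by ring

/-- The loss at the radius at distance `(δ₀ - δ) / (n + 2)` from `δ` costs a factor `n + 2`, which
the factor `1 / (n + 1)` from the integration in time compensates. -/
lemma dSym_mul {n : ℕ} (hX : GrowthLE δ₀ c n X A) (hc : 0 < c) (i : Fin 3) {δ : ℝ} (hδ : 1 ≤ δ)
    (hlt : δ < δ₀) : WNormLE (weight δ) (((1 / (n + 1) : ℝ) : ℂ) • (dSym i * X n))
      (48 * Real.pi * δ₀ / c * A * majorant (c / (δ₀ - δ)) (n + 1)) := by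
  have hA : 0 ≤ A := hX.nonneg (hδ.trans_lt hlt)
  obtain ⟨δ', ⟨hδ', hlt'⟩, inv_gap, inv_gap_pow⟩ := exists_intermediate_radius n hlt
  have gap_pos : 0 < δ₀ - δ := sub_pos.2 hlt
  have hδ₀ : 0 < δ₀ := by linarith
  refine (((hX n le_rfl δ' (hδ.trans hδ'.le) hlt').dSym_mul (by linarith) hδ' i).smul
    ((1 / (n + 1) : ℝ) : ℂ)).mono ?_
  rw [Complex.norm_real, Real.norm_of_nonneg (by positivity)]
  set g := (δ₀ - δ)⁻¹ with hg
  have hg_pos : 0 < g := inv_pos.2 gap_pos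
  calc 1 / ((n : ℝ) + 1)
        * (2 * Real.pi * δ / (δ' - δ) * (A * majorant (c / (δ₀ - δ')) n))
      = 2 * Real.pi * A * c ^ n * g * (((n : ℝ) + 2) / (n + 1) ^ 3) * δ * (δ₀ - δ')⁻¹ ^ n := by
        rw [div_eq_mul_inv _ (δ' - δ), inv_gap, majorant, div_eq_mul_inv c, mul_pow, hg]
        field_simp
    _ ≤ 2 * Real.pi * A * c ^ n * g * (8 / ((n : ℝ) + 2) ^ 2) * δ₀ * (3 * g ^ n) := by
        have := add_two_div_cube_le n
        gcongr
    _ = 48 * Real.pi * δ₀ / c * A * majorant (c / (δ₀ - δ)) (n + 1) := by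
        rw [majorant, div_eq_mul_inv c (δ₀ - δ), ← hg, mul_pow, pow_succ c, pow_succ g]
        push_cast
        field_simp
        ring

section Step

variable {n : ℕ} {W : ℕ → (Fin 3 → ℤ) → ℂ} {δ : ℝ}

protected lemma driftDivStep (hX : GrowthLE δ₀ c n X A) (hY : GrowthLE δ₀ c n Y B) (hc : 0 < c)
    (hδ : 1 ≤ δ) (hlt : δ < δ₀) :
    WNormLE (weight δ) (((1 / (n + 1) : ℝ) : ℂ) • driftDivStep X Y n)
      (48 * Real.pi * δ₀ / c * (16 * A * B) * majorant (c / (δ₀ - δ)) (n + 1)) := by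
  rw [driftDivStep, smul_add]
  refine ((((hX.symbol_mul norm_driftSym₁_le).cauchyProduct hY hc.le).dSym_mul hc 0 hδ hlt).add
    (((hX.symbol_mul norm_driftSym₂_le).cauchyProduct hY hc.le).dSym_mul hc 1 hδ hlt)).mono
    (le_of_eq ?_)
  ring

protected lemma continuityStep (hX : GrowthLE δ₀ c n X A) (hW : GrowthLE δ₀ c n W B) (hc : 0 < c)
    (hδ : 1 ≤ δ) (hlt : δ < δ₀) :
    WNormLE (weight δ) (((1 / (n + 1) : ℝ) : ℂ) • continuityStep X W n)
      (48 * Real.pi * δ₀ / c * (16 * A * A + 8 * B * A)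
        * majorant (c / (δ₀ - δ)) (n + 1)) := by
  rw [continuityStep, smul_neg, smul_add]
  refine ((hX.driftDivStep hX hc hδ hlt).add
    ((hW.cauchyProduct hX hc.le).dSym_mul hc 2 hδ hlt)).neg.mono (le_of_eq ?_)
  ring

protected lemma velocityStep (hX : GrowthLE δ₀ c n X A) (hW : GrowthLE δ₀ c n W B) (hc : 0 < c)
    (hδ : 1 ≤ δ) (hlt : δ < δ₀) :
    WNormLE (weight δ) (((1 / (n + 1) : ℝ) : ℂ) • velocityStep X W n)
      (48 * Real.pi * δ₀ / c * (16 * A * B + 4 * B * B + 64 * A * B * B)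
        * majorant (c / (δ₀ - δ)) (n + 1)) := by
  have hWW := hW.cauchyProduct hW hc.le
  have norm_half : ‖((1 / 2 : ℝ) : ℂ)‖ = 1 / 2 := by
    rw [Complex.norm_real, Real.norm_of_nonneg (by norm_num)]
  rw [velocityStep, smul_add, smul_neg, smul_add]
  refine (((hX.driftDivStep hW hc hδ hlt).add
    ((hWW.smul ((1 / 2 : ℝ) : ℂ)).dSym_mul hc 2 hδ hlt)).neg.add
    (((hX.cauchyProduct hWW hc.le).symbol_mul norm_meanSym_le).dSym_mul hc 2 hδ hlt)).mono
    (le_of_eq ?_)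
  rw [norm_half]
  ring

end Step

protected lemma taylor {M : ℝ} {a b : (Fin 3 → ℤ) → ℂ} (hδ₀ : 1 < δ₀) (hc : 0 < c)
    (hcM : 48 * Real.pi * δ₀ * (24 * M + 64 * M ^ 2) ≤ c) (ha : WNormLE (weight δ₀) a M)
    (hb : WNormLE (weight δ₀) b M) (N : ℕ) :
    GrowthLE δ₀ c N (taylorRho a b) M ∧ GrowthLE δ₀ c N (taylorVel a b) M := by
  have hM : 0 ≤ M := ha.nonneg
  have absorb {q : ℝ} (hq : q ≤ (24 * M + 64 * M ^ 2) * M) {δ : ℝ} (hlt : δ < δ₀) (n : ℕ) :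
      48 * Real.pi * δ₀ / c * q * majorant (c / (δ₀ - δ)) n
        ≤ M * majorant (c / (δ₀ - δ)) n := by
    refine mul_le_mul_of_nonneg_right ?_
      (majorant_nonneg (div_nonneg hc.le (sub_nonneg.2 hlt.le)) n)
    calc 48 * Real.pi * δ₀ / c * q
        ≤ 48 * Real.pi * δ₀ / c * ((24 * M + 64 * M ^ 2) * M) := by gcongr
      _ = 48 * Real.pi * δ₀ * (24 * M + 64 * M ^ 2) / c * M := by ring
      _ ≤ 1 * M := by gcongr; exact (div_le_one hc).2 hcM
      _ = M := one_mul M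
  induction N with
  | zero =>
    exact ⟨.zero (by rwa [taylorRho_zero]), .zero (by rwa [taylorVel_zero])⟩
  | succ n ih =>
    obtain ⟨hX, hW⟩ := ih
    refine ⟨hX.succ fun δ hδ hlt => ?_, hW.succ fun δ hδ hlt => ?_⟩
    · rw [taylorRho_succ]
      exact (hX.continuityStep hW hc hδ hlt).mono
        (absorb (by nlinarith [pow_nonneg hM 3]) hlt (n + 1))
    · rw [taylorVel_succ]
      exact (hX.velocityStep hW hc hδ hlt).mono (absorb (by nlinarith) hlt (n + 1))

end GrowthLE

end Growth

section GeometricBound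

variable {G : Type*}

/-- The power series with coefficients `X` is dominated by the geometric series `∑ M κⁿ tⁿ`. -/
def GeometricLE (w : G → ℝ≥0) (M κ : ℝ) (X : ℕ → G → ℂ) : Prop :=
  ∀ n, WNormLE w (X n) (M * κ ^ n)

lemma exists_gt_mul_lt_one {κ r : ℝ} (h : κ * r < 1) : ∃ b > r, κ * b < 1 :=
  ((continuous_const_mul κ).continuousAt.eventually_lt_const h).exists_gt

lemma summable_mul_pow_of_mul_lt_one {κ r : ℝ} (M : ℝ) (hκ : 0 ≤ κ) (hr : 0 ≤ r)
    (h : κ * r < 1) : Summable fun n : ℕ => r ^ n * (M * κ ^ n) :=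
  ((summable_geometric_of_lt_one (mul_nonneg hκ hr) h).mul_left M).congr fun n => by
    rw [mul_pow]; ring

lemma hasDerivAt_tsum_pow_mul {M κ : ℝ} {z : ℕ → ℂ} {ζ : ℂ} (hκ : 0 ≤ κ)
    (hz : ∀ n, ‖z n‖ ≤ M * κ ^ n) (hζ : κ * ‖ζ‖ < 1) :
    HasDerivAt (fun ξ => ∑' n, ξ ^ n * z n) (∑' n, ζ ^ n * ((n + 1) * z (n + 1))) ζ := by
  obtain ⟨b, hb, hκb⟩ := exists_gt_mul_lt_one hζ
  have hb_nonneg : 0 ≤ b := (norm_nonneg ζ).trans hb.le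
  have hsum := summable_mul_pow_of_mul_lt_one M hκ hb_nonneg hκb
  have hζ_mem : ζ ∈ Metric.ball 0 b := mem_ball_zero_iff.2 hb
  have hdiff (n : ℕ) : DifferentiableOn ℂ (fun ξ => ξ ^ n * z n) (Metric.ball 0 b) := by fun_prop
  have hbound (n : ℕ) (ξ : ℂ) (hξ : ξ ∈ Metric.ball 0 b) : ‖ξ ^ n * z n‖ ≤ b ^ n * (M * κ ^ n) := by
    have := mem_ball_zero_iff.1 hξ
    rw [norm_mul, norm_pow]
    gcongr
    exact hz n
  have deriv_term (n : ℕ) : deriv (fun ξ => ξ ^ n * z n) ζ = n * ζ ^ (n - 1) * z n := by simp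
  have hderiv := Complex.hasSum_deriv_of_summable_norm hsum hdiff Metric.isOpen_ball hbound hζ_mem
  have hmain := ((Complex.differentiableOn_tsum_of_summable_norm hsum hdiff Metric.isOpen_ball
    hbound).differentiableAt (Metric.isOpen_ball.mem_nhds hζ_mem)).hasDerivAt
  rw [← hderiv.tsum_eq, hderiv.summable.tsum_eq_zero_add] at hmain
  refine hmain.congr_deriv ?_
  simp only [deriv_term, Nat.cast_zero, zero_mul, zero_add, Nat.add_sub_cancel]
  exact tsum_congr fun n => by push_cast; ring

lemma tendsto_tsum_abs_pow_sub_pow_mul {M κ t : ℝ} (hM : 0 ≤ M) (hκ : 0 ≤ κ)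
    (ht : κ * |t| < 1) :
    Tendsto (fun s : ℝ => ∑' n : ℕ, |s ^ n - t ^ n| * (M * κ ^ n)) (𝓝 t) (𝓝 0) := by
  obtain ⟨b, hb, hκb⟩ := exists_gt_mul_lt_one ht
  have hb_nonneg : 0 ≤ b := (abs_nonneg t).trans hb.le
  have hdom := (summable_mul_pow_of_mul_lt_one M hκ hb_nonneg hκb).mul_left 2
  rw [← tsum_zero (α := ℝ) (β := ℕ)]
  refine tendsto_tsum_of_dominated_convergence hdom (fun n => ?_) ?_
  · have : Continuous fun s : ℝ => |s ^ n - t ^ n| * (M * κ ^ n) := by fun_prop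
    simpa using this.tendsto t
  · filter_upwards [continuous_abs.continuousAt.eventually_lt_const hb] with s hs n
    rw [Real.norm_of_nonneg (by positivity)]
    calc |s ^ n - t ^ n| * (M * κ ^ n) ≤ (|s| ^ n + |t| ^ n) * (M * κ ^ n) := by
          rw [← abs_pow, ← abs_pow]
          gcongr
          exact abs_sub _ _
      _ ≤ (b ^ n + b ^ n) * (M * κ ^ n) := by gcongr
      _ = 2 * (b ^ n * (M * κ ^ n)) := by ring

lemma series_zero (X : ℕ → G → ℂ) : series 0 X = X 0 := by
  ext k
  rw [series, tsum_eq_single 0 fun n hn => by simp [hn]]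
  simp

lemma Hermitian.series [AddCommGroup G] {X : ℕ → G → ℂ} (hX : ∀ n, Hermitian (X n)) (t : ℝ) :
    Hermitian (series t X) := fun k => by
  simp only [DriftFluid.series, Complex.conj_tsum]
  exact tsum_congr fun n => by rw [map_mul, map_pow, Complex.conj_ofReal, hX n k]

namespace GeometricLE

variable {w w' : G → ℝ≥0} {M κ s t : ℝ} {X Z : ℕ → G → ℂ}

lemma mono_weight (hX : GeometricLE w' M κ X) (hw : w ≤ w') : GeometricLE w M κ X :=
  fun n => (hX n).mono_weight hw

lemma summableSeries (hX : GeometricLE w M κ X) (hκ : 0 ≤ κ) (ht : κ * |t| < 1) :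
    SummableSeries w t X :=
  ⟨_, hX, summable_mul_pow_of_mul_lt_one M hκ (abs_nonneg t) ht⟩

lemma summableSeries_deriv (hX : GeometricLE w M κ X) (hκ : 0 ≤ κ) (ht : κ * |t| < 1)
    (hZ : ∀ n, X (n + 1) = ((1 / (n + 1) : ℝ) : ℂ) • Z n) : SummableSeries w t Z := by
  have hr : ‖κ * |t|‖ < 1 := by rwa [Real.norm_of_nonneg (by positivity)]
  have hsum : Summable fun n : ℕ => ((n : ℝ) + 1) * (κ * |t|) ^ n :=
    ((summable_pow_mul_geometric_of_norm_lt_one 1 hr).add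
      (summable_geometric_of_norm_lt_one hr)).congr fun n => by ring
  refine ⟨fun n => ((n : ℝ) + 1) * (M * κ ^ (n + 1)), fun n => ?_,
    (hsum.mul_left (M * κ)).congr fun n => by simp only [mul_pow]; ring⟩
  have hZn : Z n = ((n + 1 : ℝ) : ℂ) • X (n + 1) := by
    rw [hZ, smul_smul, ← Complex.ofReal_mul, mul_one_div_cancel (by positivity), Complex.ofReal_one,
      one_smul]
  rw [hZn]
  have := (hX (n + 1)).smul ((n + 1 : ℝ) : ℂ)
  rwa [Complex.norm_real, Real.norm_of_nonneg (by positivity)] at this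

lemma hasDerivAt_synth_series {d : Type*} [Fintype d] {w : (d → ℤ) → ℝ≥0}
    {X Z : ℕ → (d → ℤ) → ℂ} (hX : GeometricLE w M κ X) (hw : 1 ≤ w) (hκ : 0 ≤ κ)
    (ht : κ * |t| < 1) (hZ : ∀ n, X (n + 1) = ((1 / (n + 1) : ℝ) : ℂ) • Z n)
    (x : UnitAddTorus d) :
    HasDerivAt (fun τ => synth (series τ X) x) (synth (series t Z) x) t := by
  have hbound (n : ℕ) : ‖synth (X n) x‖ ≤ M * κ ^ n :=
    (norm_synth_le ((hX n).summable_norm hw) x).trans ((hX n).tsum_norm_le hw)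
  have hderiv := (hasDerivAt_tsum_pow_mul (ζ := t) hκ hbound
    (by rwa [Complex.norm_real])).comp_ofReal
  rw [(hX.summableSeries_deriv hκ ht hZ).synth_series hw]
  refine (hderiv.congr_deriv (tsum_congr fun n => ?_)).congr_of_eventuallyEq ?_
  · rw [hZ, synth_smul]
    push_cast
    field_simp
  · filter_upwards [(continuous_const.mul continuous_abs).continuousAt.eventually_lt_const ht]
      with τ hτ
    exact (hX.summableSeries hκ hτ).synth_series hw x

lemma wNormLE_series_sub (hX : GeometricLE w M κ X) (hw : 1 ≤ w) (hκ : 0 ≤ κ)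
    (hs : κ * |s| < 1) (ht : κ * |t| < 1) :
    WNormLE w (series s X - series t X) (∑' n, |s ^ n - t ^ n| * (M * κ ^ n)) := by
  have series_sub : series s X - series t X
      = fun k => ∑' n, (((s ^ n - t ^ n : ℝ) : ℂ) • X n) k := by
    ext k
    have hsum_s := ((hX.summableSeries hκ hs).summable_apply hw k).of_norm
    have hsum_t := ((hX.summableSeries hκ ht).summable_apply hw k).of_norm
    rw [Pi.sub_apply, series, series, ← hsum_s.tsum_sub hsum_t]
    refine tsum_congr fun n => ?_
    rw [Pi.smul_apply, smul_eq_mul, ← sub_mul]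
    push_cast
    rfl
  rw [series_sub]
  refine WNormLE.tsum (fun n => ?_) ?_
  · have := (hX n).smul ((s ^ n - t ^ n : ℝ) : ℂ)
    rwa [Complex.norm_real, Real.norm_eq_abs] at this
  · refine Summable.of_nonneg_of_le (fun n => mul_nonneg (abs_nonneg _) (hX n).nonneg) (fun n => ?_)
      ((summable_mul_pow_of_mul_lt_one M hκ (abs_nonneg s) hs).add
        (summable_mul_pow_of_mul_lt_one M hκ (abs_nonneg t) ht))
    rw [← add_mul, ← abs_pow, ← abs_pow]
    exact mul_le_mul_of_nonneg_right (abs_sub _ _) (hX n).nonneg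

end GeometricLE

end GeometricBound

section SeriesFun

/-- The real function on the torus whose Fourier coefficients at time `t` are `series t X`. -/
def seriesFun (X : ℕ → (Fin 3 → ℤ) → ℂ) (t : ℝ) (x : T3) : ℝ := (synth (series t X) x).re

variable {δ M κ t T : ℝ} {X Z : ℕ → (Fin 3 → ℤ) → ℂ}

lemma HasFourierSeries.hasDerivAt_seriesFun {f : T3 → ℝ} {a : (Fin 3 → ℤ) → ℂ}
    (hf : HasFourierSeries 1 f a) (ha : HasSeries t Z a) (hX : GeometricLE (weight δ) M κ X)
    (hδ : 1 ≤ δ) (hκ : 0 ≤ κ) (ht : κ * |t| < 1)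
    (hZ : ∀ n, X (n + 1) = ((1 / (n + 1) : ℝ) : ℂ) • Z n) (x : T3) :
    HasDerivAt (fun s => seriesFun X s x) (f x) t := by
  have hderiv := hX.hasDerivAt_synth_series (one_le_weight hδ) hκ ht hZ x
  rw [ha.series_eq, ← hf.eq_synth] at hderiv
  exact Complex.reCLM.hasFDerivAt.comp_hasDerivAt t hderiv

lemma GeometricLE.hasFourierSeries (hX : GeometricLE (weight δ) M κ X) (hδ : 1 ≤ δ) (hκ : 0 ≤ κ)
    (hherm : ∀ n, Hermitian (X n)) (ht : κ * |t| < 1) :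
    HasFourierSeries δ (seriesFun X t) (series t X) :=
  .of_hermitian hδ (hX.summableSeries hκ ht).wnorm_series_ne_top (.series hherm t)

lemma mul_abs_lt_one_of_mem_Ico (hκ : 0 ≤ κ) (hT : κ * T ≤ 1) (ht : t ∈ Ico 0 T) :
    κ * |t| < 1 := by
  rw [abs_of_nonneg ht.1]
  rcases hκ.eq_or_lt with rfl | hκ
  · simp
  · exact (mul_lt_mul_of_pos_left ht.2 hκ).trans_le hT

lemma GeometricLE.continuousInB (hX : GeometricLE (weight δ) M κ X) (hδ : 1 ≤ δ) (hκ : 0 ≤ κ)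
    (hherm : ∀ n, Hermitian (X n)) (hT : κ * T ≤ 1) : ContinuousInB T δ (seriesFun X) := by
  have small {t : ℝ} (ht : t ∈ Ico 0 T) : κ * |t| < 1 := mul_abs_lt_one_of_mem_Ico hκ hT ht
  have hM : 0 ≤ M := by simpa using (hX 0).nonneg
  have hseries {t : ℝ} (ht : t ∈ Ico 0 T) := hX.hasFourierSeries hδ hκ hherm (small ht)
  refine ⟨fun t ht => (hseries ht).memB, fun t ht => squeeze_zero' (.of_forall fun s => ?_) ?_
    ((tendsto_tsum_abs_pow_sub_pow_mul hM hκ (small ht)).mono_left nhdsWithin_le_nhds)⟩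
  · rw [normB_eq_toReal_wnorm (zero_le_one.trans hδ)]
    exact ENNReal.toReal_nonneg
  · filter_upwards [self_mem_nhdsWithin] with s hs
    rw [normB_eq_toReal_wnorm (zero_le_one.trans hδ), ((hseries hs).sub (hseries ht)).fourierC_eq]
    have hsub := hX.wNormLE_series_sub (one_le_weight hδ) hκ (small hs) (small ht)
    exact ENNReal.toReal_le_of_le_ofReal hsub.nonneg hsub.2

end SeriesFun

section StrongSolutions

variable {δ T T' : ℝ} {u ρ v : ℝ → T3 → ℝ}

lemma abs_normB_sub_normB_le {φ ψ : T3 → ℝ} (hδ : 1 ≤ δ) (hφ : MemB δ φ) (hψ : MemB δ ψ) :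
    |normB δ φ - normB δ ψ| ≤ normB δ fun x => φ x - ψ x := by
  have hδ₀ : 0 ≤ δ := zero_le_one.trans hδ
  have sub_le {f g : T3 → ℝ} (hf : MemB δ f) (hg : MemB δ g) :
      normB δ f - normB δ g ≤ normB δ fun x => f x - g x := by
    have hf := hf.hasFourierSeries hδ
    have hg := hg.hasFourierSeries hδ
    have hfg := hf.sub hg
    rw [sub_le_iff_le_add, normB_eq_toReal_wnorm hδ₀, normB_eq_toReal_wnorm hδ₀,
      normB_eq_toReal_wnorm hδ₀, hfg.fourierC_eq,
      ← ENNReal.toReal_add hfg.wnorm_ne_top hg.wnorm_ne_top]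
    refine ENNReal.toReal_mono (ENNReal.add_ne_top.2 ⟨hfg.wnorm_ne_top, hg.wnorm_ne_top⟩) ?_
    simpa using wnorm_add_le (weight δ) (fourierC f - fourierC g) (fourierC g)
  have normB_sub_comm : (normB δ fun x => ψ x - φ x) = normB δ fun x => φ x - ψ x := by
    rw [normB_eq_toReal_wnorm hδ₀, normB_eq_toReal_wnorm hδ₀,
      ((hψ.hasFourierSeries hδ).sub (hφ.hasFourierSeries hδ)).fourierC_eq,
      ((hφ.hasFourierSeries hδ).sub (hψ.hasFourierSeries hδ)).fourierC_eq]
    simp only [wnorm, Pi.sub_apply, enorm_sub_rev]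
  exact abs_sub_le_iff.2 ⟨sub_le hφ hψ, normB_sub_comm ▸ sub_le hψ hφ⟩

namespace ContinuousInB

lemma continuousOn_normB (hδ : 1 ≤ δ) (h : ContinuousInB T δ u) :
    ContinuousOn (fun t => normB δ (u t)) (Ico 0 T) := fun t ht =>
  tendsto_iff_dist_tendsto_zero.2 <| squeeze_zero' (.of_forall fun _ => dist_nonneg)
    (eventually_mem_nhdsWithin.mono fun s hs =>
      abs_normB_sub_normB_le hδ (h.1 s hs) (h.1 t ht)) (h.2 t ht)

lemma exists_wNormLE (hδ : 1 ≤ δ) (h : ContinuousInB T δ u) (hT : T' < T) :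
    ∃ R, ∀ t ∈ Icc 0 T', WNormLE (weight δ) (fourierC (u t)) R := by
  have hsub : Icc 0 T' ⊆ Ico 0 T := Icc_subset_Ico_right hT
  obtain ⟨R, hR⟩ := isCompact_Icc.bddAbove_image ((h.continuousOn_normB hδ).mono hsub)
  refine ⟨R, fun t ht => (WNormLE.of_wnorm_ne_top
    ((h.1 t (hsub ht)).hasFourierSeries hδ).wnorm_ne_top).mono ?_⟩
  rw [← normB_eq_toReal_wnorm (zero_le_one.trans hδ)]
  exact hR (mem_image_of_mem _ ht)

end ContinuousInB

lemma exists_isBoundedSolution {q : ℝ → UnitAddCircle → ℝ} (hδ : 1 < δ)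
    (hρ : ContinuousInB T δ ρ) (hv : ContinuousInB T δ v)
    (rho_deriv : ∀ t ∈ Ico 0 T, ∀ x,
      HasDerivWithinAt (fun s => ρ s x) (continuityRhs (ρ t) (v t) x) (Ico 0 T) t)
    (vel_deriv : ∀ t ∈ Ico 0 T, ∀ x,
      HasDerivWithinAt (fun s => v s x) (advection (ρ t) (v t) x - q t (x 2)) (Ico 0 T) t)
    (hT : T' < T) : ∃ R₀, ∀ R ≥ R₀, IsBoundedSolution δ R T' ρ v q := by
  have hsub : Icc 0 T' ⊆ Ico 0 T := Icc_subset_Ico_right hT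
  obtain ⟨Rρ, rho_bound⟩ := hρ.exists_wNormLE hδ.le hT
  obtain ⟨Rv, vel_bound⟩ := hv.exists_wNormLE hδ.le hT
  exact ⟨max Rρ Rv, fun R hR =>
    { one_lt := hδ
      rho := fun t ht => (hρ.1 t (hsub ht)).hasFourierSeries hδ.le
      vel := fun t ht => (hv.1 t (hsub ht)).hasFourierSeries hδ.le
      rho_bound := fun t ht => (rho_bound t ht).mono ((le_max_left _ _).trans hR)
      vel_bound := fun t ht => (vel_bound t ht).mono ((le_max_right _ _).trans hR)
      rho_deriv := fun t ht x => (rho_deriv t (hsub ht) x).mono hsub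
      vel_deriv := fun t ht x => (vel_deriv t (hsub ht) x).mono hsub }⟩

lemma exists_eq_add_const_of_dPar_eq {g g' : UnitAddCircle → ℝ}
    (hg : Differentiable ℝ fun s : ℝ => g (s : UnitAddCircle))
    (hg' : Differentiable ℝ fun s : ℝ => g' (s : UnitAddCircle))
    (heq : ∀ z, dPar g z = dPar g' z) : ∃ c : ℝ, ∀ z, g z = g' z + c := by
  have dPar_sub (z : UnitAddCircle) : dPar (fun z => g z - g' z) z = 0 := by
    obtain ⟨y, rfl⟩ := QuotientAddGroup.mk_surjective z
    refine (hasDerivAt_dPar (hg.fun_sub hg') y).unique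
      (((hasDerivAt_dPar hg y).fun_sub (hasDerivAt_dPar hg' y)).congr_deriv ?_)
    rw [heq, sub_self]
  refine ⟨g 0 - g' 0, fun z => ?_⟩
  have := eq_of_dPar_eq_zero (hg.fun_sub hg') dPar_sub z 0
  linarith

namespace IsStrongSolution

variable {δ₁ t : ℝ} {ρ₀ v₀ : T3 → ℝ} {ρ' v' : ℝ → T3 → ℝ} {p p' : ℝ → UnitAddCircle → ℝ}

lemma exists_isBoundedSolution (h : IsStrongSolution δ₁ T ρ₀ v₀ ρ v p) (hδ : 1 < δ)
    (hlt : δ < δ₁) (hT₀ : 0 < T') (hT : T' < T) :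
    PressureLaw T' ρ v (fun t => dPar (p t)) ∧
      ∃ R₀, ∀ R ≥ R₀, IsBoundedSolution δ R T' ρ v fun t => dPar (p t) := by
  have hsub : Icc 0 T' ⊆ Ico 0 T := Icc_subset_Ico_right hT
  obtain ⟨R₀, hR₀⟩ := DriftFluid.exists_isBoundedSolution hδ (h.rho_mem δ hδ hlt)
    (h.v_mem δ hδ hlt) h.eq_rho h.eq_v hT
  exact ⟨(hR₀ R₀ le_rfl).pressureLaw hT₀ (fun t ht => h.constraint t (hsub ht))
    (fun t ht => h.p_diff t (hsub ht)) fun _ _ _ => rfl, R₀, hR₀⟩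

lemma neg_dPar_pressure (h : IsStrongSolution δ₁ T ρ₀ v₀ ρ v p) (hδ₁ : 1 < δ₁)
    (ht : t ∈ Ico 0 T) (z : UnitAddCircle) :
    -dPar (p t) z = dPar (perpMean fun x => ρ t x * v t x ^ 2) z := by
  obtain ⟨δ, hδ, hlt⟩ := exists_between hδ₁
  obtain ⟨T', ht', hT⟩ := exists_between ht.2
  exact (h.exists_isBoundedSolution hδ hlt (ht.1.trans_lt ht') hT).1 t ⟨ht.1, ht'.le⟩ z

theorem unique (h : IsStrongSolution δ₁ T ρ₀ v₀ ρ v p) (h' : IsStrongSolution δ₁ T ρ₀ v₀ ρ' v' p')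
    (hδ₁ : 1 < δ₁) (ht : t ∈ Ico 0 T) :
    ρ' t = ρ t ∧ v' t = v t ∧ ∃ c : ℝ, ∀ z, p' t z = p t z + c := by
  obtain ⟨δ, hδ, hlt⟩ := exists_between hδ₁
  obtain ⟨T', ht', hT⟩ := exists_between ht.2
  obtain ⟨law, R, hR⟩ := h.exists_isBoundedSolution hδ hlt (ht.1.trans_lt ht') hT
  obtain ⟨law', R', hR'⟩ := h'.exists_isBoundedSolution hδ hlt (ht.1.trans_lt ht') hT
  obtain ⟨rho_eq, vel_eq⟩ := (hR' _ (le_max_right R R')).unique law' (hR _ (le_max_left R R')) law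
    (h'.init_rho.trans h.init_rho.symm) (h'.init_v.trans h.init_v.symm) ⟨ht.1, ht'.le⟩
  have dPar_eq (z : UnitAddCircle) : dPar (p' t) z = dPar (p t) z := by
    rw [← neg_inj, h'.neg_dPar_pressure hδ₁ ht, h.neg_dPar_pressure hδ₁ ht, rho_eq, vel_eq]
  exact ⟨rho_eq, vel_eq, exists_eq_add_const_of_dPar_eq (h'.p_diff t ht) (h.p_diff t ht) dPar_eq⟩

end IsStrongSolution

/-- The formal Taylor series in time of the solution with initial Fourier coefficients `(a, b)`
converges geometrically in `B_δ`, on `|t| < 1 / κ`. -/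
structure GeometricTaylor (δ M κ : ℝ) (a b : (Fin 3 → ℤ) → ℂ) : Prop where
  one_lt : 1 < δ
  rate_nonneg : 0 ≤ κ
  hermitian_rho : Hermitian a
  hermitian_vel : Hermitian b
  rho : GeometricLE (weight δ) M κ (taylorRho a b)
  vel : GeometricLE (weight δ) M κ (taylorVel a b)

lemma GrowthLE.geometricLE {δ₀ δ c A : ℝ} {X : ℕ → (Fin 3 → ℤ) → ℂ}
    (hX : ∀ n, GrowthLE δ₀ c n X A) (hA : 0 ≤ A) (hc : 0 ≤ c) (hδ : 1 ≤ δ) (hlt : δ < δ₀) :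
    GeometricLE (weight δ) A (c / (δ₀ - δ)) X := fun n =>
  (hX n n le_rfl δ hδ hlt).mono <| mul_le_mul_of_nonneg_left
    (majorant_le_pow (div_nonneg hc (sub_nonneg.2 hlt.le)) n) hA

lemma exists_geometricTaylor {δ₀ : ℝ} {a b : (Fin 3 → ℤ) → ℂ} (hδ₀ : 1 < δ₀)
    (ha : wnorm (weight δ₀) a ≠ ⊤) (hb : wnorm (weight δ₀) b ≠ ⊤) (ha' : Hermitian a)
    (hb' : Hermitian b) :
    ∃ c > 0, ∃ M, ∀ δ₁, 1 < δ₁ → δ₁ < δ₀ → GeometricTaylor δ₁ M (c / (δ₀ - δ₁)) a b := by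
  set M := max (wnorm (weight δ₀) a).toReal (wnorm (weight δ₀) b).toReal
  have rho_le : WNormLE (weight δ₀) a M := (WNormLE.of_wnorm_ne_top ha).mono (le_max_left _ _)
  have vel_le : WNormLE (weight δ₀) b M := (WNormLE.of_wnorm_ne_top hb).mono (le_max_right _ _)
  have hM : 0 ≤ M := rho_le.nonneg
  set c := 48 * Real.pi * δ₀ * (24 * M + 64 * M ^ 2) + 1
  have hc : 0 < c := by positivity
  have growth := GrowthLE.taylor hδ₀ hc (le_add_of_nonneg_right zero_le_one) rho_le vel_le
  exact ⟨c, hc, M, fun δ₁ hδ₁ hlt =>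
    { one_lt := hδ₁
      rate_nonneg := div_nonneg hc.le (sub_nonneg.2 hlt.le)
      hermitian_rho := ha'
      hermitian_vel := hb'
      rho := GrowthLE.geometricLE (fun n => (growth n).1) hM hc.le hδ₁.le hlt
      vel := GrowthLE.geometricLE (fun n => (growth n).2) hM hc.le hδ₁.le hlt }⟩

namespace GeometricTaylor

variable {δ' M κ t : ℝ} {a b : (Fin 3 → ℤ) → ℂ}

lemma mono (h : GeometricTaylor δ M κ a b) (hδ' : 1 < δ') (hle : δ' ≤ δ) :
    GeometricTaylor δ' M κ a b :=
  have hw := weight_mono (by linarith) hle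
  ⟨hδ', h.rate_nonneg, h.hermitian_rho, h.hermitian_vel, h.rho.mono_weight hw,
    h.vel.mono_weight hw⟩

lemma hasFourierSeries_rho (h : GeometricTaylor δ M κ a b) (ht : κ * |t| < 1) :
    HasFourierSeries δ (seriesFun (taylorRho a b) t) (series t (taylorRho a b)) :=
  h.rho.hasFourierSeries h.one_lt.le h.rate_nonneg
    (fun n => (hermitian_taylor h.hermitian_rho h.hermitian_vel n).1) ht

lemma hasFourierSeries_vel (h : GeometricTaylor δ M κ a b) (ht : κ * |t| < 1) :
    HasFourierSeries δ (seriesFun (taylorVel a b) t) (series t (taylorVel a b)) :=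
  h.vel.hasFourierSeries h.one_lt.le h.rate_nonneg
    (fun n => (hermitian_taylor h.hermitian_rho h.hermitian_vel n).2) ht

lemma continuousInB_rho (h : GeometricTaylor δ M κ a b) (hT : κ * T ≤ 1) :
    ContinuousInB T δ (seriesFun (taylorRho a b)) :=
  h.rho.continuousInB h.one_lt.le h.rate_nonneg
    (fun n => (hermitian_taylor h.hermitian_rho h.hermitian_vel n).1) hT

lemma continuousInB_vel (h : GeometricTaylor δ M κ a b) (hT : κ * T ≤ 1) :
    ContinuousInB T δ (seriesFun (taylorVel a b)) :=
  h.vel.continuousInB h.one_lt.le h.rate_nonneg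
    (fun n => (hermitian_taylor h.hermitian_rho h.hermitian_vel n).2) hT

lemma hasDerivAt_rho (h : GeometricTaylor δ M κ a b) (ht : κ * |t| < 1) (x : T3) :
    HasDerivAt (fun s => seriesFun (taylorRho a b) s x)
      (continuityRhs (seriesFun (taylorRho a b) t) (seriesFun (taylorVel a b) t) x) t :=
  ((h.hasFourierSeries_rho ht).continuityRhs le_rfl h.one_lt
    (h.hasFourierSeries_vel ht)).hasDerivAt_seriesFun
    (hasSeries_continuityStep (h.rho.summableSeries h.rate_nonneg ht)
      (h.vel.summableSeries h.rate_nonneg ht) (one_le_weight h.one_lt.le))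
    h.rho h.one_lt.le h.rate_nonneg ht (taylorRho_succ a b) x

lemma hasDerivAt_vel (h : GeometricTaylor δ M κ a b) (ht : κ * |t| < 1) (x : T3) :
    HasDerivAt (fun s => seriesFun (taylorVel a b) s x)
      (advection (seriesFun (taylorRho a b) t) (seriesFun (taylorVel a b) t) x
        + pressureForce (seriesFun (taylorRho a b) t) (seriesFun (taylorVel a b) t) (x 2)) t :=
  have hρ := h.hasFourierSeries_rho ht
  have hv := h.hasFourierSeries_vel ht
  ((hρ.advection le_rfl h.one_lt hv).add
    (hρ.pressureForce le_rfl h.one_lt hv)).hasDerivAt_seriesFun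
    (hasSeries_velocityStep (h.rho.summableSeries h.rate_nonneg ht)
      (h.vel.summableSeries h.rate_nonneg ht) (one_le_weight h.one_lt.le)
      (weight_add_le h.one_lt.le))
    h.vel h.one_lt.le h.rate_nonneg ht (taylorVel_succ a b) x

lemma seriesFun_rho_zero {ρ₀ : T3 → ℝ} (h : GeometricTaylor δ M κ a b)
    (hρ₀ : HasFourierSeries δ ρ₀ a) : seriesFun (taylorRho a b) 0 = ρ₀ := by
  have := h.hasFourierSeries_rho (t := 0) (by simp)
  rw [series_zero, taylorRho_zero] at this
  exact this.ext hρ₀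

lemma seriesFun_vel_zero {v₀ : T3 → ℝ} (h : GeometricTaylor δ M κ a b)
    (hv₀ : HasFourierSeries δ v₀ b) : seriesFun (taylorVel a b) 0 = v₀ := by
  have := h.hasFourierSeries_vel (t := 0) (by simp)
  rw [series_zero, taylorVel_zero] at this
  exact this.ext hv₀

theorem isStrongSolution {ρ₀ v₀ : T3 → ℝ} (h : GeometricTaylor δ M κ a b)
    (hρ₀ : HasFourierSeries δ ρ₀ a) (hv₀ : HasFourierSeries δ v₀ b)
    (hmean : ∀ z, perpMean ρ₀ z = 1)
    (hcurrent : ∀ z, dPar (perpMean fun x => ρ₀ x * v₀ x) z = 0) (hT : κ * T ≤ 1) :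
    IsStrongSolution δ T ρ₀ v₀ (seriesFun (taylorRho a b)) (seriesFun (taylorVel a b))
      fun t z => -perpMean
        (fun x => seriesFun (taylorRho a b) t x * seriesFun (taylorVel a b) t x ^ 2) z := by
  set ρ := seriesFun (taylorRho a b)
  set v := seriesFun (taylorVel a b)
  set p : ℝ → UnitAddCircle → ℝ := fun t z => -perpMean (fun x => ρ t x * v t x ^ 2) z
  have dPar_p (t : ℝ) (z : UnitAddCircle) : dPar (p t) z = -pressureForce (ρ t) (v t) z := by
    simp only [p, pressureForce, dPar, deriv.fun_neg]
  have small {t : ℝ} (ht : t ∈ Ico 0 T) : κ * |t| < 1 :=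
    mul_abs_lt_one_of_mem_Ico h.rate_nonneg hT ht
  have rho_deriv (t : ℝ) (ht : t ∈ Ico 0 T) (x : T3) :
      HasDerivWithinAt (fun s => ρ s x) (continuityRhs (ρ t) (v t) x) (Ico 0 T) t :=
    (h.hasDerivAt_rho (small ht) x).hasDerivWithinAt
  have vel_deriv (t : ℝ) (ht : t ∈ Ico 0 T) (x : T3) : HasDerivWithinAt (fun s => v s x)
      (advection (ρ t) (v t) x - dPar (p t) (x 2)) (Ico 0 T) t := by
    rw [dPar_p, sub_neg_eq_add]
    exact (h.hasDerivAt_vel (small ht) x).hasDerivWithinAt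
  have rho_zero : ρ 0 = ρ₀ := h.seriesFun_rho_zero hρ₀
  have vel_zero : v 0 = v₀ := h.seriesFun_vel_zero hv₀
  have rho_continuous : ContinuousInB T δ ρ := h.continuousInB_rho hT
  have vel_continuous : ContinuousInB T δ v := h.continuousInB_vel hT
  refine
    { rho_mem := fun δ' hδ' hlt => (h.mono hδ' hlt.le).continuousInB_rho hT
      v_mem := fun δ' hδ' hlt => (h.mono hδ' hlt.le).continuousInB_vel hT
      p_diff := fun t ht => (((h.hasFourierSeries_rho (small ht)).mul_sq
        (h.hasFourierSeries_vel (small ht))).differentiable_perpMean h.one_lt).neg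
      init_rho := rho_zero
      init_v := vel_zero
      eq_rho := rho_deriv
      eq_v := vel_deriv
      constraint := fun t ht => ?_ }
  obtain ⟨T', ht', hT'⟩ := exists_between ht.2
  obtain ⟨R, hR⟩ := exists_isBoundedSolution h.one_lt rho_continuous vel_continuous rho_deriv
    vel_deriv hT'
  exact (hR R le_rfl).perpMean_rho_eq_one (fun s _ z => neg_eq_iff_eq_neg.2 (dPar_p s z))
    (by rwa [rho_zero]) (by rwa [rho_zero, vel_zero]) ⟨ht.1, ht'.le⟩

end GeometricTaylor

theorem exists_isStrongSolution {δ₀ : ℝ} (hδ₀ : 1 < δ₀) {ρ₀ v₀ : T3 → ℝ} (hρ₀ : MemB δ₀ ρ₀)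
    (hv₀ : MemB δ₀ v₀) (hmean : ∀ z, perpMean ρ₀ z = 1)
    (hcurrent : ∀ z, dPar (perpMean fun x => ρ₀ x * v₀ x) z = 0) :
    ∃ η : ℝ, 0 < η ∧ ∀ δ₁ : ℝ, 1 < δ₁ → δ₁ < δ₀ → ∃ ρ v p,
      IsStrongSolution δ₁ (η * (δ₀ - δ₁)) ρ₀ v₀ ρ v p := by
  have rho_series := hρ₀.hasFourierSeries hδ₀.le
  have vel_series := hv₀.hasFourierSeries hδ₀.le
  obtain ⟨c, hc, M, htaylor⟩ := exists_geometricTaylor hδ₀ rho_series.wnorm_ne_top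
    vel_series.wnorm_ne_top rho_series.hermitian vel_series.hermitian
  refine ⟨1 / c, one_div_pos.2 hc, fun δ₁ hδ₁ hlt => ⟨_, _, _, (htaylor δ₁ hδ₁ hlt).isStrongSolution
    (rho_series.mono hδ₁.le hlt.le) (vel_series.mono hδ₁.le hlt.le) hmean hcurrent ?_⟩⟩
  have := sub_pos.2 hlt
  exact le_of_eq (by field_simp)

end StrongSolutions

end DriftFluid

end

theorem mainTheorem3_general (δ₀ : ℝ) (hδ₀ : 1 < δ₀) (ρ₀ v₀ : DriftFluid.T3 → ℝ)
    (hρ₀ : DriftFluid.MemB δ₀ ρ₀) (hv₀ : DriftFluid.MemB δ₀ v₀)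
    (hmean : ∀ z, DriftFluid.perpMean ρ₀ z = 1)
    (hcurrent : ∀ z, DriftFluid.dPar (DriftFluid.perpMean fun x => ρ₀ x * v₀ x) z = 0) :
    ∃ η : ℝ, 0 < η ∧ ∀ δ₁ : ℝ, 1 < δ₁ → δ₁ < δ₀ →
      ∃ (ρ v : ℝ → DriftFluid.T3 → ℝ) (p : ℝ → UnitAddCircle → ℝ),
        DriftFluid.IsStrongSolution δ₁ (η * (δ₀ - δ₁)) ρ₀ v₀ ρ v p ∧
        (∀ t ∈ Set.Ico 0 (η * (δ₀ - δ₁)), ∀ z,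
          -DriftFluid.dPar (p t) z =
            DriftFluid.dPar (DriftFluid.perpMean fun x => ρ t x * v t x ^ 2) z) ∧
        ∀ (ρ' v' : ℝ → DriftFluid.T3 → ℝ) (p' : ℝ → UnitAddCircle → ℝ),
          DriftFluid.IsStrongSolution δ₁ (η * (δ₀ - δ₁)) ρ₀ v₀ ρ' v' p' →
          ∀ t ∈ Set.Ico 0 (η * (δ₀ - δ₁)),
            ρ' t = ρ t ∧ v' t = v t ∧ ∃ c : ℝ, ∀ z, p' t z = p t z + c := by
  obtain ⟨η, hη, hsol⟩ := DriftFluid.exists_isStrongSolution hδ₀ hρ₀ hv₀ hmean hcurrent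
  refine ⟨η, hη, fun δ₁ hδ₁ hlt => ?_⟩
  obtain ⟨ρ, v, p, h⟩ := hsol δ₁ hδ₁ hlt
  exact ⟨ρ, v, p, h, fun t ht z => h.neg_dPar_pressure hδ₁ ht z,
    fun ρ' v' p' h' t ht => h.unique h' hδ₁ ht⟩

theorem mainTheorem3 (δ₀ : ℝ) (hδ₀ : 1 < δ₀) (ρ₀ v₀ : DriftFluid.T3 → ℝ)
    (hρ₀ : DriftFluid.MemB δ₀ ρ₀) (hv₀ : DriftFluid.MemB δ₀ v₀)
    (hpos : ∀ x, 0 ≤ ρ₀ x)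
    (hmean : ∀ z, DriftFluid.perpMean ρ₀ z = 1)
    (hcurrent : ∀ z, DriftFluid.dPar (DriftFluid.perpMean fun x => ρ₀ x * v₀ x) z = 0) :
    ∃ η : ℝ, 0 < η ∧ ∀ δ₁ : ℝ, 1 < δ₁ → δ₁ < δ₀ →
      ∃ (ρ v : ℝ → DriftFluid.T3 → ℝ) (p : ℝ → UnitAddCircle → ℝ),
        DriftFluid.IsStrongSolution δ₁ (η * (δ₀ - δ₁)) ρ₀ v₀ ρ v p ∧
        (∀ t ∈ Set.Ico 0 (η * (δ₀ - δ₁)), ∀ z,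
          -DriftFluid.dPar (p t) z =
            DriftFluid.dPar (DriftFluid.perpMean fun x => ρ t x * v t x ^ 2) z) ∧
        ∀ (ρ' v' : ℝ → DriftFluid.T3 → ℝ) (p' : ℝ → UnitAddCircle → ℝ),
          DriftFluid.IsStrongSolution δ₁ (η * (δ₀ - δ₁)) ρ₀ v₀ ρ' v' p' →
          ∀ t ∈ Set.Ico 0 (η * (δ₀ - δ₁)),
            ρ' t = ρ t ∧ v' t = v t ∧ ∃ c : ℝ, ∀ z, p' t z = p t z + c :=
  mainTheorem3_general δ₀ hδ₀ ρ₀ v₀ hρ₀ hv₀ hmean hcurrent
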